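/- Theorem. There are a constant $c$ and an algorithm (for a word RAM whose words have $O(\log n)$ bits, where each elementary operation takes one step) with the following property. Given, by a list of its edges, a finite simple graph $G$ of maximum degree at most $4$ with $n\ge 1$ vertices and $m$ edges, the algorithm computes in at most $c\,n$ steps a 1-bend RAC drawing of $G$ whose vertices and bends lie on points of the integer grid, whose area is at most $c\,n^2$, and in which at least $m/8$ edges are drawn as straight-line segments. Here a 1-bend RAC drawing of $G$ places the vertices at pairwise distinct points of the plane and draws each edge $uv$ as a simple polygonal curve from $u$ to $v$ that is either a straight-line segment or consists of two segments meeting at a bend, such that no edge passes through a vertex other than its two ends, and each common point of two distinct edges is either a common end of them or a crossing, that is, a point that is a bend of neither edge and in which the two edge segments meet at a right angle. The area is that of the smallest axis-parallel rectangle that encloses the drawing, measured as the number of grid points in that rectangle. -/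

import Mathlib

/-! ### One-bend right-angle-crossing drawings on the integer grid -/

/-- A point of the integer grid. -/
abbrev GridPoint := ℤ × ℤ

/-- A grid point, seen in the Euclidean plane. -/
def GridPoint.toPlane (p : GridPoint) : ℝ × ℝ := ((p.1 : ℝ), (p.2 : ℝ))

/-- The closed straight-line segment between two grid points. -/
def gridSegment (p q : GridPoint) : Set (ℝ × ℝ) := segment ℝ p.toPlane q.toPlane

/-- The directions of the segments `pq` and `p'q'` are orthogonal. -/
def GridPerp (p q p' q' : GridPoint) : Prop :=
  (q.1 - p.1) * (q'.1 - p'.1) + (q.2 - p.2) * (q'.2 - p'.2) = 0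

/-- The data of a polyline drawing on the grid with at most one bend per edge: a grid point for
each vertex and, for each edge, either no bend (the edge is a straight-line segment) or one bend at
a grid point. Only the values of `bend` at edges of the drawn graph are ever used. -/
structure OneBendDrawing (V : Type*) where
  pos : V → GridPoint
  bend : Sym2 V → Option GridPoint

namespace OneBendDrawing

variable {V : Type*}

/-- `pq` is one of the (one or two) segments of which the drawing of `e` consists. -/
def IsPiece (D : OneBendDrawing V) (e : Sym2 V) (p q : GridPoint) : Prop :=
  ∃ u v : V, e = s(u, v) ∧ p = D.pos u ∧
    ((D.bend e = none ∧ q = D.pos v) ∨ D.bend e = some q)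

/-- The set of points of the plane that are covered by the drawing of `e`. -/
def curve (D : OneBendDrawing V) (e : Sym2 V) : Set (ℝ × ℝ) :=
  {z | ∃ p q : GridPoint, D.IsPiece e p q ∧ z ∈ gridSegment p q}

/-- `z` is the bend of `e`. -/
def IsBendAt (D : OneBendDrawing V) (e : Sym2 V) (z : ℝ × ℝ) : Prop :=
  ∃ b : GridPoint, D.bend e = some b ∧ z = b.toPlane

/-- `D` is a 1-bend RAC drawing of `G`. -/
structure IsRAC (G : SimpleGraph V) (D : OneBendDrawing V) : Prop where
  /-- Distinct vertices are drawn at distinct points. -/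
  pos_injective : Function.Injective D.pos
  /-- A bend is not placed at an end of its edge, and an edge does not meet itself: its two segments
  have only the bend in common. -/
  edge_simple : ∀ (u v : V) (b : GridPoint), G.Adj u v → D.bend s(u, v) = some b →
    b ≠ D.pos u ∧ b ≠ D.pos v ∧
      gridSegment (D.pos u) b ∩ gridSegment (D.pos v) b = {b.toPlane}
  /-- No edge passes through a vertex that is not one of its ends. -/
  vertex_free : ∀ e ∈ G.edgeSet, ∀ w : V, (D.pos w).toPlane ∈ D.curve e → w ∈ e
  /-- A common point of two distinct edges is a common end, or it is a crossing: it is a bend of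
  neither edge, and the segments of the two edges that meet there are orthogonal. -/
  crossing : ∀ e ∈ G.edgeSet, ∀ f ∈ G.edgeSet, e ≠ f → ∀ z ∈ D.curve e ∩ D.curve f,
    (∃ w : V, w ∈ e ∧ w ∈ f ∧ z = (D.pos w).toPlane) ∨
      (¬ D.IsBendAt e z ∧ ¬ D.IsBendAt f z ∧
        ∀ p q p' q' : GridPoint, D.IsPiece e p q → z ∈ gridSegment p q →
          D.IsPiece f p' q' → z ∈ gridSegment p' q' → GridPerp p q p' q')

/-- The vertices and bends of the drawing. -/
def points (G : SimpleGraph V) (D : OneBendDrawing V) : Set GridPoint :=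
  Set.range D.pos ∪ {b | ∃ e ∈ G.edgeSet, D.bend e = some b}

/-- The width of the smallest enclosing axis-parallel rectangle. -/
noncomputable def width (G : SimpleGraph V) (D : OneBendDrawing V) : ℤ :=
  sSup (Prod.fst '' D.points G) - sInf (Prod.fst '' D.points G)

/-- The height of the smallest enclosing axis-parallel rectangle. -/
noncomputable def height (G : SimpleGraph V) (D : OneBendDrawing V) : ℤ :=
  sSup (Prod.snd '' D.points G) - sInf (Prod.snd '' D.points G)

/-- The area of a grid drawing, measured as the number of grid points in the smallest enclosing
rectangle; this is at least `width * height`, and a flat rectangle does not count as zero. -/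
noncomputable def area (G : SimpleGraph V) (D : OneBendDrawing V) : ℤ :=
  (D.width G + 1) * (D.height G + 1)

/-- The edges that are drawn as straight-line segments. -/
def straightEdges (G : SimpleGraph V) (D : OneBendDrawing V) : Set (Sym2 V) :=
  {e | e ∈ G.edgeSet ∧ D.bend e = none}

end OneBendDrawing

/-! ### A random access machine

Programs are while-programs over finitely many arrays of integers with random access. Each
elementary operation (constant, array access, arithmetic, comparison, assignment, branching) takes
one step. All numbers that occur, addresses included, have to be at most a given bound `B` in
absolute value, that is, to fit into a machine word. -/

namespace WordRAM

/-- The memory: `s a i` is the content of cell `i` of array `a`. -/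
abbrev Memory := ℕ → ℤ → ℤ

/-- The arithmetical operations; a comparison yields `1` for true and `0` for false. -/
inductive BinOp where
  | add | sub | mul | lt | eq

def BinOp.eval : BinOp → ℤ → ℤ → ℤ
  | .add, x, y => x + y
  | .sub, x, y => x - y
  | .mul, x, y => x * y
  | .lt, x, y => if x < y then 1 else 0
  | .eq, x, y => if x = y then 1 else 0

inductive Expr where
  | const (z : ℤ)
  | read (a : ℕ) (i : Expr)
  | bin (op : BinOp) (e f : Expr)

namespace Expr

def eval (s : Memory) : Expr → ℤ
  | const z => z
  | read a i => s a (i.eval s)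
  | bin op e f => op.eval (e.eval s) (f.eval s)

/-- The number of elementary operations in an expression. -/
def cost : Expr → ℕ
  | const _ => 1
  | read _ i => i.cost + 1
  | bin _ e f => e.cost + f.cost + 1

/-- The value of the expression and of each of its subexpressions fits into a word. -/
def Fits (B : ℕ) (s : Memory) : Expr → Prop
  | const z => |z| ≤ (B : ℤ)
  | read a i => i.Fits B s ∧ |s a (i.eval s)| ≤ (B : ℤ)
  | bin op e f => e.Fits B s ∧ f.Fits B s ∧ |op.eval (e.eval s) (f.eval s)| ≤ (B : ℤ)

end Expr

/-- Programs; `write a i e` is the assignment `a[i] := e`, and a test succeeds if its value is not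
zero. -/
inductive Program where
  | skip
  | write (a : ℕ) (i e : Expr)
  | seq (P Q : Program)
  | cond (e : Expr) (P Q : Program)
  | loop (e : Expr) (P : Program)

/-- The memory `s` after `a[i] := x`. -/
def Memory.set (s : Memory) (a : ℕ) (i x : ℤ) : Memory :=
  fun a' i' => if a' = a ∧ i' = i then x else s a' i'

/-- `Exec B P s t s'`: started in memory `s`, the program `P` halts after exactly `t` steps in
memory `s'`, and no number outside of the word range `[-B, B]` is computed on the way. -/
inductive Exec (B : ℕ) : Program → Memory → ℕ → Memory → Prop where
  | skip (s : Memory) : Exec B .skip s 1 s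
  | write (s : Memory) (a : ℕ) (i e : Expr) (hi : i.Fits B s) (he : e.Fits B s) :
      Exec B (.write a i e) s (i.cost + e.cost + 1) (s.set a (i.eval s) (e.eval s))
  | seq {P Q : Program} {s s₁ s₂ : Memory} {t₁ t₂ : ℕ}
      (hP : Exec B P s t₁ s₁) (hQ : Exec B Q s₁ t₂ s₂) :
      Exec B (.seq P Q) s (t₁ + t₂) s₂
  | cond_true {e : Expr} {P Q : Program} {s s₁ : Memory} {t : ℕ}
      (hf : e.Fits B s) (he : e.eval s ≠ 0) (hP : Exec B P s t s₁) :
      Exec B (.cond e P Q) s (e.cost + 1 + t) s₁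
  | cond_false {e : Expr} {P Q : Program} {s s₁ : Memory} {t : ℕ}
      (hf : e.Fits B s) (he : e.eval s = 0) (hQ : Exec B Q s t s₁) :
      Exec B (.cond e P Q) s (e.cost + 1 + t) s₁
  | loop_false {e : Expr} {P : Program} {s : Memory}
      (hf : e.Fits B s) (he : e.eval s = 0) :
      Exec B (.loop e P) s (e.cost + 1) s
  | loop_true {e : Expr} {P : Program} {s s₁ s₂ : Memory} {t₁ t₂ : ℕ}
      (hf : e.Fits B s) (he : e.eval s ≠ 0)
      (hP : Exec B P s t₁ s₁) (hL : Exec B (.loop e P) s₁ t₂ s₂) :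
      Exec B (.loop e P) s (e.cost + 1 + t₁ + t₂) s₂

end WordRAM

/-! ### Input and output format -/

/-- The `i`-th edge of a list of pairs of vertices. -/
def listedEdge {n m : ℕ} (E : Fin m → Fin n × Fin n) (i : Fin m) : Sym2 (Fin n) :=
  s((E i).1, (E i).2)

/-- `E` lists the edges of `G`, each exactly once, in an arbitrary order and with its two ends in an
arbitrary order. In particular, `G` has `m` edges. -/
def IsEdgeList {n m : ℕ} (G : SimpleGraph (Fin n)) (E : Fin m → Fin n × Fin n) : Prop :=
  Function.Injective (listedEdge E) ∧ Set.range (listedEdge E) = G.edgeSet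

/-- The memory that holds the graph with vertices `0, …, n - 1` and edge list `E`: array `0` starts
with `n` and `m`, the arrays `1` and `2` hold the first and second ends of the edges, and all other
cells hold `0`. -/
def inputMemory {n m : ℕ} (E : Fin m → Fin n × Fin n) : WordRAM.Memory := fun a i =>
  if a = 0 then (if i = 0 then (n : ℤ) else if i = 1 then (m : ℤ) else 0)
  else if h : 0 ≤ i ∧ i.toNat < m then
    (if a = 1 then ((E ⟨i.toNat, h.2⟩).1 : ℤ)
    else if a = 2 then ((E ⟨i.toNat, h.2⟩).2 : ℤ)
    else 0)
  else 0

/-- The memory `s` holds the drawing `D` of the graph with edge list `E`: the position of vertex `v`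
is in cell `v` of the arrays `3` and `4`; cell `i` of array `5` tells whether the `i`-th edge has a
bend, and then the bend is in cell `i` of the arrays `6` and `7`. -/
def HoldsDrawing {n m : ℕ} (E : Fin m → Fin n × Fin n) (s : WordRAM.Memory)
    (D : OneBendDrawing (Fin n)) : Prop :=
  (∀ v : Fin n, D.pos v = (s 3 (v : ℤ), s 4 (v : ℤ))) ∧
  (∀ i : Fin m, D.bend (listedEdge E i) =
    if s 5 (i : ℤ) = 0 then none else some (s 6 (i : ℤ), s 7 (i : ℤ)))

/-! Splitting. Cut each edge into two half-edges and colour the half-edges with two colours so that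
the halves of an edge differ and the colours are balanced at each vertex. This orients the edges
with at most two arcs leaving and at most two entering each vertex. A second such colouring,
balanced separately on the outgoing and the incoming half-edges of each vertex, splits the arcs into
two classes, in each of which a vertex has at most one outgoing and at most one incoming arc. Both
colourings come from one principle: pair up half-edges, with equal keys as far as possible. This
matching and the matching of half-edges by edges together form even alternating cycles, which can be
2-coloured (`PerfectPairing.card_color_le`, `CycleColoring.step`, `color_ne`). The larger class is
called `F`; it has at least half of the edges, and its components are directed paths and cycles, the
blocks.

Placing. The blocks occupy consecutive squares along the diagonal, and all vertices have distinct
rows and distinct columns. An arc outside `F` leaves its tail horizontally and enters its head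
vertically; an arc of `F` leaves its tail vertically and enters its head horizontally, unless it
joins diagonally neighbouring points and is drawn straight. So the at most four edges at a vertex
use its four axis-parallel directions, provided that two horizontal (or two vertical) ones leave
oppositely. Away from common ends, segments of distinct edges then either do not meet or cross as an
exactly horizontal and an exactly vertical segment. Coordinates are multiplied by four, so that a
segment may be tilted by one unit where it would otherwise overlap another or obstruct a crossing.

Bends within `F`. A path block is drawn straight along a diagonal. In a cyclic block, choose a start
whose outgoing arc outside `F` is absent or leaves the block, and a turn whose incoming arc outside
`F` is absent or comes from another block. Rotate the cycle so that it begins at the start, and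
raise the part up to the turn above the rest. Then start and turn lie on the boundary of the square,
only the arc into the start and the arc out of the turn are bent, and a reflection makes these arcs
and the arcs to other blocks leave in opposite directions (`port_mixed`, `port_mixed'`). If a block
has no start, then no arc outside `F` leaves it, and by pigeonhole none enters it (`closed`); then
one tilted arc around the corner of the square closes the cycle. If a start exists, so does a turn
(`turn_of_S_ne_zero`).

Counting. A block has at most two bent arcs of `F`. A block with a bent arc is a cycle of length at
least three, because the graph is simple, and it contains a straight arc. So at least a third of
`F`, hence a sixth of all edges, is straight (`card_F_le`), which is more than what is required.

Running time. All programs are free of multiplication and keep the memory linearly bounded, so that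
intermediate values are at most a constant times the memory bound, and the time is at most the
program size times the number of loop iterations plus one (`Steps.exec`). Hence only functional
correctness and iteration counts have to be verified. -/

/-! ### A program logic for the random access machine -/

namespace WordRAM

/-- No multiplication occurs in the expression. -/
def Expr.mulFree : Expr → Bool
  | .const _ => true
  | .read _ i => i.mulFree
  | .bin op e f => (match op with | .mul => false | _ => true) && e.mulFree && f.mulFree

/-- If all memory cells are at most `W ≥ 1` in absolute value, then the value of a
multiplication-free expression is at most `weight * W`. -/
def Expr.weight : Expr → ℕ
  | .const z => z.natAbs + 1
  | .read _ i => i.weight + 1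
  | .bin _ e f => e.weight + f.weight

def Program.mulFree : Program → Bool
  | .skip => true
  | .write _ i e => i.mulFree && e.mulFree
  | .seq P Q => P.mulFree && Q.mulFree
  | .cond e P Q => e.mulFree && P.mulFree && Q.mulFree
  | .loop e P => e.mulFree && P.mulFree

def Program.weight : Program → ℕ
  | .skip => 1
  | .write _ i e => i.weight + e.weight
  | .seq P Q => P.weight + Q.weight
  | .cond e P Q => e.weight + P.weight + Q.weight
  | .loop e P => e.weight + P.weight

/-- The number of elementary operations in the text of a program. -/
def Program.size : Program → ℕ
  | .skip => 1
  | .write _ i e => i.cost + e.cost + 1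
  | .seq P Q => P.size + Q.size
  | .cond e P Q => e.cost + 1 + P.size + Q.size
  | .loop e P => e.cost + 1 + P.size

/-- The arrays that a program may write to. -/
def Program.writes : Program → List ℕ
  | .skip => []
  | .write a _ _ => [a]
  | .seq P Q => P.writes ++ Q.writes
  | .cond _ P Q => P.writes ++ Q.writes
  | .loop _ P => P.writes

/-- All memory cells are at most `W` in absolute value. -/
def Memory.Bounded (W : ℕ) (s : Memory) : Prop := ∀ a i, |s a i| ≤ (W : ℤ)

/-- Sums and differences at most add the bounds of their operands, and a read value is bounded by
the memory. Only a product could grow faster than linearly in `W`. -/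
theorem Expr.abs_eval_le {W : ℕ} (hW : 1 ≤ W) {s : Memory} (hs : s.Bounded W) :
    ∀ e : Expr, e.mulFree = true → |e.eval s| ≤ ((e.weight * W : ℕ) : ℤ)
  | .const z, _ => by
    have h1 : (1 : ℤ) ≤ W := by exact_mod_cast hW
    have h2 := abs_nonneg z
    simp only [eval, weight]; push_cast; nlinarith
  | .read a i, _ => by
    refine (hs a _).trans ?_
    simp only [weight]; push_cast
    nlinarith [Int.natCast_nonneg W, Int.natCast_nonneg i.weight,
      mul_nonneg (Int.natCast_nonneg W) (Int.natCast_nonneg i.weight)]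
  | .bin op e f, h => by
    simp only [mulFree, Bool.and_eq_true] at h
    have he := e.abs_eval_le hW hs h.1.2
    have hf := f.abs_eval_le hW hs h.2
    have pos : ∀ g : Expr, 1 ≤ g.weight := by
      intro g; induction g <;> simp only [weight] <;> omega
    have hb : (1 : ℤ) ≤ ((e.weight + f.weight) * W : ℕ) := by
      exact_mod_cast Nat.mul_pos (by have := pos e; omega) hW
    simp only [eval, weight]
    rw [abs_le] at he hf ⊢
    rw [Nat.add_mul] at hb ⊢
    push_cast at *
    cases op with
    | add => simp only [BinOp.eval]; constructor <;> linarith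
    | sub => simp only [BinOp.eval]; constructor <;> linarith
    | mul => simp at h
    | lt => simp only [BinOp.eval]; split_ifs <;> constructor <;> linarith
    | eq => simp only [BinOp.eval]; split_ifs <;> constructor <;> linarith

theorem Expr.fits_of_weight {W B : ℕ} (hW : 1 ≤ W) {s : Memory} (hs : s.Bounded W) :
    ∀ e : Expr, e.mulFree = true → e.weight * W ≤ B → e.Fits B s
  | .const z, h, hB => (abs_eval_le hW hs (.const z) h).trans (by exact_mod_cast hB)
  | .read a i, h, hB =>
    ⟨i.fits_of_weight hW hs h
      (le_trans (Nat.mul_le_mul_right _ (by simp only [weight]; omega)) hB),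
      (abs_eval_le hW hs (.read a i) h).trans (by exact_mod_cast hB)⟩
  | .bin op e f, h, hB => by
    have h' := h
    simp only [mulFree, Bool.and_eq_true] at h'
    exact ⟨e.fits_of_weight hW hs h'.1.2
        (le_trans (Nat.mul_le_mul_right _ (by simp only [weight]; omega)) hB),
      f.fits_of_weight hW hs h'.2
        (le_trans (Nat.mul_le_mul_right _ (by simp only [weight]; omega)) hB),
      (abs_eval_le hW hs (.bin op e f) h).trans (by exact_mod_cast hB)⟩

/-- Execution that records the number of loop iterations only, and in which the written values are
at most `W` in absolute value. -/
inductive Steps (W : ℕ) : Program → Memory → ℕ → Memory → Prop where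
  | skip (s : Memory) : Steps W .skip s 0 s
  | write (s : Memory) (a : ℕ) (i e : Expr) (h : |e.eval s| ≤ (W : ℤ)) :
      Steps W (.write a i e) s 0 (s.set a (i.eval s) (e.eval s))
  | seq {P Q : Program} {s s₁ s₂ : Memory} {k₁ k₂ : ℕ} :
      Steps W P s k₁ s₁ → Steps W Q s₁ k₂ s₂ → Steps W (.seq P Q) s (k₁ + k₂) s₂
  | cond_true {e : Expr} {P Q : Program} {s s₁ : Memory} {k : ℕ} :
      e.eval s ≠ 0 → Steps W P s k s₁ → Steps W (.cond e P Q) s k s₁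
  | cond_false {e : Expr} {P Q : Program} {s s₁ : Memory} {k : ℕ} :
      e.eval s = 0 → Steps W Q s k s₁ → Steps W (.cond e P Q) s k s₁
  | loop_false {e : Expr} {P : Program} {s : Memory} :
      e.eval s = 0 → Steps W (.loop e P) s 0 s
  | loop_true {e : Expr} {P : Program} {s s₁ s₂ : Memory} {k₁ k₂ : ℕ} :
      e.eval s ≠ 0 → Steps W P s k₁ s₁ → Steps W (.loop e P) s₁ k₂ s₂ →
      Steps W (.loop e P) s (k₁ + k₂ + 1) s₂

/-- Between two loop iterations each command of the text is executed at most once; this bounds the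
time by the size times `k + 1`. Written values stay below `W` by `Steps`, and intermediate values
fit into words because of their weight. This reduces the machine model to counting iterations. -/
theorem Steps.exec {W B : ℕ} (hW : 1 ≤ W) {P : Program} {s s' : Memory} {k : ℕ}
    (h : Steps W P s k s') :
    P.mulFree = true → P.weight * W ≤ B → s.Bounded W →
      s'.Bounded W ∧ ∃ t, Exec B P s t s' ∧ t ≤ P.size * (k + 1) := by
  induction h with
  | skip s => exact fun _ _ hs => ⟨hs, 1, .skip s, by simp [Program.size]⟩
  | write s a i e h =>
    intro hm hB hs
    simp only [Program.mulFree, Bool.and_eq_true] at hm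
    simp only [Program.weight, Nat.add_mul] at hB
    refine ⟨fun a' i' => ?_, _, .write s a i e (i.fits_of_weight hW hs hm.1 (by omega))
      (e.fits_of_weight hW hs hm.2 (by omega)), by simp [Program.size]⟩
    simp only [Memory.set]
    split_ifs
    · exact h
    · exact hs _ _
  | @seq P Q s s₁ s₂ k₁ k₂ _ _ ih₁ ih₂ =>
    intro hm hB hs
    simp only [Program.mulFree, Bool.and_eq_true] at hm
    simp only [Program.weight, Nat.add_mul] at hB
    obtain ⟨hs₁, t₁, e₁, l₁⟩ := ih₁ hm.1 (by omega) hs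
    obtain ⟨hs₂, t₂, e₂, l₂⟩ := ih₂ hm.2 (by omega) hs₁
    refine ⟨hs₂, _, .seq e₁ e₂, ?_⟩
    simp only [Program.size]
    nlinarith [Nat.zero_le (P.size * k₂), Nat.zero_le (Q.size * k₁)]
  | @cond_true e P Q s s₁ k he _ ih =>
    intro hm hB hs
    simp only [Program.mulFree, Bool.and_eq_true] at hm
    simp only [Program.weight, Nat.add_mul] at hB
    obtain ⟨hs₁, t₁, e₁, l₁⟩ := ih hm.1.2 (by omega) hs
    refine ⟨hs₁, _, .cond_true (e.fits_of_weight hW hs hm.1.1 (by omega)) he e₁, ?_⟩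
    simp only [Program.size]
    nlinarith [Nat.zero_le (Q.size * (k + 1)), Nat.zero_le (e.cost * k)]
  | @cond_false e P Q s s₁ k he _ ih =>
    intro hm hB hs
    simp only [Program.mulFree, Bool.and_eq_true] at hm
    simp only [Program.weight, Nat.add_mul] at hB
    obtain ⟨hs₁, t₁, e₁, l₁⟩ := ih hm.2 (by omega) hs
    refine ⟨hs₁, _, .cond_false (e.fits_of_weight hW hs hm.1.1 (by omega)) he e₁, ?_⟩
    simp only [Program.size]
    nlinarith [Nat.zero_le (P.size * (k + 1)), Nat.zero_le (e.cost * k)]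
  | @loop_false e P s he =>
    intro hm hB hs
    simp only [Program.mulFree, Bool.and_eq_true] at hm
    simp only [Program.weight, Nat.add_mul] at hB
    exact ⟨hs, _, .loop_false (e.fits_of_weight hW hs hm.1 (by omega)) he,
      by simp [Program.size]⟩
  | @loop_true e P s s₁ s₂ k₁ k₂ he _ _ ih₁ ih₂ =>
    intro hm hB hs
    have hm' := hm
    have hB' := hB
    simp only [Program.mulFree, Bool.and_eq_true] at hm
    simp only [Program.weight, Nat.add_mul] at hB
    obtain ⟨hs₁, t₁, e₁, l₁⟩ := ih₁ hm.2 (by omega) hs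
    obtain ⟨hs₂, t₂, e₂, l₂⟩ := ih₂ hm' hB' hs₁
    refine ⟨hs₂, _, .loop_true (e.fits_of_weight hW hs hm.1 (by omega)) he e₁ e₂, ?_⟩
    simp only [Program.size] at l₂ ⊢
    nlinarith [Nat.zero_le (P.size * k₂), Nat.zero_le (e.cost * k₁), Nat.zero_le (e.cost * k₂)]

/-- A program does not change the arrays that it does not write to. -/
theorem Steps.frame {W : ℕ} {P : Program} {s s' : Memory} {k : ℕ} (h : Steps W P s k s') :
    ∀ a, a ∉ P.writes → s' a = s a := by
  induction h with
  | skip s => exact fun _ _ => rfl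
  | write s a i e h =>
    intro a' ha
    simp only [Program.writes, List.mem_singleton] at ha
    funext j
    simp [Memory.set, ha]
  | seq _ _ ih₁ ih₂ =>
    intro a ha
    simp only [Program.writes, List.mem_append, not_or] at ha
    rw [ih₂ a ha.2, ih₁ a ha.1]
  | cond_true _ _ ih =>
    intro a ha
    simp only [Program.writes, List.mem_append, not_or] at ha
    exact ih a ha.1
  | cond_false _ _ ih =>
    intro a ha
    simp only [Program.writes, List.mem_append, not_or] at ha
    exact ih a ha.2
  | loop_false _ => exact fun _ _ => rfl
  | loop_true _ _ _ ih₁ ih₂ =>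
    intro a ha
    rw [ih₂ a ha, ih₁ a ha]

/-- Started in `s`, the program `P` makes at most `k` loop iterations and ends in a memory that
satisfies `Q` and differs from `s` only in the arrays that `P` writes to. -/
def Runs (W : ℕ) (P : Program) (s : Memory) (k : ℕ) (Q : Memory → Prop) : Prop :=
  ∃ k' s', Steps W P s k' s' ∧ k' ≤ k ∧ (∀ a, a ∉ P.writes → s' a = s a) ∧ Q s'

theorem Runs.mono {W : ℕ} {P : Program} {s : Memory} {k k₁ : ℕ} {Q Q₁ : Memory → Prop}
    (h : Runs W P s k Q) (hk : k ≤ k₁)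
    (hQ : ∀ s', (∀ a, a ∉ P.writes → s' a = s a) → Q s' → Q₁ s') : Runs W P s k₁ Q₁ := by
  obtain ⟨k', s', h1, h2, h3, h4⟩ := h
  exact ⟨k', s', h1, h2.trans hk, h3, hQ s' h3 h4⟩

theorem Runs.seq {W : ℕ} {P P' : Program} {s : Memory} {k k₁ k₂ : ℕ} {Q Q' : Memory → Prop}
    (h : Runs W P s k₁ Q)
    (h' : ∀ s', (∀ a, a ∉ P.writes → s' a = s a) → Q s' → Runs W P' s' k₂ Q')
    (hk : k₁ + k₂ ≤ k) : Runs W (.seq P P') s k Q' := by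
  obtain ⟨l, s₁, h1, h2, h3, h4⟩ := h
  obtain ⟨l', s₂, g1, g2, g3, g4⟩ := h' s₁ h3 h4
  exact ⟨l + l', s₂, .seq h1 g1, by omega, (Steps.seq h1 g1).frame, g4⟩

/-- The weakest precondition of a loop-free program. -/
def Program.wp (W : ℕ) : Program → (Memory → Prop) → Memory → Prop
  | .skip, Q, s => Q s
  | .write a i e, Q, s => |e.eval s| ≤ (W : ℤ) ∧ Q (s.set a (i.eval s) (e.eval s))
  | .seq P R, Q, s => P.wp W (R.wp W Q) s
  | .cond e P R, Q, s => (e.eval s ≠ 0 → P.wp W Q s) ∧ (e.eval s = 0 → R.wp W Q s)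
  | .loop _ _, _, _ => False

theorem Program.steps_of_wp {W : ℕ} : ∀ (P : Program) (Q : Memory → Prop) (s : Memory),
    P.wp W Q s → ∃ s', Steps W P s 0 s' ∧ Q s'
  | .skip, _, s, h => ⟨s, .skip s, h⟩
  | .write a i e, _, s, h => ⟨_, .write s a i e h.1, h.2⟩
  | .seq P R, Q, s, h => by
    obtain ⟨s₁, h1, h2⟩ := P.steps_of_wp _ s h
    obtain ⟨s₂, h3, h4⟩ := R.steps_of_wp _ s₁ h2
    exact ⟨s₂, .seq h1 h3, h4⟩
  | .cond e P R, Q, s, h => by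
    by_cases he : e.eval s = 0
    · obtain ⟨s₁, h1, h2⟩ := R.steps_of_wp _ s (h.2 he)
      exact ⟨s₁, .cond_false he h1, h2⟩
    · obtain ⟨s₁, h1, h2⟩ := P.steps_of_wp _ s (h.1 he)
      exact ⟨s₁, .cond_true he h1, h2⟩

theorem Runs.of_wp {W : ℕ} {P : Program} {s : Memory} {k : ℕ} {Q : Memory → Prop}
    (h : P.wp W Q s) : Runs W P s k Q := by
  obtain ⟨s', h1, h2⟩ := P.steps_of_wp Q s h
  exact ⟨0, s', h1, Nat.zero_le _, h1.frame, h2⟩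

/-- Loops with a loop-free body, a measure, and an invariant. -/
theorem Runs.loop {W : ℕ} {e : Expr} {P : Program} (Inv : ℕ → Memory → Prop)
    (hbody : ∀ μ s, Inv μ s → e.eval s ≠ 0 → P.wp W (fun s' => ∃ μ' < μ, Inv μ' s') s)
    {μ : ℕ} {s : Memory} (hs : Inv μ s) :
    Runs W (.loop e P) s μ (fun s' => e.eval s' = 0 ∧ ∃ μ', Inv μ' s') := by
  induction μ using Nat.strong_induction_on generalizing s with
  | _ μ ih =>
    by_cases he : e.eval s = 0
    · exact ⟨0, s, .loop_false he, Nat.zero_le _, fun _ _ => rfl, he, μ, hs⟩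
    · obtain ⟨s₁, h1, μ', hμ, h2⟩ := P.steps_of_wp _ s (hbody μ s hs he)
      obtain ⟨k, s₂, g1, g2, g3, g4⟩ := ih μ' hμ h2
      have := Steps.loop_true he h1 g1
      exact ⟨_, s₂, this, by omega, this.frame, g4⟩

/-- The scalar variable stored in cell `0` of the array `a`. -/
abbrev Expr.var (a : ℕ) : Expr := .read a (.const 0)

/-- `for a := 0 to b - 1 do P`, with scalar variables `a` and `b`. -/
def Program.forLoop (a b : ℕ) (P : Program) : Program :=
  .seq (.write a (.const 0) (.const 0))
    (.loop (.bin .lt (.var a) (.var b))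
      (.seq P (.write a (.const 0) (.bin .add (.var a) (.const 1)))))

theorem Memory.set_same (s : Memory) (a : ℕ) (i x : ℤ) :
    (s.set a i x) a = Function.update (s a) i x := by
  funext j; simp [Memory.set, Function.update_apply]

theorem Memory.set_ne (s : Memory) {a a' : ℕ} (h : a' ≠ a) (i x : ℤ) :
    (s.set a i x) a' = s a' := by
  funext j; simp [Memory.set, h]

theorem Program.wp_mono {W : ℕ} : ∀ (P : Program) {Q Q' : Memory → Prop} {s : Memory},
    P.wp W Q s → (∀ s', (∀ a, a ∉ P.writes → s' a = s a) → Q s' → Q' s') → P.wp W Q' s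
  | .skip, _, _, s, h, hQ => hQ s (fun _ _ => rfl) h
  | .write a i e, _, _, s, h, hQ => ⟨h.1, hQ _ (fun a' ha => Memory.set_ne _ (by
      simpa [writes] using ha) _ _) h.2⟩
  | .seq P R, Q, Q', s, h, hQ => by
    refine P.wp_mono (Q := R.wp W Q) h (fun s₁ h1 h2 => R.wp_mono h2 (fun s₂ h3 h4 => ?_))
    refine hQ s₂ (fun a ha => ?_) h4
    simp only [writes, List.mem_append, not_or] at ha
    rw [h3 a ha.2, h1 a ha.1]
  | .cond e P R, Q, Q', s, h, hQ => by
    refine ⟨fun he => P.wp_mono (h.1 he) fun s' h1 => hQ s' fun a ha => h1 a ?_,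
      fun he => R.wp_mono (h.2 he) fun s' h1 => hQ s' fun a ha => h1 a ?_⟩ <;>
    · simp only [writes, List.mem_append, not_or] at ha
      first | exact ha.1 | exact ha.2

/-- The rule for `for`-loops with a loop-free body. The invariant may refer to all arrays, except
that it has to be insensitive to the loop variable. -/
theorem Runs.forLoop {W N : ℕ} {a b : ℕ} {P : Program} (Inv : ℕ → Memory → Prop) {s : Memory}
    (hab : a ≠ b) (hPa : a ∉ P.writes) (hPb : b ∉ P.writes) (hN : s b 0 = N) (hW : N ≤ W)
    (hset : ∀ j s x, Inv j s → Inv j (s.set a 0 x)) (h0 : Inv 0 s)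
    (hbody : ∀ (j : ℕ) (s' : Memory), j < N → (∀ c, c ∉ P.writes → s' c = s.set a 0 j c) →
      Inv j s' → P.wp W (fun s'' => Inv (j + 1) s'') s') :
    Runs W (.forLoop a b P) s N (Inv N) := by
  have hb : ∀ s' : Memory, ∀ j : ℕ, (∀ c, c ∉ P.writes → s' c = s.set a 0 j c) →
      s' b 0 = N ∧ s' a 0 = j := by
    intro s' j h
    rw [h b hPb, h a hPa, Memory.set_ne _ hab.symm, hN, Memory.set_same]
    simp
  -- The measure is the number of remaining iterations. Arrays that the body does not write to agree
  -- with the original memory except for the loop variable, and this pins down both the counter and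
  -- the limit.
  have key := Runs.loop (W := W) (e := .bin .lt (.var a) (.var b))
    (P := .seq P (.write a (.const 0) (.bin .add (.var a) (.const 1))))
    (fun μ s' => ∃ j, j ≤ N ∧ μ = N - j ∧ (∀ c, c ∉ P.writes → s' c = s.set a 0 j c) ∧
      Inv j s') (by
    rintro μ s' ⟨j, hj, rfl, hfr, hI⟩ he
    obtain ⟨hb', ha⟩ := hb s' j hfr
    have hlt : j < N := by
      by_contra hcon
      apply he
      simp only [Expr.eval, BinOp.eval, ha, hb']
      rw [if_neg]; exact_mod_cast hcon
    refine P.wp_mono (hbody j s' hlt hfr hI) fun s'' h1 h2 => ?_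
    have ha'' : s'' a 0 = j := by rw [h1 a hPa, ha]
    simp only [Program.wp, Expr.eval, BinOp.eval, ha'']
    refine ⟨?_, N - (j + 1), by omega, j + 1, by omega, rfl, ?_, ?_⟩
    · rw [abs_of_nonneg (by omega)]; exact_mod_cast (by omega : j + 1 ≤ W)
    · intro c hcP
      by_cases hc : c = a
      · subst hc
        rw [Memory.set_same, Memory.set_same, h1 c hcP, hfr c hcP, Memory.set_same]
        simp
      · rw [Memory.set_ne _ hc, Memory.set_ne _ hc, h1 c hcP, hfr c hcP, Memory.set_ne _ hc]
    · exact hset _ _ _ h2) (μ := N) (s := s.set a 0 0) ⟨0, Nat.zero_le _, rfl,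
        fun c _ => rfl, hset _ _ _ h0⟩
  refine Runs.seq (k₁ := 0) (k₂ := N) (Q := fun s' => s' = s.set a 0 0) (Runs.of_wp ?_) ?_ (by omega)
  · simp [Program.wp, Expr.eval]
  · rintro s' _ rfl
    refine key.mono le_rfl ?_
    rintro s' _ ⟨he, μ, j, hj, -, hfr, hI⟩
    obtain ⟨hb', ha⟩ := hb s' j hfr
    have : j = N := by
      by_contra hcon
      have : ((j : ℤ)) < N := by exact_mod_cast lt_of_le_of_ne hj hcon
      simp only [Expr.eval, BinOp.eval, ha, hb', this, if_true] at he
      exact one_ne_zero he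
    exact this ▸ hI

end WordRAM

/-! ### Sufficient conditions for a 1-bend RAC drawing -/

/-- The data of a drawing in which the vertex `v` is placed at `(4 * X v, 4 * Y v)`, and in which
each edge `j` has ends `a j` and `c j`; if it is bent, then its bend is at
`(4 * X (c j) + α j, 4 * Y (a j) + β j)`, and `α j` and `β j` are at most one in absolute value. -/
structure GridLayout (V ι : Type*) where
  X : V → ℤ
  Y : V → ℤ
  a : ι → V
  c : ι → V
  α : ι → ℤ
  β : ι → ℤ
  bent : ι → Prop

/-- The number `r` is strictly smaller or strictly larger than both `p` and `q`. -/
def OutsideOf (r p q : ℤ) : Prop := (r < p ∧ r < q) ∨ (p < r ∧ q < r)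

namespace GridLayout

variable {V ι : Type*}

/-- The half of the requirements on a layout; the other half is obtained by exchanging the axes. -/
structure HalfValid (L : GridLayout V ι) : Prop where
  inj : Function.Injective L.Y
  small : ∀ j, L.β j = -1 ∨ L.β j = 0 ∨ L.β j = 1
  straight : ∀ j, ¬ L.bent j → L.Y (L.c j) - L.Y (L.a j) = 1 ∨ L.Y (L.c j) - L.Y (L.a j) = -1
  /-- Two horizontal segments at a vertex leave it in opposite directions. -/
  port : ∀ f g, f ≠ g → L.bent f → L.bent g → L.β f = 0 → L.β g = 0 → L.a f = L.a g →
    (L.X (L.c f) - L.X (L.a f)) * (L.X (L.c g) - L.X (L.a g)) < 0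
  skew : ∀ f g, f ≠ g → L.bent f → L.bent g → L.β f ≠ 0 → L.β g ≠ 0 → L.a f ≠ L.a g
  /-- A horizontal segment does not meet an almost vertical one, except at a common end. -/
  cross : ∀ f g, f ≠ g → L.bent f → L.bent g → L.β f = 0 → L.α g ≠ 0 →
    L.a f = L.c g ∨ (L.a f = L.a g ∧ L.β g = 0) ∨
      OutsideOf (L.Y (L.a f)) (L.Y (L.c g)) (L.Y (L.a g)) ∨
      ((L.X (L.a f) - L.X (L.c g)) * L.α g ≤ 0 ∧ (L.X (L.c f) - L.X (L.c g)) * L.α g ≤ 0)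

/-- Exchange of the axes. -/
def transpose (L : GridLayout V ι) : GridLayout V ι :=
  ⟨L.Y, L.X, L.c, L.a, L.β, L.α, L.bent⟩

structure Valid (L : GridLayout V ι) : Prop where
  half : L.HalfValid
  half' : L.transpose.HalfValid
  ne : ∀ j, L.a j ≠ L.c j
  distinct : ∀ f g, f ≠ g → s(L.a f, L.c f) ≠ s(L.a g, L.c g)
  /-- An almost horizontal segment does not meet an almost vertical one, except at a common end. -/
  skewCross : ∀ f g, f ≠ g → L.bent f → L.bent g → L.β f ≠ 0 → L.α g ≠ 0 →
    L.a f = L.c g ∨ OutsideOf (L.X (L.c g)) (L.X (L.a f)) (L.X (L.c f)) ∨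
      OutsideOf (L.Y (L.a f)) (L.Y (L.c g)) (L.Y (L.a g))

theorem Valid.transpose {L : GridLayout V ι} (h : L.Valid) : L.transpose.Valid where
  half := h.half'
  half' := h.half
  ne j := (h.ne j).symm
  distinct f g hfg := by
    have := h.distinct f g hfg
    simp only [GridLayout.transpose]
    rwa [Sym2.eq_swap, Sym2.eq_swap (a := L.c g)]
  skewCross f g hfg hf hg hα hβ := by
    rcases h.skewCross g f hfg.symm hg hf hβ hα with h | h | h
    · exact Or.inl h.symm
    · exact Or.inr (Or.inr h)
    · exact Or.inr (Or.inl h)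

/-- `(x, y)` lies on the segment from the end `a j` of `j` to the bend. -/
def OnH (L : GridLayout V ι) (j : ι) (x y : ℝ) : Prop :=
  ∃ t : ℝ, 0 ≤ t ∧ t ≤ 1 ∧
    x = 4 * L.X (L.a j) + t * (4 * (L.X (L.c j) - L.X (L.a j)) + L.α j) ∧
    y = 4 * L.Y (L.a j) + t * L.β j

/-- `(x, y)` lies on the segment between the ends of `j`. -/
def OnD (L : GridLayout V ι) (j : ι) (x y : ℝ) : Prop :=
  ∃ t : ℝ, 0 ≤ t ∧ t ≤ 1 ∧
    x = 4 * L.X (L.a j) + t * (4 * (L.X (L.c j) - L.X (L.a j))) ∧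
    y = 4 * L.Y (L.a j) + t * (4 * (L.Y (L.c j) - L.Y (L.a j)))

/-- `(x, y)` is a common end of `f` and `g`. -/
def CommonEnd (L : GridLayout V ι) (f g : ι) (x y : ℝ) : Prop :=
  ∃ w, (w = L.a f ∨ w = L.c f) ∧ (w = L.a g ∨ w = L.c g) ∧ x = 4 * L.X w ∧ y = 4 * L.Y w

theorem OnD.transpose {L : GridLayout V ι} {j : ι} {x y : ℝ} (h : L.OnD j x y) :
    L.transpose.OnD j y x := by
  obtain ⟨t, h0, h1, hx, hy⟩ := h
  refine ⟨1 - t, by linarith, by linarith, ?_, ?_⟩ <;> simp only [GridLayout.transpose] <;> linarith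

theorem CommonEnd.of_transpose {L : GridLayout V ι} {f g : ι} {x y : ℝ}
    (h : L.transpose.CommonEnd f g y x) : L.CommonEnd f g x y := by
  obtain ⟨w, h1, h2, h3, h4⟩ := h
  exact ⟨w, h1.symm, h2.symm, h4, h3⟩

theorem CommonEnd.symm {L : GridLayout V ι} {f g : ι} {x y : ℝ}
    (h : L.CommonEnd f g x y) : L.CommonEnd g f x y := by
  obtain ⟨w, h1, h2, h3⟩ := h
  exact ⟨w, h2, h1, h3⟩

/-- This is the purpose of the factor four: the strips of half-width one around distinct rows are
disjoint, so a tilt by one unit never leads into the strip of another row. -/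
theorem eq_of_abs_sub_lt {p q : ℤ} {y : ℝ} (hp : |y - 4 * p| ≤ 1) (hq : |y - 4 * q| ≤ 1) :
    p = q := by
  rw [abs_le] at hp hq
  have h1 : ((4 * p : ℤ) : ℝ) ≤ ((4 * q + 2 : ℤ) : ℝ) := by push_cast; linarith [hp.1, hq.2]
  have h2 : ((4 * q : ℤ) : ℝ) ≤ ((4 * p + 2 : ℤ) : ℝ) := by push_cast; linarith [hp.2, hq.1]
  have h1 := Int.cast_le.1 h1
  have h2 := Int.cast_le.1 h2
  omega

variable {L : GridLayout V ι}

theorem HalfValid.abs_le_one (h : L.HalfValid) (j : ι) : |(L.β j : ℝ)| ≤ 1 := by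
  rcases h.small j with e | e | e <;> rw [e] <;> norm_num

theorem HalfValid.near (h : L.HalfValid) {j : ι} {x y : ℝ} (hz : L.OnH j x y) :
    |y - 4 * L.Y (L.a j)| ≤ 1 := by
  obtain ⟨t, h0, h1, -, rfl⟩ := hz
  rw [add_sub_cancel_left, abs_mul, abs_of_nonneg h0]
  nlinarith [h.abs_le_one j, abs_nonneg (L.β j : ℝ)]

/-- The horizontal extent of an almost horizontal segment is at least three. -/
theorem Valid.three_le (h : L.Valid) (j : ι) :
    3 ≤ 4 * ((L.X (L.c j) : ℝ) - L.X (L.a j)) + L.α j ∨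
      4 * ((L.X (L.c j) : ℝ) - L.X (L.a j)) + L.α j ≤ -3 := by
  have hne : L.X (L.a j) ≠ L.X (L.c j) := fun e => h.ne j (h.half'.inj e)
  have hs : L.α j = -1 ∨ L.α j = 0 ∨ L.α j = 1 := h.half'.small j
  have : 3 ≤ 4 * (L.X (L.c j) - L.X (L.a j)) + L.α j ∨
      4 * (L.X (L.c j) - L.X (L.a j)) + L.α j ≤ -3 := by omega
  rcases this with this | this
  · left; exact_mod_cast this
  · right; exact_mod_cast this

/-- A shift by at most one cannot change the sign of a nonzero multiple of four. -/
theorem Valid.mul_neg_of_mul_neg (h : L.Valid) (f g : ι)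
    (hp : (L.X (L.c f) - L.X (L.a f)) * (L.X (L.c g) - L.X (L.a g)) < 0) :
    (4 * ((L.X (L.c f) : ℝ) - L.X (L.a f)) + L.α f) *
      (4 * ((L.X (L.c g) : ℝ) - L.X (L.a g)) + L.α g) < 0 := by
  have hf : L.α f = -1 ∨ L.α f = 0 ∨ L.α f = 1 := h.half'.small f
  have hg : L.α g = -1 ∨ L.α g = 0 ∨ L.α g = 1 := h.half'.small g
  have : (4 * (L.X (L.c f) - L.X (L.a f)) + L.α f) *
      (4 * (L.X (L.c g) - L.X (L.a g)) + L.α g) < 0 := by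
    rcases mul_neg_iff.1 hp with hp | hp
    · exact mul_neg_of_pos_of_neg (by omega) (by omega)
    · exact mul_neg_of_neg_of_pos (by omega) (by omega)
  exact_mod_cast this

/-- Segments that meet lie in the strip of the same row, hence start at the same vertex. If both are
exactly horizontal, they leave in opposite directions by `port`; if one is tilted, comparing heights
forces the meeting point to be the vertex; two tilted ones are excluded by `skew`. -/
theorem Valid.commonEnd_of_onH_onH (h : L.Valid) {f g : ι} (hfg : f ≠ g) (hf : L.bent f)
    (hg : L.bent g) {x y : ℝ} (hzf : L.OnH f x y) (hzg : L.OnH g x y) :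
    L.CommonEnd f g x y := by
  have ha : L.a f = L.a g := h.half.inj (eq_of_abs_sub_lt (h.half.near hzf) (h.half.near hzg))
  have key : x = 4 * L.X (L.a f) ∧ y = 4 * L.Y (L.a f) := by
    obtain ⟨t, t0, t1, hx, hy⟩ := hzf
    obtain ⟨u, u0, u1, hx', hy'⟩ := hzg
    rw [← ha] at hx' hy'
    by_cases bf : L.β f = 0
    · by_cases bg : L.β g = 0
      · have hp := h.half.port f g hfg hf hg bf bg ha
        -- With `A` and `B` the signed extents, `t * A = u * B` and `A * B < 0` give `t * A ^ 2 = u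
        -- * (A * B) ≤ 0`.
        have ht : t = 0 := by
          have hAB := h.mul_neg_of_mul_neg f g hp
          have e : t * (4 * ((L.X (L.c f) : ℝ) - L.X (L.a f)) + L.α f) =
            u * (4 * ((L.X (L.c g) : ℝ) - L.X (L.a g)) + L.α g) := by rw [← ha]; linarith
          rw [← ha] at hAB e
          generalize 4 * ((L.X (L.c f) : ℝ) - L.X (L.a f)) + L.α f = A at *
          generalize 4 * ((L.X (L.c g) : ℝ) - L.X (L.a f)) + L.α g = B at *
          have hA : A ≠ 0 := by rintro rfl; simp at hAB
          have hA2 : 0 < A * A := mul_self_pos.2 hA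
          have e2 : t * (A * A) = u * (A * B) := by rw [← mul_assoc, e]; ring
          nlinarith
        subst ht
        simp at hx hy
        exact ⟨hx, hy⟩
      · have hu : u = 0 := by
          rw [bf] at hy
          have : u * (L.β g : ℝ) = 0 := by push_cast at hy; linarith
          rcases mul_eq_zero.1 this with h | h
          · exact h
          · exact absurd (by exact_mod_cast h) bg
        subst hu
        simp at hx' hy'
        exact ⟨hx', hy'⟩
    · by_cases bg : L.β g = 0
      · have hu : t = 0 := by
          rw [bg] at hy'
          have : t * (L.β f : ℝ) = 0 := by push_cast at hy'; linarith
          rcases mul_eq_zero.1 this with h | h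
          · exact h
          · exact absurd (by exact_mod_cast h) bf
        subst hu
        simp at hx hy
        exact ⟨hx, hy⟩
      · exact absurd ha (h.half.skew f g hfg hf hg bf bg)
  exact ⟨L.a f, Or.inl rfl, Or.inl ha, key⟩

theorem Valid.onH_bend (L : GridLayout V ι) (j : ι) {x y : ℝ}
    (hx : x = 4 * L.X (L.c j) + L.α j) (hy : y = 4 * L.Y (L.a j) + L.β j) : L.OnH j x y :=
  ⟨1, zero_le_one, le_rfl, by rw [hx]; ring, by rw [hy]; ring⟩

/-- The crossing would not be at a right angle, so it must not occur. The four alternatives of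
`cross` are used in turn: the row of `f` contains the end `c g`; it contains the bend of `g`, which
then also lies on the horizontal segment of `g`; the row misses `g` altogether; or `g` is tilted
away from the whole segment of `f`. -/
theorem Valid.commonEnd_of_horizontal_of_skew (h : L.Valid) {f g : ι} (hfg : f ≠ g)
    (hf : L.bent f) (hg : L.bent g) {x y : ℝ} (hzf : L.OnH f x y) (hzg : L.transpose.OnH g y x)
    (bf : L.β f = 0) (ag : L.α g ≠ 0) : L.CommonEnd f g x y := by
  have hzf' := hzf
  obtain ⟨t, t0, t1, hx, hy⟩ := hzf
  obtain ⟨u, u0, u1, hy', hx'⟩ := hzg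
  simp only [GridLayout.transpose] at hx' hy'
  have hB := h.transpose.three_le g
  have hβ := h.half.abs_le_one g
  simp only [GridLayout.transpose] at hB
  rw [bf] at hy
  simp only [Int.cast_zero, mul_zero, add_zero] at hy
  have vertex : u = 0 → L.CommonEnd f g x y := by
    rintro rfl
    simp only [zero_mul, add_zero] at hx' hy'
    have : L.Y (L.a f) = L.Y (L.c g) := by
      have : (L.Y (L.a f) : ℝ) = L.Y (L.c g) := by linarith
      exact_mod_cast this
    exact ⟨L.c g, Or.inl (h.half.inj this).symm, Or.inr rfl, hx', hy'⟩
  rcases h.half.cross f g hfg hf hg bf ag with e | ⟨e, bg⟩ | e | ⟨e1, e2⟩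
  · apply vertex
    rw [hy, e] at hy'
    have : u * (4 * ((L.Y (L.a g) : ℝ) - L.Y (L.c g)) + L.β g) = 0 := by linarith
    rcases mul_eq_zero.1 this with h | h
    · exact h
    · rw [h] at hB; norm_num at hB
  · have hu : u = 1 := by
      rw [bg] at hB hy'
      rw [hy, e] at hy'
      have : (1 - u) * (4 * ((L.Y (L.a g) : ℝ) - L.Y (L.c g)) + (0 : ℤ)) = 0 := by
        push_cast at hy' ⊢; linarith
      rcases mul_eq_zero.1 this with h | h
      · linarith
      · rw [h] at hB; norm_num at hB
    subst hu
    refine h.commonEnd_of_onH_onH hfg hf hg hzf' (onH_bend L g ?_ ?_) <;> linarith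
  · exfalso
    rw [abs_le] at hβ
    rcases e with ⟨e1, e2⟩ | ⟨e1, e2⟩
    · have e1 : (L.Y (L.a f) : ℝ) + 1 ≤ L.Y (L.c g) := by exact_mod_cast e1
      have e2 : (L.Y (L.a f) : ℝ) + 1 ≤ L.Y (L.a g) := by exact_mod_cast e2
      nlinarith
    · have e1 : (L.Y (L.c g) : ℝ) + 1 ≤ L.Y (L.a f) := by exact_mod_cast e1
      have e2 : (L.Y (L.a g) : ℝ) + 1 ≤ L.Y (L.a f) := by exact_mod_cast e2
      nlinarith
  · apply vertex
    -- The bend of `f` may be shifted by `α f` towards the side to which `g` is tilted. In that case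
    -- `skew` for the transposed layout puts the two ends in different columns, and the distance
    -- four outweighs the shift.
    have key : (4 * (L.X (L.c f) - L.X (L.c g)) + L.α f) * L.α g ≤ 0 := by
      have sf : L.α f = -1 ∨ L.α f = 0 ∨ L.α f = 1 := h.half'.small f
      have sg : L.α g = -1 ∨ L.α g = 0 ∨ L.α g = 1 := h.half'.small g
      by_cases af : L.α f = 0
      · rw [af]; linarith
      · have hne : L.c f ≠ L.c g := h.half'.skew f g hfg hf hg af ag
        have hne' : L.X (L.c f) ≠ L.X (L.c g) := fun e => hne (h.half'.inj e)
        rcases sg with sg | sg | sg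
        · rw [sg] at e2 ⊢; omega
        · exact absurd sg ag
        · rw [sg] at e2 ⊢; omega
    have key' : (4 * ((L.X (L.c f) : ℝ) - L.X (L.c g)) + L.α f) * L.α g ≤ 0 := by
      exact_mod_cast key
    have e1' : ((L.X (L.a f) : ℝ) - L.X (L.c g)) * L.α g ≤ 0 := by exact_mod_cast e1
    have sg : (L.α g : ℝ) * L.α g = 1 := by
      rcases h.half'.small g with e | e | e
      · simp only [GridLayout.transpose] at e; rw [e]; norm_num
      · exact absurd e ag
      · simp only [GridLayout.transpose] at e; rw [e]; norm_num
    -- As `α g` squares to one, `u` is the horizontal distance from the column of `c g`, measured in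
    -- the direction of the tilt. It is a convex combination of the values at the two ends of the
    -- segment of `f`, neither of which is positive.
    have e3 : u = (1 - t) * (4 * (((L.X (L.a f) : ℝ) - L.X (L.c g)) * L.α g)) +
        t * ((4 * ((L.X (L.c f) : ℝ) - L.X (L.c g)) + L.α f) * L.α g) := by
      have e4 : (x - 4 * L.X (L.c g)) * L.α g = u := by rw [hx', add_sub_cancel_left, mul_assoc, sg,
        mul_one]
      rw [← e4, hx]; ring
    have e5 := mul_nonneg (sub_nonneg.2 t1) (neg_nonneg.2 e1')
    have e6 := mul_nonneg t0 (neg_nonneg.2 key')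
    linarith

/-- The only crossings left are those of an exactly horizontal with an exactly vertical segment. If
just one of the two is tilted, the previous lemma applies, possibly after an exchange of the axes;
if both are, `skewCross` separates them or gives a common end. -/
theorem Valid.onH_onV (h : L.Valid) {f g : ι} (hfg : f ≠ g) (hf : L.bent f) (hg : L.bent g)
    {x y : ℝ} (hzf : L.OnH f x y) (hzg : L.transpose.OnH g y x) :
    L.CommonEnd f g x y ∨ (L.β f = 0 ∧ L.α g = 0) := by
  by_cases bf : L.β f = 0
  · by_cases ag : L.α g = 0
    · exact Or.inr ⟨bf, ag⟩
    · exact Or.inl (h.commonEnd_of_horizontal_of_skew hfg hf hg hzf hzg bf ag)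
  · left
    by_cases ag : L.α g = 0
    · exact (h.transpose.commonEnd_of_horizontal_of_skew hfg.symm hg hf hzg hzf ag
        bf).of_transpose.symm
    · obtain ⟨t, t0, t1, hx, hy⟩ := hzf
      obtain ⟨u, u0, u1, hy', hx'⟩ := hzg
      have hβ := h.half.abs_le_one g
      have hβ' := h.half.abs_le_one f
      have hα := h.half'.abs_le_one g
      have hα' := h.half'.abs_le_one f
      have hA := h.three_le f
      have hB := h.transpose.three_le g
      simp only [GridLayout.transpose] at hx' hy' hB hα hα'
      rcases h.skewCross f g hfg hf hg bf ag with e | e | e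
      · rw [e] at hx hy hA
        -- Two lines through a common vertex: the determinant `A * B - α g * β f` is nonzero,
        -- because the extents `A` and `B` are at least three and the tilts at most one in absolute
        -- value.
        have ht : t = 0 := by
          generalize 4 * ((L.X (L.c f) : ℝ) - L.X (L.c g)) + L.α f = A at *
          generalize 4 * ((L.Y (L.a g) : ℝ) - L.Y (L.c g)) + L.β g = B at *
          have e1 : t * A = u * L.α g := by linarith
          have e2 : t * L.β f = u * B := by linarith
          have e3 : t * (A * B - L.α g * L.β f) = 0 := by
            linear_combination B * e1 - L.α g * e2
          rcases mul_eq_zero.1 e3 with e4 | e4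
          · exact e4
          · exfalso
            have hab : |(L.α g : ℝ) * L.β f| ≤ 1 := by
              rw [abs_mul]; exact mul_le_one₀ hα (abs_nonneg _) hβ'
            have hAB : 9 ≤ |A * B| := by
              rw [abs_mul]
              have : 3 ≤ |A| := le_abs.2 (hA.imp id fun h => by linarith)
              have : 3 ≤ |B| := le_abs.2 (hB.imp id fun h => by linarith)
              nlinarith
            rw [sub_eq_zero.1 e4] at hAB
            linarith
        subst ht
        simp only [zero_mul, add_zero] at hx hy
        exact ⟨L.c g, Or.inl e.symm, Or.inr rfl, hx, hy⟩
      · exfalso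
        rw [abs_le] at *
        rcases e with ⟨e1, e2⟩ | ⟨e1, e2⟩
        · have e1 : (L.X (L.c g) : ℝ) + 1 ≤ L.X (L.a f) := by exact_mod_cast e1
          have e2 : (L.X (L.c g) : ℝ) + 1 ≤ L.X (L.c f) := by exact_mod_cast e2
          nlinarith
        · have e1 : (L.X (L.a f) : ℝ) + 1 ≤ L.X (L.c g) := by exact_mod_cast e1
          have e2 : (L.X (L.c f) : ℝ) + 1 ≤ L.X (L.c g) := by exact_mod_cast e2
          nlinarith
      · exfalso
        rw [abs_le] at *
        rcases e with ⟨e1, e2⟩ | ⟨e1, e2⟩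
        · have e1 : (L.Y (L.a f) : ℝ) + 1 ≤ L.Y (L.c g) := by exact_mod_cast e1
          have e2 : (L.Y (L.a f) : ℝ) + 1 ≤ L.Y (L.a g) := by exact_mod_cast e2
          nlinarith
        · have e1 : (L.Y (L.c g) : ℝ) + 1 ≤ L.Y (L.a f) := by exact_mod_cast e1
          have e2 : (L.Y (L.a g) : ℝ) + 1 ≤ L.Y (L.a f) := by exact_mod_cast e2
          nlinarith

/-- If a straight segment meets the row of `w` up to distance one, then `w` is one of its ends. -/
theorem HalfValid.end_of_onD (h : L.HalfValid) {j : ι} (hj : ¬ L.bent j) {x y : ℝ}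
    (hz : L.OnD j x y) {w : V} (hw : |y - 4 * L.Y w| ≤ 1) : w = L.a j ∨ w = L.c j := by
  obtain ⟨t, t0, t1, -, hy⟩ := hz
  rw [abs_le] at hw
  have key : L.Y w = L.Y (L.a j) ∨ L.Y w = L.Y (L.c j) := by
    rcases h.straight j hj with e | e
    · have e' : (L.Y (L.c j) : ℝ) - L.Y (L.a j) = 1 := by exact_mod_cast e
      rw [e'] at hy
      have h1 : ((4 * L.Y w : ℤ) : ℝ) ≤ ((4 * L.Y (L.a j) + 5 : ℤ) : ℝ) := by
        push_cast; linarith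
      have h2 : ((4 * L.Y (L.a j) : ℤ) : ℝ) ≤ ((4 * L.Y w + 1 : ℤ) : ℝ) := by
        push_cast; linarith
      have h1 := Int.cast_le.1 h1
      have h2 := Int.cast_le.1 h2
      omega
    · have e' : (L.Y (L.c j) : ℝ) - L.Y (L.a j) = -1 := by exact_mod_cast e
      rw [e'] at hy
      have h1 : ((4 * L.Y w : ℤ) : ℝ) ≤ ((4 * L.Y (L.a j) + 1 : ℤ) : ℝ) := by
        push_cast; linarith
      have h2 : ((4 * L.Y (L.a j) : ℤ) : ℝ) ≤ ((4 * L.Y w + 5 : ℤ) : ℝ) := by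
        push_cast; linarith
      have h1 := Int.cast_le.1 h1
      have h2 := Int.cast_le.1 h2
      omega
  exact key.imp (fun e => h.inj e) (fun e => h.inj e)

/-- A straight edge joins consecutive rows, so it meets the strip of the row of `a f` only if `a f`
is one of its ends. From there it has slope `1` or `-1`, whereas an almost horizontal segment has
slope at most a third, so they meet only in the vertex. -/
theorem Valid.commonEnd_of_onD_onH (h : L.Valid) {j f : ι} (hj : ¬ L.bent j) {x y : ℝ}
    (hzj : L.OnD j x y) (hzf : L.OnH f x y) : L.CommonEnd j f x y := by
  have hend := h.half.end_of_onD hj hzj (h.half.near hzf)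
  have hA := h.three_le f
  have hβ := h.half.abs_le_one f
  suffices hs : x = 4 * L.X (L.a f) ∧ y = 4 * L.Y (L.a f) from ⟨_, hend, Or.inl rfl, hs⟩
  obtain ⟨t, t0, t1, hx, hy⟩ := hzj
  obtain ⟨u, u0, u1, hx', hy'⟩ := hzf
  generalize hAe : 4 * ((L.X (L.c f) : ℝ) - L.X (L.a f)) + L.α f = A at *
  -- The displacement from the common vertex along the diagonal edge has coordinates of equal
  -- absolute value.
  obtain ⟨r, σ, hr, hσ, hx, hy⟩ : ∃ r σ : ℝ, |r| = |σ| ∧ True ∧ x = 4 * L.X (L.a f) + r ∧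
      y = 4 * L.Y (L.a f) + σ := by
    have e1 : |(L.X (L.c j) : ℝ) - L.X (L.a j)| = 1 := by
      rcases h.half'.straight j hj with e | e <;> simp only [GridLayout.transpose] at e
      · have : (L.X (L.a j) : ℝ) - L.X (L.c j) = 1 := by exact_mod_cast e
        rw [abs_sub_comm, this, abs_one]
      · have : (L.X (L.a j) : ℝ) - L.X (L.c j) = -1 := by exact_mod_cast e
        rw [abs_sub_comm, this, abs_neg, abs_one]
    have e2 : |(L.Y (L.c j) : ℝ) - L.Y (L.a j)| = 1 := by
      rcases h.half.straight j hj with e | e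
      · have : (L.Y (L.c j) : ℝ) - L.Y (L.a j) = 1 := by exact_mod_cast e
        rw [this, abs_one]
      · have : (L.Y (L.c j) : ℝ) - L.Y (L.a j) = -1 := by exact_mod_cast e
        rw [this, abs_neg, abs_one]
    rcases hend with e | e <;> rw [e]
    · refine ⟨_, _, ?_, trivial, hx, hy⟩
      simp only [abs_mul, e1, e2]
    · refine ⟨(t - 1) * (4 * ((L.X (L.c j) : ℝ) - L.X (L.a j))),
        (t - 1) * (4 * ((L.Y (L.c j) : ℝ) - L.Y (L.a j))), ?_, trivial, ?_, ?_⟩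
      · simp only [abs_mul, e1, e2]
      · rw [hx]; ring
      · rw [hy]; ring
  have e1 : r = u * A := by linarith
  have e2 : σ = u * L.β f := by linarith
  have hu : u = 0 := by
    rw [e1, e2, abs_mul, abs_mul] at hr
    have hA' : 3 ≤ |A| := le_abs.2 (hA.imp id fun h => by linarith)
    have : |u| * (|A| - |(L.β f : ℝ)|) = 0 := by rw [mul_sub]; linarith
    rcases mul_eq_zero.1 this with h | h
    · exact abs_eq_zero.1 h
    · linarith
  subst hu
  constructor <;> linarith

/-- Straight edges project to intervals between consecutive columns. Two such intervals that meet
are equal, and then the edges have the same ends, or share just an endpoint, which is the column of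
a common vertex. The four cases below orient both edges from left to right. -/
theorem Valid.commonEnd_of_onD_onD (h : L.Valid) {f g : ι} (hfg : f ≠ g) (hf : ¬ L.bent f)
    (hg : ¬ L.bent g) {x y : ℝ} (hzf : L.OnD f x y) (hzg : L.OnD g x y) :
    L.CommonEnd f g x y := by
  have d := h.distinct f g hfg
  have inj : Function.Injective L.X := h.half'.inj
  obtain ⟨t, t0, t1, hx, hy⟩ := hzf
  obtain ⟨u, u0, u1, hx', hy'⟩ := hzg
  have sf : L.X (L.a f) - L.X (L.c f) = 1 ∨ L.X (L.a f) - L.X (L.c f) = -1 := h.half'.straight f hf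
  have sg : L.X (L.a g) - L.X (L.c g) = 1 ∨ L.X (L.a g) - L.X (L.c g) = -1 := h.half'.straight g hg
  have key : ∀ (a c a' c' : V) (t u : ℝ), 0 ≤ t → t ≤ 1 → 0 ≤ u → u ≤ 1 →
      L.X c - L.X a = 1 → L.X c' - L.X a' = 1 → s(a, c) ≠ s(a', c') →
      4 * (L.X a : ℝ) + t * (4 * (L.X c - L.X a)) = 4 * L.X a' + u * (4 * (L.X c' - L.X a')) →
      (a = c' ∧ t = 0) ∨ (c = a' ∧ t = 1) := by
    intro a c a' c' t u t0 t1 u0 u1 e e' d hx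
    have r : (L.X c : ℝ) - L.X a = 1 := by exact_mod_cast e
    have r' : (L.X c' : ℝ) - L.X a' = 1 := by exact_mod_cast e'
    rw [r, r'] at hx
    have h1 : (L.X a : ℝ) ≤ ((L.X a' + 1 : ℤ) : ℝ) := by push_cast; linarith
    have h2 : (L.X a' : ℝ) ≤ ((L.X a + 1 : ℤ) : ℝ) := by push_cast; linarith
    have h1 := Int.cast_le.1 h1
    have h2 := Int.cast_le.1 h2
    have h3 : L.X a ≠ L.X a' := by
      intro h3
      apply d
      rw [inj h3, inj (show L.X c = L.X c' by omega)]
    rcases (by omega : L.X a = L.X a' + 1 ∨ L.X a' = L.X a + 1) with h4 | h4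
    · left
      have : (L.X a : ℝ) = L.X a' + 1 := by exact_mod_cast h4
      exact ⟨inj (by omega), by linarith⟩
    · right
      have : (L.X a' : ℝ) = L.X a + 1 := by exact_mod_cast h4
      exact ⟨inj (by omega), by linarith⟩
  have fin : ∀ w, (w = L.a f ∧ t = 0) ∨ (w = L.c f ∧ t = 1) → (w = L.a g ∨ w = L.c g) →
      L.CommonEnd f g x y := by
    rintro w (⟨rfl, rfl⟩ | ⟨rfl, rfl⟩) hw
    · exact ⟨_, Or.inl rfl, hw, by linarith, by linarith⟩
    · exact ⟨_, Or.inr rfl, hw, by linarith, by linarith⟩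
  rcases sf with sf | sf <;> rcases sg with sg | sg
  · rcases key (L.c f) (L.a f) (L.c g) (L.a g) (1 - t) (1 - u) (by linarith) (by linarith)
      (by linarith) (by linarith) sf sg (by rwa [Sym2.eq_swap, Sym2.eq_swap (a := L.c g)])
      (by linarith) with ⟨e, e'⟩ | ⟨e, e'⟩
    · exact fin _ (Or.inr ⟨rfl, by linarith⟩) (Or.inl e)
    · exact fin _ (Or.inl ⟨rfl, by linarith⟩) (Or.inr e)
  · rcases key (L.c f) (L.a f) (L.a g) (L.c g) (1 - t) u (by linarith) (by linarith)
      (by linarith) (by linarith) sf (by omega) (by rwa [Sym2.eq_swap])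
      (by linarith) with ⟨e, e'⟩ | ⟨e, e'⟩
    · exact fin _ (Or.inr ⟨rfl, by linarith⟩) (Or.inr e)
    · exact fin _ (Or.inl ⟨rfl, by linarith⟩) (Or.inl e)
  · rcases key (L.a f) (L.c f) (L.c g) (L.a g) t (1 - u) (by linarith) (by linarith)
      (by linarith) (by linarith) (by omega) sg (by rwa [Sym2.eq_swap (a := L.c g)])
      (by linarith) with ⟨e, e'⟩ | ⟨e, e'⟩
    · exact fin _ (Or.inl ⟨rfl, by linarith⟩) (Or.inl e)
    · exact fin _ (Or.inr ⟨rfl, by linarith⟩) (Or.inr e)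
  · rcases key (L.a f) (L.c f) (L.a g) (L.c g) t u t0 t1 u0 u1 (by omega) (by omega) d
      (by linarith) with ⟨e, e'⟩ | ⟨e, e'⟩
    · exact fin _ (Or.inl ⟨rfl, by linarith⟩) (Or.inr e)
    · exact fin _ (Or.inr ⟨rfl, by linarith⟩) (Or.inl e)

end GridLayout

/-! ### From valid layouts to RAC drawings -/

namespace GridLayout

variable {V ι : Type*} {L : GridLayout V ι}

theorem mem_gridSegment {p q : GridPoint} {z : ℝ × ℝ} : z ∈ gridSegment p q ↔
    ∃ t : ℝ, 0 ≤ t ∧ t ≤ 1 ∧ z.1 = p.1 + t * (q.1 - p.1) ∧ z.2 = p.2 + t * (q.2 - p.2) := by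
  simp only [gridSegment, segment_eq_image', Set.mem_image, Set.mem_Icc, GridPoint.toPlane,
    Prod.ext_iff, Prod.fst_add, Prod.snd_add, Prod.smul_fst, Prod.smul_snd, Prod.fst_sub,
    Prod.snd_sub, smul_eq_mul]
  constructor
  · rintro ⟨t, ⟨h0, h1⟩, h2, h3⟩
    exact ⟨t, h0, h1, h2.symm, h3.symm⟩
  · rintro ⟨t, h0, h1, h2, h3⟩
    exact ⟨t, ⟨h0, h1⟩, h2.symm, h3.symm⟩

/-- The place of a vertex. -/
def place (L : GridLayout V ι) (v : V) : GridPoint := (4 * L.X v, 4 * L.Y v)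

/-- The bend of a bent edge. -/
def bendPoint (L : GridLayout V ι) (j : ι) : GridPoint :=
  (4 * L.X (L.c j) + L.α j, 4 * L.Y (L.a j) + L.β j)

theorem mem_gridSegment_onH {j : ι} {z : ℝ × ℝ} :
    z ∈ gridSegment (L.place (L.a j)) (L.bendPoint j) ↔ L.OnH j z.1 z.2 := by
  rw [mem_gridSegment]
  simp only [OnH, place, bendPoint]
  push_cast
  refine exists_congr fun t => ?_
  refine and_congr_right fun _ => and_congr_right fun _ => ?_
  constructor <;> rintro ⟨h1, h2⟩ <;> constructor <;> linarith

theorem mem_gridSegment_onV {j : ι} {z : ℝ × ℝ} :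
    z ∈ gridSegment (L.place (L.c j)) (L.bendPoint j) ↔ L.transpose.OnH j z.2 z.1 := by
  rw [mem_gridSegment]
  simp only [OnH, place, bendPoint, transpose]
  push_cast
  refine exists_congr fun t => ?_
  refine and_congr_right fun _ => and_congr_right fun _ => ?_
  constructor <;> rintro ⟨h1, h2⟩ <;> constructor <;> linarith

theorem mem_gridSegment_onD {j : ι} {z : ℝ × ℝ} :
    z ∈ gridSegment (L.place (L.a j)) (L.place (L.c j)) ↔ L.OnD j z.1 z.2 := by
  rw [mem_gridSegment]
  simp only [OnD, place]
  push_cast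
  refine exists_congr fun t => ?_
  refine and_congr_right fun _ => and_congr_right fun _ => ?_
  constructor <;> rintro ⟨h1, h2⟩ <;> constructor <;> linarith

theorem gridSegment_symm (p q : GridPoint) : gridSegment p q = gridSegment q p :=
  segment_symm ℝ _ _

/-- The drawing `D` of `G` is given by the layout `L`. -/
structure Describes (L : GridLayout V ι) (G : SimpleGraph V) (D : OneBendDrawing V) : Prop where
  edges : ∀ e, e ∈ G.edgeSet ↔ ∃ j, s(L.a j, L.c j) = e
  pos : ∀ v, D.pos v = L.place v
  bend : ∀ j, L.bent j → D.bend s(L.a j, L.c j) = some (L.bendPoint j)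
  none : ∀ j, ¬ L.bent j → D.bend s(L.a j, L.c j) = none

variable {G : SimpleGraph V} {D : OneBendDrawing V}

/-- A piece of a straight edge may be listed from either end, so for straight edges only the set of
points is determined. -/
theorem Describes.isPiece (hD : L.Describes G D) {j : ι} {p q : GridPoint}
    (h : D.IsPiece s(L.a j, L.c j) p q) :
    (L.bent j ∧ (p = L.place (L.a j) ∨ p = L.place (L.c j)) ∧ q = L.bendPoint j) ∨
      (¬ L.bent j ∧ gridSegment p q = gridSegment (L.place (L.a j)) (L.place (L.c j))) := by
  obtain ⟨u, v, e, rfl, h⟩ := h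
  simp only [hD.pos] at h ⊢
  by_cases hb : L.bent j
  · left
    rw [hD.bend j hb] at h
    simp only [reduceCtorEq, false_and, Option.some.injEq, false_or] at h
    refine ⟨hb, ?_, h.symm⟩
    rcases Sym2.eq_iff.1 e with ⟨e, -⟩ | ⟨-, e⟩
    · exact Or.inl (by rw [e])
    · exact Or.inr (by rw [e])
  · right
    rw [hD.none j hb] at h
    simp only [true_and, reduceCtorEq, or_false] at h
    refine ⟨hb, ?_⟩
    rw [h]
    rcases Sym2.eq_iff.1 e with ⟨e, e'⟩ | ⟨e, e'⟩
    · rw [e, e']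
    · rw [e, e', gridSegment_symm]

theorem Valid.vertex_of_onH (h : L.Valid) {j : ι} {w : V}
    (hz : L.OnH j (4 * L.X w) (4 * L.Y w)) : w = L.a j := by
  have h1 := h.half.near hz
  exact h.half.inj (eq_of_abs_sub_lt (y := 4 * L.Y w) (by simp) h1)

/-- Two segments of two distinct edges. -/
theorem Describes.crossing_pieces (hD : L.Describes G D) (h : L.Valid) {f g : ι} (hfg : f ≠ g)
    {p q p' q' : GridPoint} {z : ℝ × ℝ} (hf : D.IsPiece s(L.a f, L.c f) p q)
    (hg : D.IsPiece s(L.a g, L.c g) p' q') (hz : z ∈ gridSegment p q)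
    (hz' : z ∈ gridSegment p' q') :
    L.CommonEnd f g z.1 z.2 ∨
      (z ≠ (L.bendPoint f).toPlane ∧ z ≠ (L.bendPoint g).toPlane ∧ L.bent f ∧ L.bent g ∧
        GridPerp p q p' q') := by
  have bendH : ∀ j, z = (L.bendPoint j).toPlane → L.OnH j z.1 z.2 := by
    rintro j rfl
    exact mem_gridSegment_onH.1 (right_mem_segment ℝ _ _)
  have bendV : ∀ j, z = (L.bendPoint j).toPlane → L.transpose.OnH j z.2 z.1 := by
    rintro j rfl
    exact mem_gridSegment_onV.1 (right_mem_segment ℝ _ _)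
  -- The bend of `f` lies on both segments of `f`. If `z` were this bend, two almost vertical
  -- segments would meet in `z`, which happens at common ends only; likewise for the bend of `g` and
  -- two almost horizontal segments.
  have hv : ∀ f g, f ≠ g → L.bent f → L.bent g → L.OnH f z.1 z.2 → L.transpose.OnH g z.2 z.1 →
      L.CommonEnd f g z.1 z.2 ∨ (z ≠ (L.bendPoint f).toPlane ∧ z ≠ (L.bendPoint g).toPlane ∧
        L.β f = 0 ∧ L.α g = 0) := by
    intro f g hfg bf bg hz hz'
    by_cases h1 : L.CommonEnd f g z.1 z.2
    · exact Or.inl h1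
    · right
      refine ⟨fun e => h1 ?_, fun e => h1 ?_, (h.onH_onV hfg bf bg hz hz').resolve_left h1⟩
      · exact (h.transpose.commonEnd_of_onH_onH hfg bf bg (bendV f e) hz').of_transpose
      · exact h.commonEnd_of_onH_onH hfg bf bg hz (bendH g e)
  rcases hD.isPiece hf with ⟨bf, hp, rfl⟩ | ⟨bf, hp⟩
  · rcases hD.isPiece hg with ⟨bg, hp', rfl⟩ | ⟨bg, hp'⟩
    · rcases hp with rfl | rfl
      · rw [mem_gridSegment_onH] at hz
        rcases hp' with rfl | rfl
        · rw [mem_gridSegment_onH] at hz'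
          exact Or.inl (h.commonEnd_of_onH_onH hfg bf bg hz hz')
        · rw [mem_gridSegment_onV] at hz'
          refine (hv f g hfg bf bg hz hz').imp id ?_
          rintro ⟨h1, h2, h3, h4⟩
          exact ⟨h1, h2, bf, bg, by simp [GridPerp, place, bendPoint, h3, h4]⟩
      · rw [mem_gridSegment_onV] at hz
        rcases hp' with rfl | rfl
        · rw [mem_gridSegment_onH] at hz'
          refine (hv g f hfg.symm bg bf hz' hz).imp (fun h => h.symm) ?_
          rintro ⟨h1, h2, h3, h4⟩
          exact ⟨h2, h1, bf, bg, by simp [GridPerp, place, bendPoint, h3, h4]⟩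
        · rw [mem_gridSegment_onV] at hz'
          exact Or.inl (h.transpose.commonEnd_of_onH_onH hfg bf bg hz hz').of_transpose
    · left
      rw [hp', mem_gridSegment_onD] at hz'
      rcases hp with rfl | rfl
      · rw [mem_gridSegment_onH] at hz
        exact (h.commonEnd_of_onD_onH bg hz' hz).symm
      · rw [mem_gridSegment_onV] at hz
        exact (h.transpose.commonEnd_of_onD_onH bg hz'.transpose hz).symm.of_transpose
  · left
    rw [hp, mem_gridSegment_onD] at hz
    rcases hD.isPiece hg with ⟨bg, hp', rfl⟩ | ⟨bg, hp'⟩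
    · rcases hp' with rfl | rfl
      · rw [mem_gridSegment_onH] at hz'
        exact h.commonEnd_of_onD_onH bf hz hz'
      · rw [mem_gridSegment_onV] at hz'
        exact (h.transpose.commonEnd_of_onD_onH bf hz.transpose hz').of_transpose
    · rw [hp', mem_gridSegment_onD] at hz'
      exact h.commonEnd_of_onD_onD hfg bf bg hz hz'

/-- The two segments of a bent edge have only the bend in common. -/
theorem Valid.segments_inter (h : L.Valid) (j : ι) :
    gridSegment (L.place (L.a j)) (L.bendPoint j) ∩
      gridSegment (L.place (L.c j)) (L.bendPoint j) = {(L.bendPoint j).toPlane} := by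
  refine Set.eq_singleton_iff_unique_mem.2
    ⟨⟨right_mem_segment ℝ _ _, right_mem_segment ℝ _ _⟩, ?_⟩
  rintro z ⟨h1, h2⟩
  rw [mem_gridSegment_onH] at h1
  rw [mem_gridSegment_onV] at h2
  obtain ⟨t, t0, t1, hx, hy⟩ := h1
  obtain ⟨u, u0, u1, hy', hx'⟩ := h2
  have hA := h.three_le j
  have hB := h.transpose.three_le j
  have hα := h.half'.abs_le_one j
  have hβ := h.half.abs_le_one j
  simp only [GridLayout.transpose] at hB hα hx' hy'
  generalize hAe : 4 * ((L.X (L.c j) : ℝ) - L.X (L.a j)) + L.α j = A at *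
  generalize hBe : 4 * ((L.Y (L.a j) : ℝ) - L.Y (L.c j)) + L.β j = B at *
  -- Measured from the bend, both segments give the same displacement; the determinant is nonzero,
  -- as the extents are at least three and the tilts at most one.
  have e1 : (t - 1) * A = (u - 1) * L.α j := by linarith
  have e2 : (t - 1) * L.β j = (u - 1) * B := by linarith
  have e3 : (t - 1) * (A * B - L.α j * L.β j) = 0 := by linear_combination B * e1 - L.α j * e2
  have ht : t = 1 := by
    rcases mul_eq_zero.1 e3 with e4 | e4
    · linarith
    · exfalso
      have hab : |(L.α j : ℝ) * L.β j| ≤ 1 := by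
        rw [abs_mul]; exact mul_le_one₀ hα (abs_nonneg _) hβ
      have hAB : 9 ≤ |A * B| := by
        rw [abs_mul]
        have : 3 ≤ |A| := le_abs.2 (hA.imp id fun h => by linarith)
        have : 3 ≤ |B| := le_abs.2 (hB.imp id fun h => by linarith)
        nlinarith
      rw [sub_eq_zero.1 e4] at hAB
      linarith
  subst ht
  apply Prod.ext
  · simp only [bendPoint, GridPoint.toPlane]; push_cast; linarith
  · simp only [bendPoint, GridPoint.toPlane]; push_cast; linarith

theorem Valid.bendPoint_ne (h : L.Valid) (j : ι) :
    L.bendPoint j ≠ L.place (L.a j) ∧ L.bendPoint j ≠ L.place (L.c j) := by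
  have hA := h.three_le j
  have hB := h.transpose.three_le j
  simp only [GridLayout.transpose] at hB
  constructor <;> intro e <;> have e := congrArg GridPoint.toPlane e <;>
    simp only [bendPoint, place, GridPoint.toPlane, Prod.mk.injEq] at e <;> push_cast at e
  · rcases hA with h | h <;> linarith [e.1]
  · rcases hB with h | h <;> linarith [e.2]

theorem Describes.isRAC (hD : L.Describes G D) (h : L.Valid) : D.IsRAC G where
  pos_injective u v e := by
    rw [hD.pos, hD.pos] at e
    have e := congrArg Prod.snd e
    simp only [place] at e
    exact h.half.inj (by omega)
  edge_simple u v b huv hb := by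
    obtain ⟨j, hj⟩ := (hD.edges s(u, v)).1 huv
    rw [← hj] at hb
    by_cases bj : L.bent j
    · rw [hD.bend j bj, Option.some.injEq] at hb
      subst hb
      rw [hD.pos, hD.pos]
      rcases Sym2.eq_iff.1 hj with ⟨rfl, rfl⟩ | ⟨rfl, rfl⟩
      · exact ⟨(h.bendPoint_ne j).1, (h.bendPoint_ne j).2, h.segments_inter j⟩
      · exact ⟨(h.bendPoint_ne j).2, (h.bendPoint_ne j).1, by
          rw [Set.inter_comm]; exact h.segments_inter j⟩
    · rw [hD.none j bj] at hb
      exact absurd hb (by simp)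
  vertex_free e he w hw := by
    obtain ⟨j, rfl⟩ := (hD.edges e).1 he
    obtain ⟨p, q, hpq, hz⟩ := hw
    rw [hD.pos] at hz
    have e1 : (L.place w).toPlane.1 = 4 * (L.X w : ℝ) := by simp [place, GridPoint.toPlane]
    have e2 : (L.place w).toPlane.2 = 4 * (L.Y w : ℝ) := by simp [place, GridPoint.toPlane]
    rw [Sym2.mem_iff]
    rcases hD.isPiece hpq with ⟨bj, hp, rfl⟩ | ⟨bj, hp⟩
    · rcases hp with rfl | rfl
      · rw [mem_gridSegment_onH, e1, e2] at hz
        exact Or.inl (h.vertex_of_onH hz)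
      · rw [mem_gridSegment_onV, e1, e2] at hz
        exact Or.inr (h.transpose.vertex_of_onH hz)
    · rw [hp, mem_gridSegment_onD, e1, e2] at hz
      exact h.half.end_of_onD bj hz (by simp)
  crossing e he e' he' hne z hz := by
    obtain ⟨f, rfl⟩ := (hD.edges e).1 he
    obtain ⟨g, rfl⟩ := (hD.edges e').1 he'
    have hfg : f ≠ g := by rintro rfl; exact hne rfl
    by_cases hc : L.CommonEnd f g z.1 z.2
    · left
      obtain ⟨w, h1, h2, h3, h4⟩ := hc
      refine ⟨w, Sym2.mem_iff.2 h1, Sym2.mem_iff.2 h2, ?_⟩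
      rw [hD.pos]
      apply Prod.ext
      · rw [h3]; simp [place, GridPoint.toPlane]
      · rw [h4]; simp [place, GridPoint.toPlane]
    · right
      obtain ⟨⟨p, q, hpq, hz1⟩, ⟨p', q', hpq', hz2⟩⟩ := hz
      obtain ⟨h1, h2, h3, h4, -⟩ := (hD.crossing_pieces h hfg hpq hpq' hz1 hz2).resolve_left hc
      refine ⟨?_, ?_, ?_⟩
      · rintro ⟨b, hb, hb'⟩
        rw [hD.bend f h3, Option.some.injEq] at hb
        exact h1 (by rw [hb, hb'])
      · rintro ⟨b, hb, hb'⟩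
        rw [hD.bend g h4, Option.some.injEq] at hb
        exact h2 (by rw [hb, hb'])
      · intro p q p' q' hpq hz1 hpq' hz2
        exact ((hD.crossing_pieces h hfg hpq hpq' hz1 hz2).resolve_left hc).2.2.2.2

end GridLayout

/-! ### Layouts from two families of directed paths and cycles -/

/-- Arcs `tail j → head j` on the vertices `0, …, n - 1`, in two classes (those with and those
without `F`), such that in each class each vertex has at most one incoming and at most one outgoing
arc. The components of the class `F` are the blocks: the vertex `v` has position `pos v`, its block
occupies the positions from `base v` to `base v + len (base v) - 1`, and the arcs of `F` go to the
next position, or from the last to the first position of a block. -/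
structure ArcBlocks (n m : ℕ) where
  tail : Fin m → Fin n
  head : Fin m → Fin n
  F : Fin m → Prop
  pos : Fin n → ℤ
  base : Fin n → ℤ
  len : ℤ → ℤ
  distinct : ∀ i j, i ≠ j → s(tail i, head i) ≠ s(tail j, head j)
  ne : ∀ i, tail i ≠ head i
  tail_inj : ∀ i j, (F i ↔ F j) → tail i = tail j → i = j
  head_inj : ∀ i j, (F i ↔ F j) → head i = head j → i = j
  pos_inj : Function.Injective pos
  mem_block : ∀ v, base v ≤ pos v ∧ pos v < base v + len (base v)
  blocks : ∀ v w, base v < base w → base v + len (base v) ≤ base w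
  arc : ∀ i, F i → base (head i) = base (tail i) ∧ (pos (head i) = pos (tail i) + 1 ∨
    (pos (head i) = base (tail i) ∧ pos (tail i) + 1 = base (tail i) + len (base (tail i))))
  pred : ∀ v, pos v ≠ base v → ∃ i, F i ∧ head i = v ∧ pos (tail i) + 1 = pos v
  full : ∀ v p, base v ≤ p → p < base v + len (base v) → ∃ w, pos w = p

namespace ArcBlocks

variable {n m : ℕ} (A : ArcBlocks n m)

/-- The block with the given base is a cycle. -/
def Cyclic (b : ℤ) : Prop := ∃ i, A.F i ∧ A.pos (A.head i) = b

/-- `v` may serve as the start of the rotated block. -/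
def IsStart (v : Fin n) : Prop :=
  (¬ ∃ i, A.F i ∧ A.head i = v) ∨
    (A.Cyclic (A.base v) ∧ ¬ ∃ i, ¬ A.F i ∧ A.tail i = v ∧ A.base (A.head i) = A.base v)

/-- `v` may serve as the end of the first part of the rotated block. -/
def IsTurn (v : Fin n) : Prop :=
  (¬ ∃ i, A.F i ∧ A.tail i = v) ∨
    (A.Cyclic (A.base v) ∧ ¬ ∃ i, ¬ A.F i ∧ A.head i = v ∧ A.base (A.tail i) = A.base v)

theorem base_eq_of_mem {v w : Fin n} (h1 : A.base v ≤ A.pos w)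
    (h2 : A.pos w < A.base v + A.len (A.base v)) : A.base w = A.base v := by
  have h3 := A.mem_block w
  rcases lt_trichotomy (A.base w) (A.base v) with h | h | h
  · have := A.blocks w v h; omega
  · exact h
  · have := A.blocks v w h; omega

/-- In a cycle, each vertex has a predecessor. -/
theorem exists_pred {v : Fin n} (hc : A.Cyclic (A.base v)) : ∃ i, A.F i ∧ A.head i = v := by
  by_cases h : A.pos v = A.base v
  · obtain ⟨i, hi, h'⟩ := hc
    exact ⟨i, hi, A.pos_inj (h'.trans h.symm)⟩
  · obtain ⟨i, hi, h', -⟩ := A.pred v h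
    exact ⟨i, hi, h'⟩

/-- Pigeonhole: choosing a related element in `B` gives an injective self-map of a finite set, which
is surjective. -/
theorem surj_of_inj {V : Type*} [Fintype V] [DecidableEq V] (B : Finset V) (r : V → V → Prop)
    (h1 : ∀ v ∈ B, ∃ w ∈ B, r v w) (h2 : ∀ v v' w, r v w → r v' w → v = v') :
    ∀ w ∈ B, ∃ v ∈ B, r v w := by
  choose! f hf hr using h1
  have := Finset.surj_on_of_inj_on_of_card_le (s := B) (t := B) (fun a _ => f a)
    (fun a ha => hf a ha) (fun a b ha hb e => h2 a b (f a) (hr a ha) (by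
      have : f a = f b := e
      rw [this]; exact hr b hb)) le_rfl
  intro w hw
  obtain ⟨v, hv, e⟩ := this w hw
  exact ⟨v, hv, by rw [e]; exact hr v hv⟩

/-- The arcs outside `F` define an injective partial map on the vertices. If it maps the block into
itself and is defined on all of it, then it permutes the block, so the arcs that enter the block's
vertices also start inside. -/
theorem inner_in_of_inner_out (b : ℤ)
    (h : ∀ v, A.base v = b → ∃ i, ¬ A.F i ∧ A.tail i = v ∧ A.base (A.head i) = b) :
    ∀ v, A.base v = b → ∃ i, ¬ A.F i ∧ A.head i = v ∧ A.base (A.tail i) = b := by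
  classical
  intro v hv
  obtain ⟨w, hw, i, hi, h1, h2⟩ := surj_of_inj (Finset.univ.filter fun v => A.base v = b)
    (fun v w => ∃ i, ¬ A.F i ∧ A.tail i = v ∧ A.head i = w) (by
      intro v hv
      obtain ⟨i, h1, h2, h3⟩ := h v (by simpa using hv)
      exact ⟨A.head i, by simpa using h3, i, h1, h2, rfl⟩) (by
      rintro v v' w ⟨i, h1, rfl, rfl⟩ ⟨j, h2, rfl, h3⟩
      rw [A.head_inj i j (by simp [h1, h2]) h3.symm]) v (by simpa using hv)
  exact ⟨i, hi, h2, by rw [h1]; simpa using hw⟩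

theorem inner_out_of_inner_in (b : ℤ)
    (h : ∀ v, A.base v = b → ∃ i, ¬ A.F i ∧ A.head i = v ∧ A.base (A.tail i) = b) :
    ∀ v, A.base v = b → ∃ i, ¬ A.F i ∧ A.tail i = v ∧ A.base (A.head i) = b := by
  classical
  intro v hv
  obtain ⟨w, hw, i, hi, h1, h2⟩ := surj_of_inj (Finset.univ.filter fun v => A.base v = b)
    (fun v w => ∃ i, ¬ A.F i ∧ A.head i = v ∧ A.tail i = w) (by
      intro v hv
      obtain ⟨i, h1, h2, h3⟩ := h v (by simpa using hv)
      exact ⟨A.tail i, by simpa using h3, i, h1, h2, rfl⟩) (by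
      rintro v v' w ⟨i, h1, rfl, rfl⟩ ⟨j, h2, rfl, h3⟩
      rw [A.tail_inj i j (by simp [h1, h2]) h3.symm]) v (by simpa using hv)
  exact ⟨i, hi, h2, by rw [h1]; simpa using hw⟩

end ArcBlocks

/-- The choice of a start and of a turn for each block: `S b` and `T b` are their positions plus
one; they are zero if the arcs that are not in `F` do not leave the block. -/
structure RotatedBlocks (n m : ℕ) extends ArcBlocks n m where
  S : ℤ → ℤ
  T : ℤ → ℤ
  start : ∀ v, (S (base v) = 0 ∧ ∀ w, base w = base v → ¬ toArcBlocks.IsStart w) ∨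
    ∃ w, base w = base v ∧ S (base v) = pos w + 1 ∧ toArcBlocks.IsStart w
  turn : ∀ v, (T (base v) = 0 ∧ ∀ w, base w = base v → ¬ toArcBlocks.IsTurn w) ∨
    ∃ w, base w = base v ∧ T (base v) = pos w + 1 ∧ toArcBlocks.IsTurn w
  pos_nonneg : ∀ v, 0 ≤ pos v

/-- The residue of `z` modulo `k`, for `- k ≤ z < k`. -/
def wrap (k z : ℤ) : ℤ := if z < 0 then z + k else z

/-- The reflection of the interval from `0` to `k - 1`, or the identity. -/
def reflect (f : Bool) (k z : ℤ) : ℤ := if f then k - 1 - z else z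

/-! ### Coordinates and bends in rotated blocks -/

namespace RotatedBlocks

variable {n m : ℕ} (R : RotatedBlocks n m)

/-- Whether the block with base `b` is reflected horizontally. -/
noncomputable def flipX (b : ℤ) : Bool := by
  classical
  exact decide (∃ i, ¬ R.F i ∧ R.pos (R.tail i) + 1 = R.S b ∧ R.pos (R.tail i) < R.pos (R.head i))

/-- Whether the block with base `b` is reflected vertically. -/
noncomputable def flipY (b : ℤ) : Bool := by
  classical
  exact decide (∃ i, ¬ R.F i ∧ R.pos (R.head i) + 1 = R.T b ∧ R.pos (R.tail i) < R.pos (R.head i))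

/-- The position of a vertex within its rotated block. -/
def idx (v : Fin n) : ℤ := wrap (R.len (R.base v)) (R.pos v + 1 - R.S (R.base v))

/-- The size of the first part of a rotated block. -/
def part (b : ℤ) : ℤ := wrap (R.len b) (R.T b - R.S b) + 1

/-- Up to reflection, the columns follow the rotated order, so that the start lies in an extreme
column of its square. A block without a start stays unrotated, on the diagonal. -/
noncomputable def X (v : Fin n) : ℤ :=
  if R.S (R.base v) = 0 then R.pos v
  else R.base v + reflect (R.flipX (R.base v)) (R.len (R.base v)) (R.idx v)

/-- Up to reflection, the first part, from the start to the turn, is raised above the rest. Then the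
turn is in the top row, and its successor, one column further, is in the bottom row; the last vertex
is in the row just below the start. So the arc out of the turn joins neighbouring columns, the arc
into the start joins neighbouring rows, and all other arcs of the block are unit diagonals. -/
noncomputable def Y (v : Fin n) : ℤ :=
  if R.S (R.base v) = 0 then R.pos v
  else R.base v + reflect (R.flipY (R.base v)) (R.len (R.base v))
    (if R.idx v < R.part (R.base v) then R.len (R.base v) - R.part (R.base v) + R.idx v
      else R.idx v - R.part (R.base v))

/-- Arcs outside `F` always count as bent. In a block without a start only the closing arc is bent;
otherwise the arcs out of the turn and into the start are. -/
def Bent (j : Fin m) : Prop :=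
  R.F j → if R.S (R.base (R.tail j)) = 0 then R.pos (R.head j) = R.base (R.tail j)
    else R.pos (R.tail j) + 1 = R.T (R.base (R.tail j)) ∨
      R.pos (R.head j) + 1 = R.S (R.base (R.tail j))

-- The ends `a` and `c` are those left horizontally and vertically, so the roles of tail and head
-- are exchanged for arcs in `F`. The tilts of bent arcs: in a block without a start the closing arc
-- bends outside the lower right corner of the square; the arc out of the turn is exactly vertical
-- at the turn and tilted at its head, unless this is the start; the arc into the start is exactly
-- horizontal at the start and tilted at its tail, unless this is the turn. The signs prescribed for
-- straight arcs play no role in the drawing.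
open Classical in
noncomputable def layout : GridLayout (Fin n) (Fin m) where
  X := R.X
  Y := R.Y
  a j := if R.F j then R.head j else R.tail j
  c j := if R.F j then R.tail j else R.head j
  α j := if R.F j then
      if R.S (R.base (R.tail j)) = 0 then 1
      else if R.pos (R.tail j) + 1 = R.T (R.base (R.tail j)) then 0
      else if R.X (R.tail j) < R.X (R.head j) then 1 else -1
    else 0
  β j := if R.F j then
      if R.S (R.base (R.tail j)) = 0 then -1
      else if R.pos (R.head j) + 1 = R.S (R.base (R.tail j)) then 0
      else if R.Y (R.head j) < R.Y (R.tail j) then 1 else -1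
    else 0
  bent := R.Bent

variable {R}

theorem start_of_S_ne_zero {v : Fin n} (h : R.S (R.base v) ≠ 0) :
    ∃ w, R.base w = R.base v ∧ R.S (R.base v) = R.pos w + 1 ∧ R.IsStart w := by
  rcases R.start v with h' | h'
  · exact absurd h'.1 h
  · exact h'

theorem not_isStart {v : Fin n} (h : R.S (R.base v) = 0) : ¬ R.IsStart v := by
  rcases R.start v with h' | ⟨w, -, h', -⟩
  · exact h'.2 v rfl
  · have := R.pos_nonneg w; omega

/-- In a block without a start, the arcs that are not in `F` do not leave the block. -/
theorem closed {v : Fin n} (h : R.S (R.base v) = 0) : R.Cyclic (R.base v) ∧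
    ∀ w, R.base w = R.base v →
      (∃ i, ¬ R.F i ∧ R.tail i = w ∧ R.base (R.head i) = R.base v) ∧
      (∃ i, ¬ R.F i ∧ R.head i = w ∧ R.base (R.tail i) = R.base v) := by
  have hc : R.Cyclic (R.base v) := by
    have hm := R.mem_block v
    obtain ⟨f, hf⟩ := R.full v (R.base v) le_rfl (by omega)
    have hb : R.base f = R.base v := R.base_eq_of_mem hf.ge (by omega)
    have := not_isStart (v := f) (by rw [hb]; exact h)
    simp only [ArcBlocks.IsStart, not_or, not_not] at this
    obtain ⟨i, hi, h'⟩ := this.1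
    exact ⟨i, hi, by rw [h', hf]⟩
  have hout : ∀ w, R.base w = R.base v →
      ∃ i, ¬ R.F i ∧ R.tail i = w ∧ R.base (R.head i) = R.base v := by
    intro w hw
    have := not_isStart (v := w) (by rw [hw]; exact h)
    simp only [ArcBlocks.IsStart, not_or, not_and, not_not] at this
    obtain ⟨i, h1, h2, h3⟩ := this.2 (by rwa [hw])
    exact ⟨i, h1, h2, by rw [h3, hw]⟩
  -- Without a start, every vertex of the cycle sends its arc outside `F` into the block itself, and
  -- pigeonhole yields the incoming arcs.
  exact ⟨hc, fun w hw => ⟨hout w hw, R.inner_in_of_inner_out _ hout w hw⟩⟩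

/-- If there were no turn, the last vertex would have an outgoing arc in `F`, so the block would be
a cycle, and each of its vertices would receive an arc outside `F` from within the block. By
pigeonhole each vertex also sends one into the block, which contradicts the existence of a start. -/
theorem turn_of_S_ne_zero {v : Fin n} (h : R.S (R.base v) ≠ 0) :
    ∃ w, R.base w = R.base v ∧ R.T (R.base v) = R.pos w + 1 ∧ R.IsTurn w := by
  rcases R.turn v with ⟨-, h'⟩ | h'
  · exfalso
    have hm := R.mem_block v
    have hc : R.Cyclic (R.base v) := by
      obtain ⟨l, hl⟩ := R.full v (R.base v + R.len (R.base v) - 1) (by omega) (by omega)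
      have hb : R.base l = R.base v := R.base_eq_of_mem (by omega) (by omega)
      have := h' l hb
      simp only [ArcBlocks.IsTurn, not_or, not_not] at this
      obtain ⟨i, hi, rfl⟩ := this.1
      obtain ⟨h1, h2⟩ := R.arc i hi
      have := R.mem_block (R.head i)
      rw [h1, hb] at this
      rw [hb] at h2
      exact ⟨i, hi, by omega⟩
    obtain ⟨w, hw, -, hs⟩ := start_of_S_ne_zero h
    rw [← hw] at hc
    rcases hs with hs | ⟨-, hs⟩
    · exact hs (R.exists_pred hc)
    · apply hs
      have := R.inner_out_of_inner_in (R.base v) (fun u hu => by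
        have := h' u hu
        simp only [ArcBlocks.IsTurn, not_or, not_and, not_not] at this
        obtain ⟨i, h1, h2, h3⟩ := this.2 (by rw [hu, ← hw]; exact hc)
        exact ⟨i, h1, h2, by rw [h3, hu]⟩) w hw
      rwa [hw]
  · exact h'

/-- The basic facts on rotated blocks. -/
theorem idx_facts {v : Fin n} (h : R.S (R.base v) ≠ 0) :
    0 ≤ R.idx v ∧ R.idx v < R.len (R.base v) ∧ 1 ≤ R.part (R.base v) ∧
      R.part (R.base v) ≤ R.len (R.base v) ∧
      (R.pos v + 1 = R.S (R.base v) ↔ R.idx v = 0) ∧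
      (R.pos v + 1 = R.T (R.base v) ↔ R.idx v = R.part (R.base v) - 1) := by
  obtain ⟨w, h1, h2, -⟩ := start_of_S_ne_zero h
  obtain ⟨u, h3, h4, -⟩ := turn_of_S_ne_zero h
  have m1 := R.mem_block w
  have m2 := R.mem_block u
  have m3 := R.mem_block v
  rw [h1] at m1
  rw [h3] at m2
  simp only [idx, part, wrap]
  split_ifs <;> omega

theorem idx_eq_iff {v w : Fin n} (h : R.S (R.base v) ≠ 0) (hb : R.base w = R.base v) :
    R.idx v = R.idx w → v = w := by
  intro e
  obtain ⟨u, h1, h2, -⟩ := start_of_S_ne_zero h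
  have m1 := R.mem_block v
  have m2 := R.mem_block w
  have m3 := R.mem_block u
  simp only [idx, wrap, hb] at e
  rw [hb] at m2
  rw [h1] at m3
  apply R.pos_inj
  split_ifs at e <;> omega

/-- Arcs in rotated blocks. -/
theorem idx_arc {i : Fin m} (hi : R.F i) (h : R.S (R.base (R.tail i)) ≠ 0) :
    R.idx (R.head i) = R.idx (R.tail i) + 1 ∨
      (R.idx (R.head i) = 0 ∧ R.idx (R.tail i) + 1 = R.len (R.base (R.tail i))) := by
  obtain ⟨hb, ha⟩ := R.arc i hi
  obtain ⟨u, h1, h2, -⟩ := start_of_S_ne_zero h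
  have m1 := R.mem_block (R.tail i)
  have m2 := R.mem_block (R.head i)
  have m3 := R.mem_block u
  rw [hb] at m2
  rw [h1] at m3
  simp only [idx, wrap, hb]
  split_ifs <;> omega

theorem X_mem (v : Fin n) : R.base v ≤ R.X v ∧ R.X v < R.base v + R.len (R.base v) := by
  have m := R.mem_block v
  by_cases h : R.S (R.base v) = 0
  · simp only [X, h, if_true]; exact m
  · have := idx_facts h
    simp only [X, h, if_false, reflect]
    split_ifs <;> omega

theorem Y_mem (v : Fin n) : R.base v ≤ R.Y v ∧ R.Y v < R.base v + R.len (R.base v) := by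
  have m := R.mem_block v
  by_cases h : R.S (R.base v) = 0
  · simp only [Y, h, if_true]; exact m
  · have := idx_facts h
    simp only [Y, h, if_false, reflect]
    split_ifs <;> omega

theorem X_lt_of_base_lt {v w : Fin n} (h : R.base v < R.base w) : R.X v < R.X w := by
  have := R.blocks v w h
  have := R.X_mem v
  have := R.X_mem w
  omega

theorem Y_lt_of_base_lt {v w : Fin n} (h : R.base v < R.base w) : R.Y v < R.Y w := by
  have := R.blocks v w h
  have := R.Y_mem v
  have := R.Y_mem w
  omega

theorem X_injective : Function.Injective R.X := by
  intro v w e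
  have hb : R.base w = R.base v := by
    rcases lt_trichotomy (R.base v) (R.base w) with h | h | h
    · have := X_lt_of_base_lt h; omega
    · exact h.symm
    · have := X_lt_of_base_lt h; omega
  by_cases h : R.S (R.base v) = 0
  · simp only [X, hb, h, if_true] at e
    exact R.pos_inj e
  · apply idx_eq_iff h hb
    simp only [X, hb, h, if_false, reflect] at e
    split_ifs at e <;> omega

theorem Y_injective : Function.Injective R.Y := by
  intro v w e
  have hb : R.base w = R.base v := by
    rcases lt_trichotomy (R.base v) (R.base w) with h | h | h
    · have := Y_lt_of_base_lt h; omega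
    · exact h.symm
    · have := Y_lt_of_base_lt h; omega
  by_cases h : R.S (R.base v) = 0
  · simp only [Y, hb, h, if_true] at e
    exact R.pos_inj e
  · apply idx_eq_iff h hb
    have f1 := idx_facts h
    have f2 := idx_facts (v := w) (by rw [hb]; exact h)
    simp only [Y, hb, h, if_false, reflect] at e
    rw [hb] at f2
    split_ifs at e <;> omega

end RotatedBlocks

/-! ### Validity of the layout of rotated blocks -/

namespace RotatedBlocks

variable {n m : ℕ} {R : RotatedBlocks n m}

theorem X_eq {v : Fin n} (h : R.S (R.base v) ≠ 0) :
    (R.flipX (R.base v) = false ∧ R.X v = R.base v + R.idx v) ∨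
      (R.flipX (R.base v) = true ∧ R.X v = R.base v + (R.len (R.base v) - 1 - R.idx v)) := by
  cases hf : R.flipX (R.base v) <;> simp [X, h, reflect, hf]

theorem Y_eq {v : Fin n} (h : R.S (R.base v) ≠ 0) :
    ∃ y, ((R.idx v < R.part (R.base v) ∧ y = R.len (R.base v) - R.part (R.base v) + R.idx v) ∨
        (R.part (R.base v) ≤ R.idx v ∧ y = R.idx v - R.part (R.base v))) ∧
      ((R.flipY (R.base v) = false ∧ R.Y v = R.base v + y) ∨
        (R.flipY (R.base v) = true ∧ R.Y v = R.base v + (R.len (R.base v) - 1 - y))) := by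
  refine ⟨if R.idx v < R.part (R.base v) then R.len (R.base v) - R.part (R.base v) + R.idx v
      else R.idx v - R.part (R.base v), ?_, ?_⟩
  · split_ifs <;> omega
  · cases hf : R.flipY (R.base v) <;> simp [Y, h, reflect, hf]

theorem F_a {j : Fin m} (h : R.F j) : R.layout.a j = R.head j := by simp [layout, h]
theorem F_c {j : Fin m} (h : R.F j) : R.layout.c j = R.tail j := by simp [layout, h]
theorem not_F_a {j : Fin m} (h : ¬ R.F j) : R.layout.a j = R.tail j := by simp [layout, h]
theorem not_F_c {j : Fin m} (h : ¬ R.F j) : R.layout.c j = R.head j := by simp [layout, h]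
theorem not_F_α {j : Fin m} (h : ¬ R.F j) : R.layout.α j = 0 := by simp [layout, h]
theorem not_F_β {j : Fin m} (h : ¬ R.F j) : R.layout.β j = 0 := by simp [layout, h]

set_option maxHeartbeats 1000000 in
/-- The possibilities for an arc in `F`. -/
theorem F_cases {j : Fin m} (h : R.F j) :
    (R.S (R.base (R.tail j)) = 0 ∧
      ((R.Bent j ∧ R.layout.α j = 1 ∧ R.layout.β j = -1 ∧
          R.X (R.head j) = R.base (R.tail j) ∧ R.Y (R.head j) = R.base (R.tail j) ∧
          R.X (R.tail j) + 1 = R.base (R.tail j) + R.len (R.base (R.tail j)) ∧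
          R.Y (R.tail j) = R.X (R.tail j) ∧ R.pos (R.head j) = R.base (R.tail j)) ∨
        (¬ R.Bent j ∧ R.layout.α j = 1 ∧ R.layout.β j = -1 ∧
          R.X (R.head j) = R.X (R.tail j) + 1 ∧ R.Y (R.head j) = R.Y (R.tail j) + 1))) ∨
    (R.S (R.base (R.tail j)) ≠ 0 ∧ R.pos (R.tail j) + 1 = R.T (R.base (R.tail j)) ∧
      R.pos (R.head j) + 1 = R.S (R.base (R.tail j)) ∧ R.Bent j ∧ R.layout.α j = 0 ∧
      R.layout.β j = 0) ∨
    (R.S (R.base (R.tail j)) ≠ 0 ∧ R.pos (R.tail j) + 1 = R.T (R.base (R.tail j)) ∧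
      R.pos (R.head j) + 1 ≠ R.S (R.base (R.tail j)) ∧ R.Bent j ∧ R.layout.α j = 0 ∧
      (R.layout.β j = 1 ∨ R.layout.β j = -1) ∧ R.idx (R.tail j) + 1 = R.part (R.base (R.tail j)) ∧
      R.idx (R.head j) = R.part (R.base (R.tail j)) ∧
      (R.X (R.head j) = R.X (R.tail j) + 1 ∨ R.X (R.tail j) = R.X (R.head j) + 1)) ∨
    (R.S (R.base (R.tail j)) ≠ 0 ∧ R.pos (R.tail j) + 1 ≠ R.T (R.base (R.tail j)) ∧
      R.pos (R.head j) + 1 = R.S (R.base (R.tail j)) ∧ R.Bent j ∧ R.layout.β j = 0 ∧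
      (R.layout.α j = 1 ∨ R.layout.α j = -1) ∧
      R.idx (R.tail j) + 1 = R.len (R.base (R.tail j)) ∧ R.idx (R.head j) = 0 ∧
      R.part (R.base (R.tail j)) < R.len (R.base (R.tail j)) ∧
      (R.Y (R.head j) = R.Y (R.tail j) + 1 ∨ R.Y (R.tail j) = R.Y (R.head j) + 1)) ∨
    (R.S (R.base (R.tail j)) ≠ 0 ∧ ¬ R.Bent j ∧ (R.layout.α j = 1 ∨ R.layout.α j = -1) ∧
      (R.layout.β j = 1 ∨ R.layout.β j = -1) ∧
      (R.X (R.head j) = R.X (R.tail j) + 1 ∨ R.X (R.tail j) = R.X (R.head j) + 1) ∧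
      (R.Y (R.head j) = R.Y (R.tail j) + 1 ∨ R.Y (R.tail j) = R.Y (R.head j) + 1)) := by
  obtain ⟨hb, ha⟩ := R.arc j h
  by_cases hS : R.S (R.base (R.tail j)) = 0
  · left
    refine ⟨hS, ?_⟩
    have hα : R.layout.α j = 1 := by simp [layout, h, hS]
    have hβ : R.layout.β j = -1 := by simp [layout, h, hS]
    have hB : R.Bent j ↔ R.pos (R.head j) = R.base (R.tail j) := by simp [Bent, h, hS]
    have hX : ∀ v, R.base v = R.base (R.tail j) → R.X v = R.pos v := by
      intro v hv
      simp [X, hv, hS]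
    have hY : ∀ v, R.base v = R.base (R.tail j) → R.Y v = R.pos v := by
      intro v hv
      simp [Y, hv, hS]
    rw [hX _ rfl, hX _ hb, hY _ rfl, hY _ hb, hα, hβ, hB]
    have := R.mem_block (R.tail j)
    by_cases e : R.pos (R.head j) = R.base (R.tail j)
    · left
      refine ⟨e, rfl, rfl, e, e, ?_, rfl, e⟩
      rcases ha with ha | ha
      · omega
      · exact ha.2
    · right
      exact ⟨e, rfl, rfl, by omega, by omega⟩
  · right
    have f1 := idx_facts hS
    have f2 := idx_facts (v := R.head j) (by rw [hb]; exact hS)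
    have f3 := idx_arc h hS
    have x1 := X_eq hS
    have x2 := X_eq (v := R.head j) (by rw [hb]; exact hS)
    obtain ⟨y, y1, y1'⟩ := Y_eq hS
    obtain ⟨y', y2, y2'⟩ := Y_eq (v := R.head j) (by rw [hb]; exact hS)
    rw [hb] at f2 x2 y2 y2'
    have hα : R.layout.α j = if R.pos (R.tail j) + 1 = R.T (R.base (R.tail j)) then 0
        else if R.X (R.tail j) < R.X (R.head j) then 1 else -1 := by simp [layout, h, hS]
    have hβ : R.layout.β j = if R.pos (R.head j) + 1 = R.S (R.base (R.tail j)) then 0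
        else if R.Y (R.head j) < R.Y (R.tail j) then 1 else -1 := by simp [layout, h, hS]
    have hB : R.Bent j ↔ R.pos (R.tail j) + 1 = R.T (R.base (R.tail j)) ∨
        R.pos (R.head j) + 1 = R.S (R.base (R.tail j)) := by simp [Bent, h, hS]
    rw [hB]
    by_cases hT : R.pos (R.tail j) + 1 = R.T (R.base (R.tail j))
    · rw [if_pos hT] at hα
      by_cases hH : R.pos (R.head j) + 1 = R.S (R.base (R.tail j))
      · rw [if_pos hH] at hβ
        exact Or.inl ⟨hS, hT, hH, Or.inl hT, hα, hβ⟩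
      · rw [if_neg hH] at hβ
        have e1 : R.idx (R.tail j) + 1 = R.part (R.base (R.tail j)) := by
          have := f1.2.2.2.2.2.1 hT
          omega
        have e2 : R.idx (R.head j) = R.part (R.base (R.tail j)) := by
          rcases f3 with f3 | f3
          · omega
          · exact absurd (f2.2.2.2.2.1.2 f3.1) hH
        clear f1 f2 f3
        refine Or.inr (Or.inl ⟨hS, hT, hH, Or.inl hT, hα, ?_, e1, e2, ?_⟩)
        · clear x1 x2 y1 y1' y2 y2'
          split_ifs at hβ <;> omega
        · clear y1' y2' y1 y2 hβ hα
          rcases x1 with x1 | x1 <;> rcases x2 with x2 | x2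
          · omega
          · exact absurd (x1.1.symm.trans x2.1) (by simp)
          · exact absurd (x1.1.symm.trans x2.1) (by simp)
          · omega
    · rw [if_neg hT] at hα
      have hα' : R.layout.α j = 1 ∨ R.layout.α j = -1 := by split_ifs at hα <;> omega
      by_cases hH : R.pos (R.head j) + 1 = R.S (R.base (R.tail j))
      · rw [if_pos hH] at hβ
        have e1 : R.idx (R.head j) = 0 := f2.2.2.2.2.1.1 hH
        have e2 : R.idx (R.tail j) + 1 = R.len (R.base (R.tail j)) := by
          rcases f3 with f3 | f3
          · have := f1.1
            omega
          · exact f3.2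
        have e3 : R.idx (R.tail j) ≠ R.part (R.base (R.tail j)) - 1 :=
          fun e => hT (f1.2.2.2.2.2.2 e)
        have e4 := f1.2.2.1
        have e5 := f1.2.2.2.1
        clear f1 f2 f3 hα hB x1 x2
        refine Or.inr (Or.inr (Or.inl ⟨hS, hT, hH, Or.inr hH, hβ, hα', e2, e1, by omega, ?_⟩))
        have e6 : y' = y + 1 := by omega
        rcases y1' with y1' | y1' <;> rcases y2' with y2' | y2'
        · omega
        · exact absurd (y1'.1.symm.trans y2'.1) (by simp)
        · exact absurd (y1'.1.symm.trans y2'.1) (by simp)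
        · omega
      · rw [if_neg hH] at hβ
        have hβ' : R.layout.β j = 1 ∨ R.layout.β j = -1 := by split_ifs at hβ <;> omega
        have e1 : R.idx (R.head j) = R.idx (R.tail j) + 1 := by
          rcases f3 with f3 | f3
          · exact f3
          · exact absurd (f2.2.2.2.2.1.2 f3.1) hH
        have e2 : R.idx (R.tail j) ≠ R.part (R.base (R.tail j)) - 1 :=
          fun e => hT (f1.2.2.2.2.2.2 e)
        clear f1 f2 f3 hα hβ hB
        refine Or.inr (Or.inr (Or.inr ⟨hS, fun h => h.elim hT hH, hα', hβ', ?_, ?_⟩))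
        · clear y1 y2 y1' y2'
          rcases x1 with x1 | x1 <;> rcases x2 with x2 | x2
          · omega
          · exact absurd (x1.1.symm.trans x2.1) (by simp)
          · exact absurd (x1.1.symm.trans x2.1) (by simp)
          · omega
        · clear x1 x2
          have e3 : y' = y + 1 := by omega
          rcases y1' with y1' | y1' <;> rcases y2' with y2' | y2'
          · omega
          · exact absurd (y1'.1.symm.trans y2'.1) (by simp)
          · exact absurd (y1'.1.symm.trans y2'.1) (by simp)
          · omega

theorem F_of_β_ne_zero {j : Fin m} (h : R.layout.β j ≠ 0) : R.F j := by
  by_contra hF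
  exact h (not_F_β hF)

theorem F_of_α_ne_zero {j : Fin m} (h : R.layout.α j ≠ 0) : R.F j := by
  by_contra hF
  exact h (not_F_α hF)

/-- An exactly horizontal arc `g` of `F` enters a start. Since the start has a predecessor, its arc
`f` outside `F` goes to another block. The reflection puts the start on the side of its square that
faces this block, so `f` leaves the square while `g` comes from inside. -/
theorem port_mixed {f g : Fin m} (hf : ¬ R.F f) (hg : R.F g)
    (h0 : R.layout.β g = 0) (ha : R.tail f = R.head g) :
    (R.X (R.head f) - R.X (R.tail f)) * (R.X (R.tail g) - R.X (R.head g)) < 0 := by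
  obtain ⟨hb, -⟩ := R.arc g hg
  obtain ⟨hS, hH⟩ : R.S (R.base (R.tail g)) ≠ 0 ∧
      R.pos (R.head g) + 1 = R.S (R.base (R.tail g)) := by
    rcases F_cases hg with ⟨-, h | h⟩ | h | h | h | h
    · omega
    · omega
    · exact ⟨h.1, h.2.2.1⟩
    · omega
    · exact ⟨h.1, h.2.2.1⟩
    · omega
  rw [← hb] at hS hH
  obtain ⟨w, hw1, hw2, hw3⟩ := start_of_S_ne_zero hS
  obtain rfl : w = R.head g := R.pos_inj (by omega)
  rcases hw3 with hw3 | ⟨-, hw3⟩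
  · exact absurd ⟨g, hg, rfl⟩ hw3
  have hne : R.base (R.head f) ≠ R.base (R.head g) := fun e => hw3 ⟨f, hf, ha, e⟩
  have f1 := idx_facts hS
  have f2 := idx_facts (v := R.tail g) (by rw [← hb]; exact hS)
  have x1 := X_eq hS
  have x2 := X_eq (v := R.tail g) (by rw [← hb]; exact hS)
  rw [← hb] at f2 x2
  have hidx : R.idx (R.tail g) ≠ R.idx (R.head g) := fun e => R.ne g (idx_eq_iff hS hb.symm e.symm).symm
  -- As `f` is the only arc outside `F` that leaves the start, the reflection is decided by the
  -- direction of `f`.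
  have hflip : R.flipX (R.base (R.head g)) = true ↔ R.pos (R.head g) < R.pos (R.head f) := by
    simp only [flipX, decide_eq_true_eq]
    constructor
    · rintro ⟨i, h1, h2, h3⟩
      have : R.tail i = R.head g := R.pos_inj (by omega)
      obtain rfl : i = f := R.tail_inj i f (by simp [h1, hf]) (by rw [this, ha])
      rwa [this] at h3
    · intro h
      exact ⟨f, hf, by rw [ha]; exact hH, by rw [ha]; exact h⟩
  rw [ha]
  rcases lt_or_gt_of_ne hne with h | h
  · have h1 := R.blocks _ _ h
    have h2 := R.mem_block (R.head f)
    have h3 := R.mem_block (R.head g)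
    have h4 := X_lt_of_base_lt h
    rcases x1 with x1 | x1
    · rcases x2 with x2 | x2
      · exact mul_neg_of_neg_of_pos (by omega) (by omega)
      · exact absurd (x1.1.symm.trans x2.1) (by simp)
    · have := hflip.1 x1.1
      omega
  · have h1 := R.blocks _ _ h
    have h2 := R.mem_block (R.head f)
    have h3 := R.mem_block (R.head g)
    have h4 := X_lt_of_base_lt h
    have h5 := hflip.2 (by omega)
    rcases x1 with x1 | x1
    · exact absurd (x1.1.symm.trans h5) (by simp)
    · rcases x2 with x2 | x2
      · exact absurd (x1.1.symm.trans x2.1) (by simp)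
      · exact mul_neg_of_pos_of_neg (by omega) (by omega)

/-- The vertical counterpart at a turn: `f` comes from another block, and the vertical reflection
puts the turn into the row of its square that faces that block. -/
theorem port_mixed' {f g : Fin m} (hf : ¬ R.F f) (hg : R.F g)
    (h0 : R.layout.α g = 0) (ha : R.head f = R.tail g) :
    (R.Y (R.tail f) - R.Y (R.head f)) * (R.Y (R.head g) - R.Y (R.tail g)) < 0 := by
  obtain ⟨hb, -⟩ := R.arc g hg
  obtain ⟨hS, hH⟩ : R.S (R.base (R.tail g)) ≠ 0 ∧
      R.pos (R.tail g) + 1 = R.T (R.base (R.tail g)) := by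
    rcases F_cases hg with ⟨-, h | h⟩ | h | h | h | h
    · omega
    · omega
    · exact ⟨h.1, h.2.1⟩
    · exact ⟨h.1, h.2.1⟩
    · omega
    · omega
  obtain ⟨w, hw1, hw2, hw3⟩ := turn_of_S_ne_zero hS
  obtain rfl : w = R.tail g := R.pos_inj (by omega)
  rcases hw3 with hw3 | ⟨-, hw3⟩
  · exact absurd ⟨g, hg, rfl⟩ hw3
  have hne : R.base (R.tail f) ≠ R.base (R.tail g) := fun e => hw3 ⟨f, hf, ha, e⟩
  have f1 := idx_facts hS
  have f2 := idx_facts (v := R.head g) (by rw [hb]; exact hS)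
  obtain ⟨y1, hy1, x1⟩ := Y_eq hS
  obtain ⟨y2, hy2, x2⟩ := Y_eq (v := R.head g) (by rw [hb]; exact hS)
  rw [hb] at f2 x2 hy2
  have hidx : R.idx (R.head g) ≠ R.idx (R.tail g) := fun e => R.ne g (idx_eq_iff hS hb e.symm)
  have hflip : R.flipY (R.base (R.tail g)) = true ↔ R.pos (R.tail f) < R.pos (R.tail g) := by
    simp only [flipY, decide_eq_true_eq]
    constructor
    · rintro ⟨i, h1, h2, h3⟩
      have : R.head i = R.tail g := R.pos_inj (by omega)
      obtain rfl : i = f := R.head_inj i f (by simp [h1, hf]) (by rw [this, ha])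
      rwa [this] at h3
    · intro h
      exact ⟨f, hf, by rw [ha]; exact hH, by rw [ha]; exact h⟩
  rw [ha]
  rcases lt_or_gt_of_ne hne with h | h
  · have h1 := R.blocks _ _ h
    have h2 := R.mem_block (R.tail f)
    have h3 := R.mem_block (R.tail g)
    have h4 := Y_lt_of_base_lt h
    have h5 := hflip.2 (by omega)
    rcases x1 with x1 | x1
    · exact absurd (x1.1.symm.trans h5) (by simp)
    · rcases x2 with x2 | x2
      · exact absurd (x1.1.symm.trans x2.1) (by simp)
      · exact mul_neg_of_neg_of_pos (by omega) (by omega)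
  · have h1 := R.blocks _ _ h
    have h2 := R.mem_block (R.tail f)
    have h3 := R.mem_block (R.tail g)
    have h4 := Y_lt_of_base_lt h
    rcases x1 with x1 | x1
    · rcases x2 with x2 | x2
      · exact mul_neg_of_pos_of_neg (by omega) (by omega)
      · exact absurd (x1.1.symm.trans x2.1) (by simp)
    · have := hflip.1 x1.1
      omega

/-- Two arcs of the same class never have the same horizontal end, so only mixed pairs matter for
`port`, and `skew` is immediate. For `cross`, the tilted arc is in `F`; it either closes a block
without a start, or enters a start from a neighbouring row. -/
theorem layout_halfValid : R.layout.HalfValid where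
  inj := Y_injective
  small j := by
    by_cases h : R.F j
    · rcases F_cases h with ⟨-, h | h⟩ | h | h | h | h <;> omega
    · exact Or.inr (Or.inl (not_F_β h))
  straight j hj := by
    have h : R.F j := by
      by_contra h
      exact hj fun h' => absurd h' h
    have hj : ¬ R.Bent j := hj
    rw [F_a h, F_c h]
    change R.Y (R.tail j) - R.Y (R.head j) = 1 ∨ R.Y (R.tail j) - R.Y (R.head j) = -1
    rcases F_cases h with ⟨-, h | h⟩ | h | h | h | h
    · exact absurd h.1 hj
    · omega
    · exact absurd h.2.2.2.1 hj
    · exact absurd h.2.2.2.1 hj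
    · exact absurd h.2.2.2.1 hj
    · omega
  port f g hfg bf bg h0 h0' ha := by
    change (R.X _ - R.X _) * (R.X _ - R.X _) < 0
    by_cases hf : R.F f <;> by_cases hg : R.F g
    · rw [F_a hf, F_a hg] at ha
      exact absurd (R.head_inj f g (by simp [hf, hg]) ha) hfg
    · rw [F_a hf, not_F_a hg] at *
      rw [F_c hf, not_F_c hg, mul_comm]
      exact port_mixed hg hf h0 ha.symm
    · rw [F_a hg, not_F_a hf] at *
      rw [F_c hg, not_F_c hf]
      exact port_mixed hf hg h0' ha
    · rw [not_F_a hf, not_F_a hg] at ha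
      exact absurd (R.tail_inj f g (by simp [hf, hg]) ha) hfg
  skew f g hfg bf bg h0 h0' ha := by
    have hf := F_of_β_ne_zero h0
    have hg := F_of_β_ne_zero h0'
    rw [F_a hf, F_a hg] at ha
    exact hfg (R.head_inj f g (by simp [hf, hg]) ha)
  cross f g hfg bf bg h0 h0' := by
    have hg := F_of_α_ne_zero h0'
    have hY : ∀ v w, R.Y v = R.Y w → v = w := fun v w e => Y_injective e
    obtain ⟨hb, -⟩ := R.arc g hg
    have bg : R.Bent g := bg
    rw [F_a hg, F_c hg]
    change _ ∨ _ ∨ OutsideOf (R.Y _) (R.Y _) (R.Y _) ∨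
      ((R.X _ - R.X _) * _ ≤ 0 ∧ (R.X _ - R.X _) * _ ≤ 0)
    rcases F_cases hg with ⟨hS, h | h⟩ | h | h | h | h
    -- Here `g` closes a block without a start, and its almost vertical segment is tilted to the
    -- right of the last column. A horizontal segment from this block belongs to an arc outside `F`
    -- that stays in the block, hence to the left; one from another block runs in a row outside the
    -- square.
    · by_cases hbf : R.base (R.layout.a f) = R.base (R.tail g)
      · have hF : ¬ R.F f := by
          intro hF
          obtain ⟨hb', -⟩ := R.arc f hF
          rw [F_a hF, hb'] at hbf
          rcases F_cases hF with ⟨-, h | h⟩ | h | h | h | h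
          · omega
          · omega
          · rw [hbf] at h; exact absurd hS h.1
          · rw [hbf] at h; exact absurd hS h.1
          · rw [hbf] at h; exact absurd hS h.1
          · omega
        rw [not_F_a hF] at hbf ⊢
        rw [not_F_c hF]
        obtain ⟨i, h1, h2, h3⟩ := ((closed hS).2 _ hbf).1
        obtain rfl := R.tail_inj i f (by simp [h1, hF]) h2
        have x1 := R.X_mem (R.tail i)
        have x2 := R.X_mem (R.head i)
        rw [hbf] at x1
        rw [h3] at x2
        right; right; right
        rw [h.2.1]
        omega
      · right; right; left
        have y1 := R.Y_mem (R.layout.a f)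
        have y2 := R.Y_mem (R.tail g)
        rcases lt_or_gt_of_ne hbf with h' | h'
        · have := R.blocks _ _ h'
          left; omega
        · have := R.blocks _ _ h'
          right; omega
    · exact absurd bg h.1
    · exact absurd h.2.2.2.2.1 h0'
    · exact absurd h.2.2.2.2.1 h0'
    -- The ends of `g` are in neighbouring rows, so any other row is outside.
    · by_cases e1 : R.Y (R.layout.a f) = R.Y (R.tail g)
      · exact Or.inl (hY _ _ e1)
      by_cases e2 : R.Y (R.layout.a f) = R.Y (R.head g)
      · exact Or.inr (Or.inl ⟨hY _ _ e2, h.2.2.2.2.1⟩)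
      right; right; left
      simp only [OutsideOf]
      omega
    · exact absurd bg h.2.1

/-- The same with rows and columns exchanged: the turn takes the place of the start, and the closing
arc of a block without a start is tilted downwards, below the first row. -/
theorem layout_halfValid' : R.layout.transpose.HalfValid where
  inj := X_injective
  small j := by
    change R.layout.α j = _ ∨ R.layout.α j = _ ∨ R.layout.α j = _
    by_cases h : R.F j
    · rcases F_cases h with ⟨-, h | h⟩ | h | h | h | h <;> omega
    · exact Or.inr (Or.inl (not_F_α h))
  straight j hj := by
    have h : R.F j := by
      by_contra h
      exact hj fun h' => absurd h' h
    have hj : ¬ R.Bent j := hj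
    change R.X (R.layout.a j) - R.X (R.layout.c j) = 1 ∨
      R.X (R.layout.a j) - R.X (R.layout.c j) = -1
    rw [F_a h, F_c h]
    rcases F_cases h with ⟨-, h | h⟩ | h | h | h | h
    · exact absurd h.1 hj
    · omega
    · exact absurd h.2.2.2.1 hj
    · exact absurd h.2.2.2.1 hj
    · exact absurd h.2.2.2.1 hj
    · omega
  port f g hfg bf bg h0 h0' ha := by
    change (R.Y (R.layout.a f) - R.Y (R.layout.c f)) *
      (R.Y (R.layout.a g) - R.Y (R.layout.c g)) < 0
    change R.layout.c f = R.layout.c g at ha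
    by_cases hf : R.F f <;> by_cases hg : R.F g
    · rw [F_c hf, F_c hg] at ha
      exact absurd (R.tail_inj f g (by simp [hf, hg]) ha) hfg
    · rw [F_c hf, not_F_c hg] at *
      rw [F_a hf, not_F_a hg, mul_comm]
      exact port_mixed' hg hf h0 ha.symm
    · rw [F_c hg, not_F_c hf] at *
      rw [F_a hg, not_F_a hf]
      exact port_mixed' hf hg h0' ha
    · rw [not_F_c hf, not_F_c hg] at ha
      exact absurd (R.head_inj f g (by simp [hf, hg]) ha) hfg
  skew f g hfg bf bg h0 h0' ha := by
    have hf := F_of_α_ne_zero h0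
    have hg := F_of_α_ne_zero h0'
    change R.layout.c f = R.layout.c g at ha
    rw [F_c hf, F_c hg] at ha
    exact hfg (R.tail_inj f g (by simp [hf, hg]) ha)
  cross f g hfg bf bg h0 h0' := by
    change R.layout.α f = 0 at h0
    change R.layout.β g ≠ 0 at h0'
    have hg := F_of_β_ne_zero h0'
    have hX : ∀ v w, R.X v = R.X w → v = w := fun v w e => X_injective e
    obtain ⟨hb, -⟩ := R.arc g hg
    have bg : R.Bent g := bg
    change R.layout.c f = R.layout.a g ∨ (R.layout.c f = R.layout.c g ∧ R.layout.α g = 0) ∨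
      OutsideOf (R.X (R.layout.c f)) (R.X (R.layout.a g)) (R.X (R.layout.c g)) ∨
      ((R.Y (R.layout.c f) - R.Y (R.layout.a g)) * R.layout.β g ≤ 0 ∧
        (R.Y (R.layout.a f) - R.Y (R.layout.a g)) * R.layout.β g ≤ 0)
    rw [F_a hg, F_c hg]
    rcases F_cases hg with ⟨hS, h | h⟩ | h | h | h | h
    · by_cases hbf : R.base (R.layout.c f) = R.base (R.tail g)
      · have hF : ¬ R.F f := by
          intro hF
          rw [F_c hF] at hbf
          rcases F_cases hF with ⟨-, h | h⟩ | h | h | h | h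
          · omega
          · omega
          · rw [hbf] at h; exact absurd hS h.1
          · rw [hbf] at h; exact absurd hS h.1
          · rw [hbf] at h; exact absurd hS h.1
          · omega
        rw [not_F_c hF] at hbf ⊢
        rw [not_F_a hF]
        obtain ⟨i, h1, h2, h3⟩ := ((closed hS).2 _ hbf).2
        obtain rfl := R.head_inj i f (by simp [h1, hF]) h2
        have x1 := R.Y_mem (R.head i)
        have x2 := R.Y_mem (R.tail i)
        rw [hbf] at x1
        rw [h3] at x2
        right; right; right
        rw [h.2.2.1]
        omega
      · right; right; left
        have y1 := R.X_mem (R.layout.c f)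
        have y2 := R.X_mem (R.tail g)
        rcases lt_or_gt_of_ne hbf with h' | h'
        · have := R.blocks _ _ h'
          left; omega
        · have := R.blocks _ _ h'
          right; omega
    · exact absurd bg h.1
    · exact absurd h.2.2.2.2.2 h0'
    · by_cases e1 : R.X (R.layout.c f) = R.X (R.head g)
      · exact Or.inl (hX _ _ e1)
      by_cases e2 : R.X (R.layout.c f) = R.X (R.tail g)
      · exact Or.inr (Or.inl ⟨hX _ _ e2, h.2.2.2.2.1⟩)
      right; right; left
      simp only [OutsideOf]
      omega
    · exact absurd h.2.2.2.2.1 h0'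
    · exact absurd bg h.2.1

/-- What remains is `skewCross`. Different blocks have disjoint ranges of columns, and the closing
arc of a block without a start is its only bent arc in `F`; so the case left is that of the two bent
arcs of one rotated cycle. -/
theorem layout_valid : R.layout.Valid where
  half := layout_halfValid
  half' := layout_halfValid'
  ne j := by
    by_cases h : R.F j
    · rw [F_a h, F_c h]; exact (R.ne j).symm
    · rw [not_F_a h, not_F_c h]; exact R.ne j
  distinct f g hfg := by
    have key : ∀ j, s(R.layout.a j, R.layout.c j) = s(R.tail j, R.head j) := by
      intro j
      by_cases h : R.F j
      · rw [F_a h, F_c h, Sym2.eq_swap]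
      · rw [not_F_a h, not_F_c h]
    rw [key, key]
    exact R.distinct f g hfg
  skewCross f g hfg bf bg h0 h0' := by
    have hf := F_of_β_ne_zero h0
    have hg := F_of_α_ne_zero h0'
    have bf : R.Bent f := bf
    have bg : R.Bent g := bg
    obtain ⟨hb, -⟩ := R.arc f hf
    obtain ⟨hb', -⟩ := R.arc g hg
    rw [F_a hf, F_c hf, F_a hg, F_c hg]
    change _ ∨ OutsideOf (R.X _) (R.X _) (R.X _) ∨ _
    by_cases hbb : R.base (R.tail f) = R.base (R.tail g)
    · rcases F_cases hf with ⟨hS, h | h⟩ | h | h | h | h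
      · exfalso
        rcases F_cases hg with ⟨-, h' | h'⟩ | h' | h' | h' | h'
        · exact hfg (R.head_inj f g (by simp [hf, hg]) (R.pos_inj (by omega)))
        · exact h'.1 bg
        · exact h'.1 (hbb ▸ hS)
        · exact h'.1 (hbb ▸ hS)
        · exact h'.1 (hbb ▸ hS)
        · exact h'.1 (hbb ▸ hS)
      · exact absurd bf h.1
      · exact absurd h.2.2.2.2.2 h0
      · rcases F_cases hg with ⟨hS, h' | h'⟩ | h' | h' | h' | h'
        · exact absurd (hbb ▸ hS) h.1
        · exact absurd (hbb ▸ hS) h.1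
        · exact absurd h'.2.2.2.2.1 h0'
        · exact absurd h'.2.2.2.2.1 h0'
        -- Here `f` leaves the turn and `g` enters the start from the last vertex. The columns
        -- spanned by `f` are neighbours, so the column of the last vertex is outside unless that
        -- vertex is the head of `f`.
        · by_cases e : R.idx (R.head f) = R.idx (R.tail g)
          · left
            exact (idx_eq_iff (v := R.tail g) h'.1 (by rw [hb, hbb]) e.symm).symm
          · right; left
            have f1 := idx_facts h.1
            have x1 := X_eq h.1
            have x2 := X_eq (v := R.head f) (by rw [hb]; exact h.1)
            have x3 := X_eq h'.1
            rw [hb] at x2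
            rw [← hbb] at x3 h'
            simp only [OutsideOf]
            rcases x1 with x1 | x1 <;> rcases x2 with x2 | x2 <;> rcases x3 with x3 | x3
            · omega
            · exact absurd (x1.1.symm.trans x3.1) (by simp)
            · exact absurd (x1.1.symm.trans x2.1) (by simp)
            · exact absurd (x1.1.symm.trans x2.1) (by simp)
            · exact absurd (x1.1.symm.trans x2.1) (by simp)
            · exact absurd (x1.1.symm.trans x2.1) (by simp)
            · exact absurd (x1.1.symm.trans x3.1) (by simp)
            · omega
        · exact absurd bg h'.2.1
      · exact absurd h.2.2.2.2.1 h0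
      · exact absurd bf h.2.1
    · right; left
      have x1 := R.X_mem (R.tail f)
      have x2 := R.X_mem (R.head f)
      have x3 := R.X_mem (R.tail g)
      rw [hb] at x2
      simp only [OutsideOf]
      rcases lt_or_gt_of_ne hbb with h' | h'
      · have := R.blocks _ _ h'
        omega
      · have := R.blocks _ _ h'
        omega

/-! ### Counting the straight arcs -/

/-- Each block with a bent arc contains a straight one. -/
theorem exists_straight {g : Fin m} (hg : R.F g) (bg : R.Bent g) :
    ∃ j, R.F j ∧ ¬ R.Bent j ∧ R.base (R.tail j) = R.base (R.tail g) := by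
  obtain ⟨hb, ha⟩ := R.arc g hg
  have hc : R.Cyclic (R.base (R.tail g)) := by
    by_cases hS : R.S (R.base (R.tail g)) = 0
    · exact (closed hS).1
    · simp only [Bent, hg, hS, if_false, forall_const] at bg
      rcases bg with bg | bg
      · obtain ⟨w, h1, h2, h3⟩ := turn_of_S_ne_zero hS
        obtain rfl : w = R.tail g := R.pos_inj (by omega)
        rcases h3 with h3 | h3
        · exact absurd ⟨g, hg, rfl⟩ h3
        · exact h3.1
      · obtain ⟨w, h1, h2, h3⟩ := start_of_S_ne_zero hS
        obtain rfl : w = R.head g := R.pos_inj (by omega)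
        rcases h3 with h3 | h3
        · exact absurd ⟨g, hg, rfl⟩ h3
        · rw [← hb]; exact h3.1
  have mg := R.mem_block (R.tail g)
  have hmem := fun w => R.base_eq_of_mem (v := R.tail g) (w := w)
  have hfull := R.full (R.tail g)
  obtain ⟨b, hbdef⟩ : ∃ b, R.base (R.tail g) = b := ⟨_, rfl⟩
  have hrot : R.S b ≠ 0 → (∃ u, R.base u = b ∧ R.S b = R.pos u + 1) := by
    intro h
    rw [← hbdef] at h ⊢
    obtain ⟨u, h1, h2, -⟩ := start_of_S_ne_zero h
    exact ⟨u, h1, h2⟩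
  have hfacts : R.S b ≠ 0 → 1 ≤ R.part b ∧ R.part b ≤ R.len b := by
    intro h
    rw [← hbdef] at h ⊢
    have := idx_facts h
    exact ⟨this.2.2.1, this.2.2.2.1⟩
  rw [hbdef] at hc mg hmem hfull ⊢
  clear hb ha hg bg
  obtain ⟨i, hi, hi'⟩ := id hc
  obtain ⟨hbi, hai⟩ := R.arc i hi
  have mi := R.mem_block (R.head i)
  have mi' := R.mem_block (R.tail i)
  have hbi' : R.base (R.head i) = b := hmem (R.head i) (by omega) (by omega)
  have hti : R.base (R.tail i) = b := hbi.symm.trans hbi'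
  rw [hti] at hai mi'
  have hlast : R.pos (R.tail i) + 1 = b + R.len b := by omega
  have hne : R.pos (R.tail i) ≠ R.pos (R.head i) := fun e => R.ne i (R.pos_inj e)
  -- A cycle of length two would consist of two opposite arcs, that is, of the same edge twice.
  have h3 : 3 ≤ R.len b := by
    by_contra h3
    obtain ⟨j, hj, hj1, hj2⟩ := R.pred (R.tail i) (by rw [hti]; omega)
    have hj3 : R.tail j = R.head i := R.pos_inj (by omega)
    have hij : i ≠ j := by
      rintro rfl
      exact R.ne i hj1.symm
    apply R.distinct i j hij
    rw [hj1, hj3, Sym2.eq_swap]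
  have hpred : ∀ w, R.base w = b → ∃ j, R.F j ∧ R.head j = w ∧ R.base (R.tail j) = b := by
    intro w hw
    obtain ⟨j, hj, hj'⟩ := R.exists_pred (v := w) (by rw [hw]; exact hc)
    exact ⟨j, hj, hj', by rw [← (R.arc j hj).1, hj', hw]⟩
  by_cases hS : R.S b = 0
  · obtain ⟨w, hw⟩ := hfull (b + 1) (by omega) (by omega)
    have hwb : R.base w = b := hmem w (by omega) (by omega)
    obtain ⟨j, hj, rfl, hj'⟩ := hpred w hwb
    refine ⟨j, hj, ?_, hj'⟩
    simp only [Bent, hj, hj', hS, if_true, forall_const]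
    omega
  · have hfind : ∀ r, 0 ≤ r → r < R.len b → ∃ w, R.base w = b ∧ R.idx w = r := by
      intro r h1 h2
      obtain ⟨u, hu1, hu2⟩ := hrot hS
      have mu := R.mem_block u
      rw [hu1] at mu
      obtain ⟨w, hw⟩ := hfull
        (if R.pos u + r < b + R.len b then R.pos u + r else R.pos u + r - R.len b)
        (by split_ifs <;> omega) (by split_ifs <;> omega)
      have hwb : R.base w = b := hmem w
        (by rw [hw]; split_ifs <;> omega) (by rw [hw]; split_ifs <;> omega)
      refine ⟨w, hwb, ?_⟩
      simp only [idx, wrap, hwb]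
      split_ifs at * <;> omega
    have f0 := hfacts hS
    -- The arc into the vertex with index `r` is bent only if `r` is `0`, the index of the start, or
    -- `part b`, the index after the turn.
    have step : ∀ r, 0 < r → r < R.len b → r ≠ R.part b →
        ∃ j, R.F j ∧ ¬ R.Bent j ∧ R.base (R.tail j) = b := by
      intro r h1 h2 h3
      obtain ⟨w, hwb, hw⟩ := hfind r (by omega) h2
      obtain ⟨j, hj, rfl, hj'⟩ := hpred w hwb
      refine ⟨j, hj, ?_, hj'⟩
      have f1 := idx_arc hj (by rw [hj']; exact hS)
      have f2 := idx_facts (v := R.head j) (by rw [hwb]; exact hS)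
      have f3 := idx_facts (v := R.tail j) (by rw [hj']; exact hS)
      rw [hwb] at f2
      rw [hj'] at f3
      simp only [Bent, hj, hj', hS, if_false, forall_const]
      omega
    by_cases hp : R.part b = 1
    · exact step 2 (by omega) (by omega) (by omega)
    · exact step 1 (by omega) (by omega) (by omega)

open Classical in
/-- At least a third of the arcs in `F` are straight. -/
theorem card_F_le : (Finset.univ.filter fun j => R.F j).card ≤
    3 * (Finset.univ.filter fun j => ¬ R.Bent j).card := by
  choose! φ h1 h2 h3 using fun g (h : R.F g ∧ R.Bent g) => exists_straight h.1 h.2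
  have hsplit : (Finset.univ.filter fun j => R.F j).card =
      (Finset.univ.filter fun j => R.F j ∧ R.Bent j).card +
      (Finset.univ.filter fun j => R.F j ∧ ¬ R.Bent j).card := by
    rw [← Finset.card_filter_add_card_filter_not (s := Finset.univ.filter fun j => R.F j)
      (fun j => R.Bent j), Finset.filter_filter, Finset.filter_filter]
  have hle : (Finset.univ.filter fun j => R.F j ∧ ¬ R.Bent j).card ≤
      (Finset.univ.filter fun j => ¬ R.Bent j).card := by
    apply Finset.card_le_card
    intro j
    simp only [Finset.mem_filter]
    tauto
  have hinj : (Finset.univ.filter fun j => R.F j ∧ R.Bent j).card ≤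
      ((Finset.univ.filter fun j => ¬ R.Bent j) ×ˢ (Finset.univ : Finset Bool)).card := by
    have key : ∀ g, R.F g → R.Bent g → R.S (R.base (R.tail g)) ≠ 0 →
        R.pos (R.tail g) + 1 ≠ R.T (R.base (R.tail g)) →
        R.pos (R.head g) + 1 = R.S (R.base (R.tail g)) := by
      intro g hg bg hS hT
      simp only [Bent, hg, hS, if_false, forall_const] at bg
      tauto
    have key' : ∀ g, R.F g → R.Bent g → R.S (R.base (R.tail g)) = 0 →
        R.pos (R.head g) = R.base (R.tail g) := by
      intro g hg bg hS
      simpa only [Bent, hg, hS, if_true, forall_const] using bg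
    -- A bent arc is determined by its block, which the chosen straight arc identifies, and by
    -- whether it leaves the turn: otherwise it enters the start, or the first position of a block
    -- without a start.
    refine Finset.card_le_card_of_injOn
      (fun g => (φ g, decide (R.pos (R.tail g) + 1 = R.T (R.base (R.tail g))))) ?_ ?_
    · intro g hg
      have hg : R.F g ∧ R.Bent g := by simpa using hg
      exact Finset.mem_coe.2 (Finset.mem_product.2 ⟨by simpa using h2 g hg, Finset.mem_univ _⟩)
    · intro g hg g' hg' e
      have hg : R.F g ∧ R.Bent g := by simpa using hg
      have hg' : R.F g' ∧ R.Bent g' := by simpa using hg'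
      simp only [Prod.mk.injEq, decide_eq_decide] at e
      obtain ⟨e1, e2⟩ := e
      have hb : R.base (R.tail g) = R.base (R.tail g') := by
        rw [← h3 g hg, ← h3 g' hg', e1]
      by_cases hS : R.S (R.base (R.tail g)) = 0
      · have k1 := key' g hg.1 hg.2 hS
        have k2 := key' g' hg'.1 hg'.2 (by rw [← hb]; exact hS)
        exact R.head_inj g g' (by simp [hg.1, hg'.1]) (R.pos_inj (by omega))
      · by_cases hT : R.pos (R.tail g) + 1 = R.T (R.base (R.tail g))
        · have hT' := e2.1 hT
          rw [← hb] at hT'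
          exact R.tail_inj g g' (by simp [hg.1, hg'.1]) (R.pos_inj (by omega))
        · have hT' := fun h => hT (e2.2 h)
          have k1 := key g hg.1 hg.2 hS hT
          have k2 := key g' hg'.1 hg'.2 (by rw [← hb]; exact hS) hT'
          rw [← hb] at k2
          exact R.head_inj g g' (by simp [hg.1, hg'.1]) (R.pos_inj (by omega))
  rw [Finset.card_product, Finset.card_univ, Fintype.card_bool] at hinj
  omega

end RotatedBlocks

/-! ### Abbreviations for programs -/

namespace WordRAM

namespace Expr

instance : Add Expr := ⟨bin .add⟩
instance : Sub Expr := ⟨bin .sub⟩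
instance (k : ℕ) : OfNat Expr k := ⟨const k⟩

def lt (e f : Expr) : Expr := bin .lt e f
def eq (e f : Expr) : Expr := bin .eq e f
def not (e : Expr) : Expr := bin .eq e (const 0)
def and (e f : Expr) : Expr := not (bin .add (not e) (not f))
def or (e f : Expr) : Expr := bin .lt (bin .add (not e) (not f)) (const 2)

@[simp] theorem eval_const (s : Memory) (z : ℤ) : (const z).eval s = z := rfl
@[simp] theorem eval_zero (s : Memory) : (0 : Expr).eval s = 0 := rfl
@[simp] theorem eval_one (s : Memory) : (1 : Expr).eval s = 1 := rfl
@[simp] theorem eval_two (s : Memory) : (2 : Expr).eval s = 2 := rfl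
@[simp] theorem eval_read (s : Memory) (a : ℕ) (i : Expr) : (read a i).eval s = s a (i.eval s) := rfl
@[simp] theorem eval_add (s : Memory) (e f : Expr) : (e + f).eval s = e.eval s + f.eval s := rfl
@[simp] theorem eval_sub (s : Memory) (e f : Expr) : (e - f).eval s = e.eval s - f.eval s := rfl
@[simp] theorem eval_lt (s : Memory) (e f : Expr) :
    (lt e f).eval s = if e.eval s < f.eval s then 1 else 0 := rfl
@[simp] theorem eval_eq (s : Memory) (e f : Expr) :
    (eq e f).eval s = if e.eval s = f.eval s then 1 else 0 := rfl
@[simp] theorem eval_not (s : Memory) (e : Expr) :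
    (not e).eval s = if e.eval s = 0 then 1 else 0 := rfl
@[simp] theorem eval_and (s : Memory) (e f : Expr) :
    (and e f).eval s = if e.eval s ≠ 0 ∧ f.eval s ≠ 0 then 1 else 0 := by
  simp only [and, not, eval, BinOp.eval]
  by_cases h1 : e.eval s = 0 <;> by_cases h2 : f.eval s = 0 <;> simp [h1, h2]
@[simp] theorem eval_or (s : Memory) (e f : Expr) :
    (or e f).eval s = if e.eval s ≠ 0 ∨ f.eval s ≠ 0 then 1 else 0 := by
  simp only [or, not, eval, BinOp.eval]
  by_cases h1 : e.eval s = 0 <;> by_cases h2 : f.eval s = 0 <;> simp [h1, h2]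

/-- The arrays that an expression reads. -/
def reads : Expr → List ℕ
  | const _ => []
  | read a i => a :: i.reads
  | bin _ e f => e.reads ++ f.reads

theorem eval_congr {s s' : Memory} : ∀ e : Expr, (∀ a ∈ e.reads, s' a = s a) → e.eval s' = e.eval s
  | const _, _ => rfl
  | read a i, h => by
    simp only [reads, List.mem_cons, forall_eq_or_imp] at h
    simp only [eval, h.1, i.eval_congr h.2]
  | bin op e f, h => by
    simp only [reads, List.mem_append] at h
    simp only [eval, e.eval_congr fun a ha => h a (Or.inl ha),
      f.eval_congr fun a ha => h a (Or.inr ha)]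

end Expr

theorem ite_one_ne_zero {p : Prop} {_ : Decidable p} : (if p then (1 : ℤ) else 0) ≠ 0 ↔ p := by
  split_ifs with h <;> simp [h]

theorem ite_one_eq_zero {p : Prop} {_ : Decidable p} : (if p then (1 : ℤ) else 0) = 0 ↔ ¬ p := by
  split_ifs with h <;> simp [h]

namespace Expr

theorem and_ne_zero {s : Memory} {e f : Expr} :
    (and e f).eval s ≠ 0 ↔ e.eval s ≠ 0 ∧ f.eval s ≠ 0 := by
  rw [eval_and, ite_one_ne_zero]
theorem or_ne_zero {s : Memory} {e f : Expr} :
    (or e f).eval s ≠ 0 ↔ e.eval s ≠ 0 ∨ f.eval s ≠ 0 := by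
  rw [eval_or, ite_one_ne_zero]
theorem not_ne_zero {s : Memory} {e : Expr} : (not e).eval s ≠ 0 ↔ e.eval s = 0 := by
  rw [eval_not, ite_one_ne_zero]
theorem lt_ne_zero {s : Memory} {e f : Expr} : (lt e f).eval s ≠ 0 ↔ e.eval s < f.eval s := by
  rw [eval_lt, ite_one_ne_zero]
theorem eq_ne_zero {s : Memory} {e f : Expr} : (eq e f).eval s ≠ 0 ↔ e.eval s = f.eval s := by
  rw [eval_eq, ite_one_ne_zero]

end Expr

/-- `for a := 0 to b - 1 do A[a] := if e then f else g`, with scalar variables `a` and `b`. -/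
def Program.fill (a b A : ℕ) (e f g : Expr) : Program :=
  .forLoop a b (.cond e (.write A (.var a) f) (.write A (.var a) g))

theorem Runs.fill {W N : ℕ} {a b A : ℕ} {e f g : Expr} {s : Memory} (φ : ℤ → ℤ)
    (hN : s b 0 = N) (hNW : N ≤ W)
    (hφ : ∀ j : ℤ, 0 ≤ j → j < N →
      (if e.eval (s.set a 0 j) ≠ 0 then f.eval (s.set a 0 j) else g.eval (s.set a 0 j)) = φ j ∧
        |φ j| ≤ W)
    (hab : a ≠ b := by decide) (hAa : A ≠ a := by decide) (hAb : A ≠ b := by decide)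
    (hA : A ∉ e.reads ++ f.reads ++ g.reads := by decide) :
    Runs W (.fill a b A e f g) s N (fun s' => ∀ j : ℤ, 0 ≤ j → j < N → s' A j = φ j) := by
  simp only [List.mem_append, not_or] at hA
  refine (Runs.forLoop (fun k s' => ∀ j : ℤ, 0 ≤ j → j < k → s' A j = φ j) hab
    (by simp [Program.writes, hAa.symm]) (by simp [Program.writes, hAb.symm]) hN hNW ?_ ?_ ?_)
  · intro j s x h i h1 h2
    rw [Memory.set_ne _ hAa]
    exact h i h1 h2
  · intro j h1 h2; omega
  · intro j s' hj hfr hI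
    simp only [Program.writes, List.mem_append, List.mem_singleton, or_self] at hfr
    have hc : ∀ h : Expr, A ∉ h.reads → h.eval s' = h.eval (s.set a 0 j) := fun h hh =>
      h.eval_congr fun x hx => hfr x (by rintro rfl; exact hh hx)
    have ha : s' a 0 = j := by rw [hfr a hAa.symm, Memory.set_same]; simp
    obtain ⟨h1, h2⟩ := hφ j (by omega) (by omega)
    simp only [Program.wp, hc e hA.1.1, hc f hA.1.2, hc g hA.2, Expr.eval, ha, Memory.set_same]
    have key : ∀ i : ℤ, 0 ≤ i → i < (j + 1 : ℕ) → Function.update (s' A) j (φ j) i = φ i := by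
      intro i hi0 hi1
      rcases eq_or_ne i j with rfl | hne
      · simp
      · rw [Function.update_of_ne hne]
        exact hI i hi0 (by omega)
    constructor
    · intro he
      rw [if_pos he] at h1
      rw [h1]
      exact ⟨h2, key⟩
    · intro he
      rw [if_neg (by simpa using he)] at h1
      rw [h1]
      exact ⟨h2, key⟩

end WordRAM

/-! ### Pairing up and balanced colourings -/

namespace WordRAM

/-- Invariant of the first loop: `Q` holds the partners, plus one, of the elements that have been
paired with an element of the same key, and `P k` is the only element with key `k`, plus one, that
still waits for a partner. -/
structure KeyPairing (N : ℤ) (K Q P : ℤ → ℤ) (j : ℤ) : Prop where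
  partner : ∀ g, 0 ≤ g → g < j → Q g ≠ 0 →
    1 ≤ Q g ∧ Q g ≤ j ∧ Q g ≠ g + 1 ∧ Q (Q g - 1) = g + 1 ∧ K (Q g - 1) = K g
  waiting : ∀ g, 0 ≤ g → g < j → Q g = 0 → P (K g) = g + 1
  zero : ∀ g, j ≤ g → g < N → Q g = 0
  pend : ∀ g, 0 ≤ g → g < N → P (K g) ≠ 0 →
    1 ≤ P (K g) ∧ P (K g) ≤ j ∧ K (P (K g) - 1) = K g ∧ Q (P (K g) - 1) = 0

/-- Nobody with the key of `j` waits, so `j` becomes the waiting element. Indices are stored plus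
one, and zero means none. -/
theorem KeyPairing.step_new {N : ℤ} {K Q P : ℤ → ℤ} {j : ℤ} (h : KeyPairing N K Q P j)
    (hj : 0 ≤ j) (hjN : j < N) (hP : P (K j) = 0) :
    KeyPairing N K Q (Function.update P (K j) (j + 1)) (j + 1) where
  partner g h0 h1 hQ := by
    have hg : g ≠ j := by rintro rfl; exact hQ (h.zero g le_rfl hjN)
    obtain ⟨h2, h3, h4⟩ := h.partner g h0 (by omega) hQ
    exact ⟨h2, by omega, h4⟩
  waiting g h0 h1 hQ := by
    by_cases hg : g = j
    · subst hg; simp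
    · have := h.waiting g h0 (by omega) hQ
      rw [Function.update_of_ne]
      · exact this
      · intro e; rw [e, hP] at this; omega
  zero g h0 h1 := h.zero g (by omega) h1
  pend g h0 h1 hk := by
    by_cases e : K g = K j
    · rw [e]
      simp only [Function.update_self]
      exact ⟨by omega, le_rfl, by simp, by simpa using h.zero j le_rfl hjN⟩
    · rw [Function.update_of_ne e] at hk ⊢
      obtain ⟨h1, h2, h3⟩ := h.pend g h0 h1 hk
      exact ⟨h1, by omega, h3⟩

/-- The waiting element `q` and `j` become partners. No earlier pair is disturbed, because both were
unpaired before, and nobody with this key waits any longer. -/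
theorem KeyPairing.step_old {N : ℤ} {K Q P : ℤ → ℤ} {j : ℤ} (h : KeyPairing N K Q P j)
    (hj : 0 ≤ j) (hjN : j < N) (hP : P (K j) ≠ 0) :
    KeyPairing N K (Function.update (Function.update Q j (P (K j))) (P (K j) - 1) (j + 1))
      (Function.update P (K j) 0) (j + 1) := by
  obtain ⟨p1, p2, p3, p4⟩ := h.pend j hj hjN hP
  have hw := h.waiting
  have hp := h.pend
  obtain ⟨q, hq⟩ : ∃ q, P (K j) = q + 1 := ⟨P (K j) - 1, by omega⟩
  rw [hq] at p1 p2 p3 p4 ⊢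
  rw [add_sub_cancel_right] at p3 p4 ⊢
  have hQ : ∀ g, Function.update (Function.update Q j (q + 1)) q (j + 1) g =
      if g = q then j + 1 else if g = j then q + 1 else Q g := by
    intro g
    simp only [Function.update_apply]
  have hPP : ∀ k, Function.update P (K j) 0 k = if k = K j then 0 else P k := by
    intro k
    simp only [Function.update_apply]
  constructor
  · intro g h0 h1 hg
    simp only [hQ] at hg ⊢
    by_cases e1 : g = q
    · subst e1
      simp only [if_true, add_sub_cancel_right, p3]
      rw [if_neg (by omega)]
      exact ⟨by omega, by omega, by omega, rfl, trivial⟩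
    · by_cases e2 : g = j
      · subst e2
        rw [if_neg e1]
        simp only [if_true, add_sub_cancel_right, p3]
        exact ⟨by omega, by omega, by omega, trivial, trivial⟩
      · simp only [if_neg e1, if_neg e2] at hg ⊢
        obtain ⟨h2, h3, h4, h5, h6⟩ := h.partner g h0 (by omega) hg
        have n1 : Q g - 1 ≠ q := by intro e; rw [e, p4] at h5; omega
        have n2 : Q g - 1 ≠ j := by omega
        rw [if_neg n1, if_neg n2]
        exact ⟨h2, by omega, h4, h5, h6⟩
  · intro g h0 h1 hg
    simp only [hQ, hPP] at hg ⊢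
    by_cases e1 : g = q
    · rw [if_pos e1] at hg; omega
    · rw [if_neg e1] at hg
      by_cases e2 : g = j
      · rw [if_pos e2] at hg; omega
      · rw [if_neg e2] at hg
        have := hw g h0 (by omega) hg
        rw [if_neg]
        · exact this
        · intro e; rw [e] at this; omega
  · intro g h0 h1
    rw [hQ, if_neg (by omega), if_neg (by omega)]
    exact h.zero g (by omega) h1
  · intro g h0 h1 hk
    simp only [hQ, hPP] at hk ⊢
    by_cases e : K g = K j
    · simp [e] at hk
    · rw [if_neg e] at hk ⊢
      obtain ⟨h1, h2, h3, h4⟩ := hp g h0 h1 hk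
      have n1 : P (K g) - 1 ≠ q := by intro e'; rw [e', p3] at h3; exact e h3.symm
      rw [if_neg n1, if_neg (by omega)]
      exact ⟨h1, by omega, h3, h4⟩

/-- Pairs up elements with the same key. -/
def pairKeys : Program :=
  .forLoop 20 23 (.cond (.read 16 (.read 15 (.var 20)))
    (.seq (.write 17 (.var 20) (.read 16 (.read 15 (.var 20))))
      (.seq (.write 17 (.read 16 (.read 15 (.var 20)) - 1) (.var 20 + 1))
        (.write 16 (.read 15 (.var 20)) 0)))
    (.write 16 (.read 15 (.var 20)) (.var 20 + 1)))

theorem runs_pairKeys {W N : ℕ} {s : Memory} (hN : s 23 0 = N) (hW : N ≤ W)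
    (hQ : ∀ g : ℤ, 0 ≤ g → g < N → s 17 g = 0) (hP : ∀ g : ℤ, 0 ≤ g → g < N → s 16 (s 15 g) = 0) :
    Runs W pairKeys s N (fun s' => KeyPairing N (s 15) (s' 17) (s' 16) N) := by
  refine Runs.forLoop (fun j s' => KeyPairing N (s 15) (s' 17) (s' 16) j) (by decide) (by decide)
    (by decide) hN hW ?_ ?_ ?_
  · intro j s x h
    exact h
  · exact ⟨by omega, by omega, fun g h1 h2 => hQ g (by exact_mod_cast h1) h2,
      fun g h1 h2 hk => absurd (hP g h1 h2) hk⟩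
  · intro j s' hj hfr hI
    have h15 : s' 15 = s 15 := hfr 15 (by decide)
    have h20 : s' 20 0 = j := by rw [hfr 20 (by decide), Memory.set_same]; simp
    have hj' : (j : ℤ) < N := by exact_mod_cast hj
    have hjW : |(j : ℤ) + 1| ≤ W := by rw [abs_of_nonneg (by omega)]; omega
    simp only [Program.wp, Expr.eval_read, Expr.eval_add, Expr.eval_sub, Expr.eval_const,
      Expr.eval_one, Expr.eval_zero, h15, h20]
    constructor
    · intro h
      have hb := hI.pend j (by omega) hj' h
      have := hI.step_old (by omega) hj' h
      simp [Memory.set_same, Memory.set_ne, h15, h20]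
      refine ⟨?_, hjW, ?_⟩
      · rw [abs_le]; omega
      · simpa using this
    · intro h
      simp [Memory.set_same, Memory.set_ne]
      exact ⟨hjW, hI.step_new (by omega) hj' h⟩

/-- Invariant of the second loop, which pairs up the remaining elements: `w` is the element that
waits for a partner, plus one, and `Q₀` is the pairing of the first loop. -/
structure RestPairing (N : ℤ) (Q₀ Q : ℤ → ℤ) (w j : ℤ) : Prop where
  partner : ∀ g, 0 ≤ g → g < N → Q g ≠ 0 →
    1 ≤ Q g ∧ Q g ≤ N ∧ Q g ≠ g + 1 ∧ Q (Q g - 1) = g + 1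
  waiting : ∀ g, 0 ≤ g → g < j → Q g = 0 → w = g + 1
  wait : w ≠ 0 → 1 ≤ w ∧ w ≤ j ∧ Q (w - 1) = 0
  old : ∀ g, 0 ≤ g → g < N → Q₀ g ≠ 0 → Q g = Q₀ g

theorem RestPairing.step {N : ℤ} {Q₀ Q : ℤ → ℤ} {w j : ℤ} (h : RestPairing N Q₀ Q w j)
    (hj : 0 ≤ j) (hjN : j < N) (hQ : Q j = 0) (hw : w ≠ 0) :
    RestPairing N Q₀ (Function.update (Function.update Q j w) (w - 1) (j + 1)) 0 (j + 1) := by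
  obtain ⟨h1, h2, h3⟩ := h.wait hw
  obtain ⟨q, rfl⟩ : ∃ q, w = q + 1 := ⟨w - 1, by omega⟩
  rw [add_sub_cancel_right] at h3 ⊢
  have key : ∀ g, Function.update (Function.update Q j (q + 1)) q (j + 1) g =
      if g = q then j + 1 else if g = j then q + 1 else Q g := by
    intro g
    simp only [Function.update_apply]
  constructor
  · intro g h0 h4 hg
    simp only [key] at hg ⊢
    by_cases e1 : g = q
    · subst e1
      simp only [if_true, add_sub_cancel_right]
      rw [if_neg (by omega)]
      exact ⟨by omega, by omega, by omega, rfl⟩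
    · by_cases e2 : g = j
      · subst e2
        rw [if_neg e1]
        simp only [if_true, add_sub_cancel_right]
        exact ⟨by omega, by omega, by omega, trivial⟩
      · simp only [if_neg e1, if_neg e2] at hg ⊢
        obtain ⟨h5, h6, h7, h8⟩ := h.partner g h0 h4 hg
        have n1 : Q g - 1 ≠ q := by intro e; rw [e, h3] at h8; omega
        have n2 : Q g - 1 ≠ j := by intro e; rw [e, hQ] at h8; omega
        rw [if_neg n1, if_neg n2]
        exact ⟨h5, h6, h7, h8⟩
  · intro g h0 h4 hg
    simp only [key] at hg
    split_ifs at hg with e1 e2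
    · omega
    · omega
    · have := h.waiting g h0 (by omega) hg
      omega
  · exact fun h => absurd rfl h
  · intro g h0 h4 hg
    have := h.old g h0 h4 hg
    rw [key, if_neg, if_neg]
    · exact this
    · rintro rfl; exact hg (this.symm.trans hQ)
    · rintro rfl; exact hg (this.symm.trans h3)

/-- Pairs up the remaining elements. -/
def pairRest : Program :=
  .forLoop 20 23 (.cond (.read 17 (.var 20)) .skip
    (.cond (.var 22)
      (.seq (.write 17 (.var 20) (.var 22))
        (.seq (.write 17 (.var 22 - 1) (.var 20 + 1)) (.write 22 0 0)))
      (.write 22 0 (.var 20 + 1))))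

theorem runs_pairRest {W N : ℕ} {s : Memory} (hN : s 23 0 = N) (hW : N ≤ W)
    {P : ℤ → ℤ} (hQ : KeyPairing N (s 15) (s 17) P N) (h22 : s 22 0 = 0) :
    Runs W pairRest s N (fun s' => RestPairing N (s 17) (s' 17) (s' 22 0) N) := by
  refine Runs.forLoop (fun j s' => RestPairing N (s 17) (s' 17) (s' 22 0) j) (by decide) (by decide)
    (by decide) hN hW ?_ ?_ ?_
  · intro j s x h
    exact h
  · refine ⟨fun g h0 h1 hg => ?_, by omega, fun h => absurd h22 h, fun _ _ _ _ => rfl⟩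
    obtain ⟨h2, h3, h4, h5, -⟩ := hQ.partner g h0 h1 hg
    exact ⟨h2, h3, h4, h5⟩
  · intro j s' hj hfr hI
    have h20 : s' 20 0 = j := by rw [hfr 20 (by decide), Memory.set_same]; simp
    have hj' : (j : ℤ) < N := by exact_mod_cast hj
    have hjW : |(j : ℤ) + 1| ≤ W := by rw [abs_of_nonneg (by omega)]; omega
    simp only [Program.wp, Expr.eval_read, Expr.eval_add, Expr.eval_sub, Expr.eval_const,
      Expr.eval_one, Expr.eval_zero, h20]
    refine ⟨fun h => ?_, fun h => ⟨fun hw => ?_, fun hw => ?_⟩⟩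
    · refine ⟨hI.partner, fun g h0 h1 hg => ?_, fun hw => ?_, hI.old⟩
      · exact hI.waiting g h0 (lt_of_le_of_ne (by omega)
          (by rintro rfl; exact h hg)) hg
      · obtain ⟨h1, h2, h3⟩ := hI.wait hw
        exact ⟨h1, by omega, h3⟩
    · have hb := hI.wait hw
      have := hI.step (by omega) hj' h hw
      simp [Memory.set_same, Memory.set_ne, h20]
      refine ⟨?_, hjW, by simpa using this⟩
      rw [abs_le]; omega
    · simp [Memory.set_same, Memory.set_ne]
      refine ⟨hjW, hI.partner, fun g h0 h1 hg => ?_, fun _ => ?_, hI.old⟩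
      · rcases eq_or_ne g j with rfl | hne
        · rfl
        · have := hI.waiting g h0 (by omega) hg
          omega
      · exact ⟨by omega, by omega, by simpa using h⟩

/-- The set on which an involution without fixed points is defined has an even number of
elements, so that nobody waits in the end. -/
theorem RestPairing.wait_eq_zero {M : ℕ} {Q₀ Q : ℤ → ℤ} {w : ℤ}
    (h : RestPairing (2 * M : ℕ) Q₀ Q w (2 * M : ℕ)) : w = 0 := by
  by_contra hw
  obtain ⟨h1, h2, h3⟩ := h.wait hw
  -- All elements but the waiting one are paired by a fixed-point-free involution, so the ones
  -- cancel modulo two; but there are `2 * M - 1` of them.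
  have hs : ∑ g ∈ (Finset.Ico (0 : ℤ) (2 * M : ℕ)).erase (w - 1), (1 : ZMod 2) = 0 := by
    have hQ : ∀ g ∈ (Finset.Ico (0 : ℤ) (2 * M : ℕ)).erase (w - 1), Q g ≠ 0 := by
      intro g hg e
      simp only [Finset.mem_erase, Finset.mem_Ico] at hg
      have := h.waiting g hg.2.1 hg.2.2 e
      omega
    refine Finset.sum_involution (fun g _ => Q g - 1) ?_ ?_ ?_ ?_
    · intro g hg; decide
    · intro g hg _
      have hq := hQ g hg
      simp only [Finset.mem_erase, Finset.mem_Ico] at hg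
      have := h.partner g hg.2.1 hg.2.2 hq
      omega
    · intro g hg
      have hq := hQ g hg
      simp only [Finset.mem_erase, Finset.mem_Ico] at hg ⊢
      obtain ⟨h4, h5, h6, h7⟩ := h.partner g hg.2.1 hg.2.2 hq
      refine ⟨?_, by omega, by omega⟩
      intro e
      rw [e, h3] at h7
      omega
    · intro g hg
      have hq := hQ g hg
      simp only [Finset.mem_erase, Finset.mem_Ico] at hg
      obtain ⟨h4, h5, h6, h7⟩ := h.partner g hg.2.1 hg.2.2 hq
      simp only [h7]
      omega
  rw [Finset.sum_const, nsmul_eq_mul, mul_one, Finset.card_erase_of_mem (by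
    simp only [Finset.mem_Ico]; omega), Int.card_Ico, ZMod.natCast_eq_zero_iff] at hs
  have h5 : ((2 * M : ℕ) - 0 : ℤ).toNat = 2 * M := by omega
  rw [h5] at hs
  omega

end WordRAM

/-! ### Two-colouring the alternating cycles -/

namespace WordRAM

/-- A perfect matching in which at most one element of each key is matched to one of another key. -/
structure PerfectPairing (N : ℤ) (K Q : ℤ → ℤ) : Prop where
  partner : ∀ g, 0 ≤ g → g < N → 1 ≤ Q g ∧ Q g ≤ N ∧ Q g ≠ g + 1 ∧ Q (Q g - 1) = g + 1
  key : ∀ g g', 0 ≤ g → g < N → 0 ≤ g' → g' < N → g ≠ g' → K g = K g' →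
    K (Q g - 1) = K g ∨ K (Q g' - 1) = K g'

/-- After the first loop at most one element of each key is left over, since it must be the one that
waits in `P`. All others keep their partner, which has the same key. -/
theorem RestPairing.perfect {M : ℕ} {K Q₀ P Q : ℤ → ℤ} {w : ℤ}
    (h₀ : KeyPairing (2 * M : ℕ) K Q₀ P (2 * M : ℕ))
    (h : RestPairing (2 * M : ℕ) Q₀ Q w (2 * M : ℕ)) : PerfectPairing (2 * M : ℕ) K Q where
  partner g h0 h1 := by
    refine h.partner g h0 h1 fun hg => ?_
    have := h.waiting g h0 h1 hg
    rw [h.wait_eq_zero] at this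
    omega
  key g g' h0 h1 h0' h1' hne hK := by
    by_cases e : Q₀ g = 0
    · by_cases e' : Q₀ g' = 0
      · have h2 := h₀.waiting g h0 h1 e
        have h3 := h₀.waiting g' h0' h1' e'
        rw [hK] at h2
        omega
      · right
        rw [h.old g' h0' h1' e']
        exact (h₀.partner g' h0' h1' e').2.2.2.2
    · left
      rw [h.old g h0 h1 e]
      exact (h₀.partner g h0 h1 e).2.2.2.2

/-- Invariant of the colouring with the colours `1` and `2` of the cycles that consist of pairs
`{g, ρ g}` and of pairs `{g, Q g - 1}`: all elements below `i` are coloured. If `cur ≠ i`, then we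
are on the way along the cycle through `i`, and arrived at `cur` from `l`. -/
structure CycleColoring (N : ℤ) (ρ Q C : ℤ → ℤ) (i cur : ℤ) : Prop where
  colors : ∀ g, 0 ≤ g → g < N → C g = 0 ∨ C g = 1 ∨ C g = 2
  swap : ∀ g, 0 ≤ g → g < N → C g ≠ 0 → C (ρ g) = 3 - C g
  done : ∀ g, 0 ≤ g → g < i → C g ≠ 0
  pair : (cur = i ∧ ∀ g, 0 ≤ g → g < N → C g ≠ 0 → C (Q g - 1) = 3 - C g) ∨
    ∃ l, 0 ≤ l ∧ l < N ∧ i < N ∧ C i = 1 ∧ C l = 2 ∧ Q l = cur + 1 ∧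
      ∀ g, 0 ≤ g → g < N → C g ≠ 0 → g ≠ i → g ≠ l →
        C (Q g - 1) = 3 - C g ∧ Q g - 1 ≠ i ∧ Q g - 1 ≠ l

/-- The walk colours `cur` with `1` and `ρ cur` with `2`, and moves on to the `Q`-partner of `ρ
cur`. Only the two ends of the coloured arc, `i` and `ρ cur`, may still lack a coloured `Q`-partner;
the former loose end `l` is now matched with `cur`. -/
theorem CycleColoring.step {N : ℤ} {K ρ Q C : ℤ → ℤ} {i cur : ℤ}
    (h : CycleColoring N ρ Q C i cur) (hQ : PerfectPairing N K Q)
    (hρ : ∀ g, 0 ≤ g → g < N → 0 ≤ ρ g ∧ ρ g < N ∧ ρ g ≠ g ∧ ρ (ρ g) = g)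
    (hi : 0 ≤ i) (h0 : 0 ≤ cur) (hN : cur < N) (hC : C cur = 0) :
    CycleColoring N ρ Q (Function.update (Function.update C cur 1) (ρ cur) 2) i
      (Q (ρ cur) - 1) := by
  obtain ⟨r1, r2, r3, r4⟩ := hρ cur h0 hN
  -- Elements are coloured in `ρ`-pairs.
  have hCr : C (ρ cur) = 0 := by
    by_contra e
    have := h.swap _ r1 r2 e
    rw [r4, hC] at this
    rcases h.colors _ r1 r2 with e' | e' | e' <;> omega
  have key : ∀ g, Function.update (Function.update C cur 1) (ρ cur) 2 g =
      if g = ρ cur then 2 else if g = cur then 1 else C g := by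
    intro g
    simp only [Function.update_apply]
  have hC' : ∀ g, g ≠ ρ cur → g ≠ cur →
      Function.update (Function.update C cur 1) (ρ cur) 2 g = C g := by
    intro g h1 h2
    rw [key, if_neg h1, if_neg h2]
  have hCu : Function.update (Function.update C cur 1) (ρ cur) 2 cur = 1 := by
    rw [key, if_neg (Ne.symm r3), if_pos rfl]
  have hCv : Function.update (Function.update C cur 1) (ρ cur) 2 (ρ cur) = 2 := by
    rw [key, if_pos rfl]
  generalize hD : Function.update (Function.update C cur 1) (ρ cur) 2 = D at *
  clear key hD
  have hne : ∀ g, C g ≠ 0 → g ≠ ρ cur ∧ g ≠ cur := by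
    intro g hg
    exact ⟨by rintro rfl; exact hg hCr, by rintro rfl; exact hg hC⟩
  have hDC : ∀ g, C g ≠ 0 → D g = C g := fun g hg => hC' g (hne g hg).1 (hne g hg).2
  constructor
  · intro g h1 h2
    by_cases e1 : g = ρ cur
    · rw [e1, hCv]; omega
    · by_cases e2 : g = cur
      · rw [e2, hCu]; omega
      · rw [hC' g e1 e2]; exact h.colors g h1 h2
  · intro g h1 h2 hg
    by_cases e1 : g = ρ cur
    · rw [e1, r4, hCu, hCv]; rfl
    · by_cases e2 : g = cur
      · rw [e2, hCu, hCv]; rfl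
      · rw [hC' g e1 e2] at hg ⊢
        have := h.swap g h1 h2 hg
        rw [hDC, this]
        rcases h.colors g h1 h2 with e | e | e <;> omega
  · intro g h1 h2
    have := h.done g h1 h2
    rwa [hDC g this]
  · right
    rcases h.pair with ⟨rfl, hp⟩ | ⟨l, l1, l2, l3, l4, l5, l6, hp⟩
    · refine ⟨ρ cur, r1, r2, hN, hCu, hCv, by omega, ?_⟩
      intro g h1 h2 hg e2 e1
      rw [hC' g e1 e2] at hg ⊢
      have h3 := hp g h1 h2 hg
      have h4 : C (Q g - 1) ≠ 0 := by
        rcases h.colors g h1 h2 with e | e | e <;> omega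
      rw [hDC _ h4]
      exact ⟨h3, (hne _ h4).2, (hne _ h4).1⟩
    · have hil := hQ.partner l l1 l2
      have n1 := hne i (by omega)
      have n2 := hne l (by omega)
      refine ⟨ρ cur, r1, r2, l3, by rw [hDC i (by omega), l4], hCv, by omega, ?_⟩
      intro g h1 h2 hg e2 e1
      by_cases e3 : g = l
      · subst e3
        rw [hDC g (by omega), l6, add_sub_cancel_right, hCu, l5]
        exact ⟨rfl, Ne.symm n1.2, Ne.symm r3⟩
      · by_cases e4 : g = cur
        · subst e4
          rw [l6, add_sub_cancel_right] at hil
          rw [hil.2.2.2, add_sub_cancel_right, hCu, hDC l (by omega), l5]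
          refine ⟨rfl, ?_, n2.1⟩
          rintro rfl; omega
        · rw [hC' g e1 e4] at hg ⊢
          obtain ⟨h3, h4, h5⟩ := hp g h1 h2 hg e2 e3
          have h6 : C (Q g - 1) ≠ 0 := by
            rcases h.colors g h1 h2 with e | e | e <;> omega
          rw [hDC _ h6]
          exact ⟨h3, h4, (hne _ h6).1⟩

/-- When the walk reaches a coloured element, this is `i`, the only one other than `l` whose
`Q`-partner may be `l`. The closing pair consists of `l` with colour `2` and `i` with colour `1`, as
the cycle alternates between `Q` and `ρ`. -/
theorem CycleColoring.close {N : ℤ} {K ρ Q C : ℤ → ℤ} {i cur : ℤ}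
    (h : CycleColoring N ρ Q C i cur) (hQ : PerfectPairing N K Q)
    (hi : 0 ≤ i) (h0 : 0 ≤ cur) (hN : cur < N) (hC : C cur ≠ 0) :
    CycleColoring N ρ Q C (i + 1) (i + 1) := by
  have hi' : C i ≠ 0 ∧ ∀ g, 0 ≤ g → g < N → C g ≠ 0 → C (Q g - 1) = 3 - C g := by
    rcases h.pair with ⟨rfl, hp⟩ | ⟨l, l1, l2, l3, l4, l5, l6, hp⟩
    · exact ⟨hC, hp⟩
    · have hil := hQ.partner l l1 l2
      rw [l6, add_sub_cancel_right] at hil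
      have e : cur = i := by
        by_contra e
        have := (hp cur h0 hN hC e (by omega)).2.2
        omega
      subst e
      refine ⟨hC, fun g h1 h2 hg => ?_⟩
      by_cases e1 : g = cur
      · rw [e1, hil.2.2.2, add_sub_cancel_right, l5, l4]; rfl
      · by_cases e2 : g = l
        · rw [e2, l6, add_sub_cancel_right, l5, l4]; rfl
        · exact (hp g h1 h2 hg e1 e2).1
  refine ⟨h.colors, h.swap, fun g h1 h2 => ?_, Or.inl ⟨rfl, hi'.2⟩⟩
  rcases eq_or_ne g i with rfl | hne
  · exact hi'.1
  · exact h.done g h1 (by omega)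

/-- Colours the cycles. -/
def colorCycles : Program :=
  .loop (.lt (.var 20) (.var 23)) (.cond (.read 13 (.var 19))
    (.seq (.write 20 0 (.var 20 + 1)) (.write 19 0 (.var 20)))
    (.seq (.write 13 (.var 19) 1) (.seq (.write 13 (.read 11 (.var 19)) 2)
      (.write 19 0 (.read 17 (.read 11 (.var 19)) - 1)))))

theorem runs_colorCycles {W N : ℕ} {K : ℤ → ℤ} {s : Memory} (hN : s 23 0 = N) (hW : N + 2 ≤ W)
    (hQ : PerfectPairing N K (s 17))
    (hρ : ∀ g : ℤ, 0 ≤ g → g < N →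
      0 ≤ s 11 g ∧ s 11 g < N ∧ s 11 g ≠ g ∧ s 11 (s 11 g) = g)
    (hC : ∀ g : ℤ, 0 ≤ g → g < N → s 13 g = 0) (hi : s 20 0 = 0) (hc : s 19 0 = 0) :
    Runs W colorCycles s (2 * N) (fun s' => ∀ g : ℤ, 0 ≤ g → g < N →
      (s' 13 g = 1 ∨ s' 13 g = 2) ∧ s' 13 (s 11 g) = 3 - s' 13 g ∧
      s' 13 (s 17 g - 1) = 3 - s' 13 g) := by
  -- The measure is `N - i` plus the number of uncoloured elements: each iteration either advances
  -- `i` or colours something. Initially it is `2 * N`.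
  have key := Runs.loop (W := W) (e := .lt (.var 20) (.var 23)) (P := .cond (.read 13 (.var 19))
    (.seq (.write 20 0 (.var 20 + 1)) (.write 19 0 (.var 20)))
    (.seq (.write 13 (.var 19) 1) (.seq (.write 13 (.read 11 (.var 19)) 2)
      (.write 19 0 (.read 17 (.read 11 (.var 19)) - 1)))))
    (fun μ s' => s' 11 = s 11 ∧ s' 17 = s 17 ∧ s' 23 = s 23 ∧ 0 ≤ s' 20 0 ∧ s' 20 0 ≤ N ∧
      0 ≤ s' 19 0 ∧ (s' 19 0 < N ∨ s' 20 0 = N) ∧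
      CycleColoring N (s 11) (s 17) (s' 13) (s' 20 0) (s' 19 0) ∧
      (μ : ℤ) = (N - s' 20 0) + ((Finset.Ico (0 : ℤ) N).filter (fun g => s' 13 g = 0)).card) (by
    rintro μ s' ⟨e1, e2, e3, h1, h2, h3, h4, hI, hμ⟩ he
    simp only [Expr.eval_lt, Expr.eval_read, Expr.eval_const, e3, hN, ite_one_ne_zero] at he
    have h4 : s' 19 0 < N := by omega
    simp only [Program.wp, Expr.eval_read, Expr.eval_add, Expr.eval_sub, Expr.eval_const,
      Expr.eval_one, Expr.eval_zero]
    constructor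
    · intro hc
      have := hI.close hQ h1 h3 h4 hc
      simp [Memory.set_same, Memory.set_ne]
      refine ⟨by rw [abs_le]; omega, μ - 1, by omega, e1, e2, e3, by omega, he, by omega,
        by omega, this, by omega⟩
    · intro hc
      have hr := hρ _ h3 h4
      have hq := hQ.partner _ hr.1 hr.2.1
      have := hI.step hQ hρ h1 h3 h4 hc
      simp [Memory.set_same, Memory.set_ne, e1, e2]
      have hlt : ((Finset.Ico (0 : ℤ) N).filter (fun g => Function.update
          (Function.update (s' 13) (s' 19 0) 1) (s 11 (s' 19 0)) 2 g = 0)).card <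
          ((Finset.Ico (0 : ℤ) N).filter (fun g => s' 13 g = 0)).card := by
        apply Finset.card_lt_card
        refine Finset.ssubset_iff_of_subset ?_ |>.2 ⟨s' 19 0, ?_, ?_⟩
        · intro g
          simp only [Finset.mem_filter, Function.update_apply]
          split_ifs <;> simp
        · simp only [Finset.mem_filter, Finset.mem_Ico]
          exact ⟨⟨h3, h4⟩, hc⟩
        · simp only [Finset.mem_filter, Function.update_apply]
          split_ifs <;> simp
      generalize ((Finset.Ico (0 : ℤ) N).filter (fun g => Function.update
          (Function.update (s' 13) (s' 19 0) 1) (s 11 (s' 19 0)) 2 g = 0)).card = k at hlt ⊢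
      exact ⟨by omega, by omega, by rw [abs_le]; omega, (N - s' 20 0).toNat + k, by omega, e3, h1,
        h2, by omega, Or.inl (by omega), this, by omega⟩)
    (μ := N + ((Finset.Ico (0 : ℤ) N).filter (fun g => s 13 g = 0)).card) (s := s)
    ⟨rfl, rfl, rfl, by omega, by omega, by omega, by omega, by
      rw [hi, hc]
      exact ⟨fun g h1 h2 => Or.inl (hC g h1 h2), fun g h1 h2 h => absurd (hC g h1 h2) h,
        by omega, Or.inl ⟨rfl, fun g h1 h2 h => absurd (hC g h1 h2) h⟩⟩, by rw [hi]; push_cast; ring⟩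
  have hle := Finset.card_filter_le (Finset.Ico (0 : ℤ) N) (fun g => s 13 g = 0)
  rw [Int.card_Ico] at hle
  refine Runs.mono key (by omega) ?_
  rintro s' - ⟨he, μ, e1, e2, e3, h1, h2, h3, h4, hI, -⟩
  simp only [Expr.eval_lt, Expr.eval_read, Expr.eval_const, e3, hN, ite_one_eq_zero] at he
  intro g hg1 hg2
  have hg := hI.done g hg1 (by omega)
  refine ⟨(hI.colors g hg1 hg2).resolve_left hg, hI.swap g hg1 hg2 hg, ?_⟩
  rcases hI.pair with ⟨-, hp⟩ | ⟨l, -, -, hlt, -⟩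
  · exact hp g hg1 hg2 hg
  · omega

end WordRAM

/-! ### Balanced recolouring of half-edges -/

namespace WordRAM

theorem Runs.then {W : ℕ} {P P' : Program} {s : Memory} {k k₁ : ℕ} {Q Q' : Memory → Prop}
    (h : Runs W P s k₁ Q) (hk : k₁ ≤ k)
    (h' : ∀ s', (∀ a, a ∉ P.writes → s' a = s a) → Q s' → Runs W P' s' (k - k₁) Q') :
    Runs W (.seq P P') s k Q' :=
  Runs.seq h h' (by omega)

/-- `A[i] := e`. -/
theorem Runs.write {W : ℕ} {s : Memory} {A : ℕ} {i e : Expr} (h : |e.eval s| ≤ W) :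
    Runs W (.write A i e) s 0 (fun s' => s' A = Function.update (s A) (i.eval s) (e.eval s)) :=
  Runs.of_wp ⟨h, Memory.set_same _ _ _ _⟩

theorem PerfectPairing.congr {N : ℤ} {K K' Q : ℤ → ℤ} (h : PerfectPairing N K Q)
    (hK : ∀ g, 0 ≤ g → g < N → K g = K' g) : PerfectPairing N K' Q where
  partner := h.partner
  key g g' h1 h2 h3 h4 hne e := by
    have p := h.partner g h1 h2
    have p' := h.partner g' h3 h4
    rw [← hK g h1 h2, ← hK g' h3 h4, ← hK _ (by omega) (by omega), ← hK _ (by omega) (by omega)]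
    exact h.key g g' h1 h2 h3 h4 hne (by rw [hK g h1 h2, hK g' h3 h4, e])

/-- `for a := 0 to b - 1 do P[K[a]] := 0` -/
theorem runs_clear {W N : ℕ} {s : Memory} (hN : s 23 0 = N) (hW : N ≤ W) :
    Runs W (.forLoop 20 23 (.write 16 (.read 15 (.var 20)) 0)) s N
      (fun s' => ∀ g : ℤ, 0 ≤ g → g < N → s' 16 (s 15 g) = 0) := by
  refine Runs.forLoop (fun j s' => ∀ g : ℤ, 0 ≤ g → g < j → s' 16 (s 15 g) = 0) (by decide)
    (by decide) (by decide) hN hW (fun _ _ _ h => h) (by omega) ?_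
  intro j s' hj hfr hI
  have h15 : s' 15 = s 15 := hfr 15 (by decide)
  have h20 : s' 20 0 = j := by rw [hfr 20 (by decide), Memory.set_same]; simp
  simp [Program.wp, Memory.set_same, h15, h20]
  intro g h0 h1
  rw [Function.update_apply]
  split_ifs with e
  · rfl
  · exact hI g h0 (lt_of_le_of_ne (by omega) (by rintro rfl; exact e rfl))

/-- Given an involution `ρ` (in array `11`) without fixed points and a vertex for each half-edge (in
array `10`), computes a new colouring (in array `13`), in which `ρ` exchanges the colours and which
is balanced for each vertex and each old colour. The old colouring is moved to array `14`. -/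
def balance : Program :=
  .seq (.fill 20 23 14 1 (.read 13 (.var 20)) 0)
  (.seq (.fill 20 23 15 1 (.read 10 (.var 20) + .read 10 (.var 20) + .read 13 (.var 20)) 0)
  (.seq (.fill 20 23 13 1 0 0)
  (.seq (.fill 20 23 17 1 0 0)
  (.seq (.forLoop 20 23 (.write 16 (.read 15 (.var 20)) 0))
  (.seq (.write 22 0 0)
  (.seq pairKeys
  (.seq pairRest
  (.seq (.write 20 0 0)
  (.seq (.write 19 0 0) colorCycles)))))))))

/-- The key of a half-edge is twice its vertex plus its old colour. It separates vertices and
colours when all colours are `0`, and also when all are `1` or `2`. There are seven passes over the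
`2 * M` half-edges and at most `4 * M` iterations of the colouring loop. -/
theorem runs_balance {W M : ℕ} {s : Memory} (hN : s 23 0 = (2 * M : ℕ)) (hW : 2 * M + 2 ≤ W)
    (hρ : ∀ g : ℤ, 0 ≤ g → g < (2 * M : ℕ) →
      0 ≤ s 11 g ∧ s 11 g < (2 * M : ℕ) ∧ s 11 g ≠ g ∧ s 11 (s 11 g) = g)
    (hC : ∀ g : ℤ, 0 ≤ g → g < (2 * M : ℕ) →
      |s 13 g| ≤ W ∧ |s 10 g + s 10 g + s 13 g| ≤ W) :
    Runs W balance s (18 * M) (fun s' =>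
      ∃ Q, PerfectPairing (2 * M : ℕ) (fun g => s 10 g + s 10 g + s 13 g) Q ∧
        ∀ g : ℤ, 0 ≤ g → g < (2 * M : ℕ) → s' 14 g = s 13 g ∧ (s' 13 g = 1 ∨ s' 13 g = 2) ∧
          s' 13 (s 11 g) = 3 - s' 13 g ∧ s' 13 (Q g - 1) = 3 - s' 13 g) := by
  have hz : |(0 : ℤ)| ≤ W := by simp
  refine (Runs.fill (N := 2 * M) (s 13) hN (by omega) fun j h0 h1 => ?_).then (by omega)
    fun s₁ f₁ q₁ => ?_
  · exact ⟨by simp [Memory.set], (hC j h0 h1).1⟩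
  refine (Runs.fill (N := 2 * M) (fun g => s 10 g + s 10 g + s 13 g) ?_ (by omega)
    fun j h0 h1 => ?_).then (by omega) fun s₂ f₂ q₂ => ?_
  · rw [f₁ 23 (by decide), hN]
  · refine ⟨?_, (hC j h0 h1).2⟩
    simp [Memory.set, f₁ 10 (by decide), f₁ 13 (by decide)]
  refine (Runs.fill (N := 2 * M) (fun _ => 0) ?_ (by omega)
    fun j h0 h1 => ⟨by simp, hz⟩).then (by omega) fun s₃ f₃ q₃ => ?_
  · rw [f₂ 23 (by decide), f₁ 23 (by decide), hN]
  refine (Runs.fill (N := 2 * M) (fun _ => 0) ?_ (by omega)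
    fun j h0 h1 => ⟨by simp, hz⟩).then (by omega) fun s₄ f₄ q₄ => ?_
  · rw [f₃ 23 (by decide), f₂ 23 (by decide), f₁ 23 (by decide), hN]
  have hN₄ : s₄ 23 0 = (2 * M : ℕ) := by
    rw [f₄ 23 (by decide), f₃ 23 (by decide), f₂ 23 (by decide), f₁ 23 (by decide), hN]
  refine (runs_clear hN₄ (by omega)).then (by omega) fun s₅ f₅ q₅ => ?_
  refine (Runs.write (by simp)).then (by omega) fun s₆ f₆ q₆ => ?_
  have h15 : s₆ 15 = s₂ 15 := by
    rw [f₆ 15 (by decide), f₅ 15 (by decide), f₄ 15 (by decide), f₃ 15 (by decide)]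
  refine (runs_pairKeys (N := 2 * M) (by rw [f₆ 23 (by decide), f₅ 23 (by decide), hN₄]) (by omega)
    ?_ ?_).then (by omega) fun s₇ f₇ q₇ => ?_
  · intro g h0 h1
    rw [f₆ 17 (by decide), f₅ 17 (by decide)]
    exact q₄ g h0 h1
  · intro g h0 h1
    rw [f₆ 16 (by decide), f₆ 15 (by decide), f₅ 15 (by decide)]
    exact q₅ g h0 h1
  have q₇' := q₇
  rw [← f₇ 15 (by decide)] at q₇
  refine (runs_pairRest (N := 2 * M) ?_ (by omega) q₇ ?_).then (by omega) fun s₈ f₈ q₈ => ?_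
  · rw [f₇ 23 (by decide), f₆ 23 (by decide), f₅ 23 (by decide), hN₄]
  · rw [f₇ 22 (by decide), q₆]; simp
  refine (Runs.write (by simp)).then (by omega) fun s₉ f₉ q₉ => ?_
  refine (Runs.write (by simp)).then (by omega) fun s₁₀ f₁₀ q₁₀ => ?_
  have h11 : s₁₀ 11 = s 11 := by
    rw [f₁₀ 11 (by decide), f₉ 11 (by decide), f₈ 11 (by decide), f₇ 11 (by decide),
      f₆ 11 (by decide), f₅ 11 (by decide), f₄ 11 (by decide), f₃ 11 (by decide),
      f₂ 11 (by decide), f₁ 11 (by decide)]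
  have h17 : s₁₀ 17 = s₈ 17 := by rw [f₁₀ 17 (by decide), f₉ 17 (by decide)]
  have hperf : PerfectPairing (2 * M : ℕ) (fun g => s 10 g + s 10 g + s 13 g) (s₁₀ 17) := by
    rw [h17]
    refine (RestPairing.perfect q₇ q₈).congr fun g h0 h1 => ?_
    rw [f₇ 15 (by decide), h15, q₂ g h0 h1]
  refine (runs_colorCycles (N := 2 * M) ?_ (by omega) hperf ?_ ?_ ?_ ?_).mono (by omega)
    fun s' f' q' => ⟨s₁₀ 17, hperf, fun g h0 h1 => ?_⟩
  · rw [f₁₀ 23 (by decide), f₉ 23 (by decide), f₈ 23 (by decide), f₇ 23 (by decide),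
      f₆ 23 (by decide), f₅ 23 (by decide), hN₄]
  · rw [h11]; exact hρ
  · intro g h0 h1
    rw [f₁₀ 13 (by decide), f₉ 13 (by decide), f₈ 13 (by decide), f₇ 13 (by decide),
      f₆ 13 (by decide), f₅ 13 (by decide), f₄ 13 (by decide)]
    exact q₃ g h0 h1
  · rw [f₁₀ 20 (by decide), q₉]; simp
  · rw [q₁₀]; simp
  · have := q' g h0 h1
    rw [h11] at this
    refine ⟨?_, this⟩
    rw [f' 14 (by decide), f₁₀ 14 (by decide), f₉ 14 (by decide), f₈ 14 (by decide),
      f₇ 14 (by decide), f₆ 14 (by decide), f₅ 14 (by decide), f₄ 14 (by decide),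
      f₃ 14 (by decide), f₂ 14 (by decide)]
    exact q₁ g h0 h1

end WordRAM

/-! ### Splitting the edges into two classes of paths and cycles -/

namespace WordRAM

/-- A colouring that exchanges the colours of partners is balanced for each key. -/
theorem PerfectPairing.card_color_le {N : ℤ} {K Q C : ℤ → ℤ} (h : PerfectPairing N K Q)
    (hC : ∀ g, 0 ≤ g → g < N → (C g = 1 ∨ C g = 2) ∧ C (Q g - 1) = 3 - C g) (k c : ℤ) :
    ((Finset.Ico 0 N).filter fun g => K g = k ∧ C g = c).card ≤
      ((Finset.Ico 0 N).filter fun g => K g = k ∧ C g = 3 - c).card + 1 := by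
  -- Passing to the partner is injective and exchanges the colours. It stays within the key, with at
  -- most one exception `u`, which accounts for the summand one.
  have hinj : ∀ A : Finset ℤ, (∀ g ∈ A, 0 ≤ g ∧ g < N ∧ C g = c ∧ K (Q g - 1) = k) →
      A.card ≤ ((Finset.Ico 0 N).filter fun g => K g = k ∧ C g = 3 - c).card := by
    intro A hA
    refine Finset.card_le_card_of_injOn (fun g => Q g - 1) ?_ ?_
    · intro g hg
      obtain ⟨h0, h1, h2, h3⟩ := hA g hg
      have := h.partner g h0 h1
      simp only [Finset.coe_filter, Finset.mem_Ico, Set.mem_ofPred_eq]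
      exact ⟨by omega, h3, by rw [(hC g h0 h1).2, h2]⟩
    · intro g hg g' hg' e
      obtain ⟨h0, h1, -⟩ := hA g hg
      obtain ⟨h0', h1', -⟩ := hA g' hg'
      have p := (h.partner g h0 h1).2.2.2
      have p' := (h.partner g' h0' h1').2.2.2
      simp only at e
      rw [e] at p
      omega
  by_cases hu : ∃ u, 0 ≤ u ∧ u < N ∧ K u = k ∧ C u = c ∧ K (Q u - 1) ≠ k
  · obtain ⟨u, u0, u1, u2, u3, u4⟩ := hu
    have hle := hinj (((Finset.Ico 0 N).filter fun g => K g = k ∧ C g = c).erase u) (by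
      intro g hg
      simp only [Finset.mem_erase, Finset.mem_filter, Finset.mem_Ico] at hg
      obtain ⟨hne, ⟨h0, h1⟩, h2, h3⟩ := hg
      refine ⟨h0, h1, h3, ?_⟩
      rcases h.key g u h0 h1 u0 u1 hne (by rw [h2, u2]) with e | e
      · rw [e, h2]
      · rw [u2] at e; exact absurd e u4)
    have := Finset.pred_card_le_card_erase
      (s := (Finset.Ico 0 N).filter fun g => K g = k ∧ C g = c) (a := u)
    omega
  · push Not at hu
    refine (hinj _ fun g hg => ?_).trans (Nat.le_succ _)
    simp only [Finset.mem_filter, Finset.mem_Ico] at hg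
    exact ⟨hg.1.1, hg.1.2, hg.2.2, hu g hg.1.1 hg.1.2 hg.2.1 hg.2.2⟩

theorem PerfectPairing.card_color_le_half {N : ℤ} {K Q C : ℤ → ℤ} (h : PerfectPairing N K Q)
    (hC : ∀ g, 0 ≤ g → g < N → (C g = 1 ∨ C g = 2) ∧ C (Q g - 1) = 3 - C g) (k : ℤ) {r : ℕ}
    (hr : ((Finset.Ico 0 N).filter fun g => K g = k).card ≤ 2 * r) (c : ℤ) :
    ((Finset.Ico 0 N).filter fun g => K g = k ∧ C g = c).card ≤ r := by
  by_cases hc : c = 3 - c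
  · omega
  have h1 := h.card_color_le hC k c
  have h2 : ((Finset.Ico 0 N).filter fun g => K g = k ∧ C g = c).card +
      ((Finset.Ico 0 N).filter fun g => K g = k ∧ C g = 3 - c).card ≤
      ((Finset.Ico 0 N).filter fun g => K g = k).card := by
    rw [← Finset.card_union_of_disjoint]
    · apply Finset.card_le_card
      intro g
      simp only [Finset.mem_union, Finset.mem_filter]
      tauto
    · rw [Finset.disjoint_left]
      intro g
      simp only [Finset.mem_filter]
      omega
  omega

/-- Two successive balanced colourings separate half-edges, if the degrees are at most four. -/
theorem color_ne {N : ℤ} {v o d Q₁ Q₂ : ℤ → ℤ}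
    (hdeg : ∀ x, ((Finset.Ico 0 N).filter fun g => v g = x).card ≤ 4)
    (h₁ : PerfectPairing N v Q₁) (h₂ : PerfectPairing N (fun g => v g + v g + o g) Q₂)
    (ho : ∀ g, 0 ≤ g → g < N → (o g = 1 ∨ o g = 2) ∧ o (Q₁ g - 1) = 3 - o g)
    (hd : ∀ g, 0 ≤ g → g < N → (d g = 1 ∨ d g = 2) ∧ d (Q₂ g - 1) = 3 - d g)
    {g g' : ℤ} (hg : 0 ≤ g ∧ g < N) (hg' : 0 ≤ g' ∧ g' < N) (hne : g ≠ g') (hv : v g = v g')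
    (hoo : o g = o g') : d g ≠ d g' := by
  intro e
  -- Four half-edges at a vertex are halved to two of each first colour, and these to one of each
  -- pair of colours.
  have k1 := h₁.card_color_le_half ho (v g) (r := 2) (hdeg _) (o g)
  have k2 := h₂.card_color_le_half hd (v g + v g + o g) (r := 1) (by
    refine le_trans (Finset.card_le_card ?_) k1
    intro x
    simp only [Finset.mem_filter, Finset.mem_Ico]
    rintro ⟨hx, hx'⟩
    have := (ho x hx.1 hx.2).1
    have := (ho g hg.1 hg.2).1
    exact ⟨hx, by omega, by omega⟩) (d g)
  have := Finset.card_le_one.1 k2 g (by simp [hg]) g' (by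
    simp only [Finset.mem_filter, Finset.mem_Ico]
    exact ⟨hg', by omega, e.symm⟩)
  exact hne this

theorem exists_fin {m : ℕ} {h : ℤ} (h0 : 0 ≤ h) (h1 : h < m) : ∃ i : Fin m, h = (i : ℤ) :=
  ⟨⟨h.toNat, by omega⟩, by simp [h0]⟩

theorem IsEdgeList.adj {n m : ℕ} {G : SimpleGraph (Fin n)} {E : Fin m → Fin n × Fin n}
    (hE : IsEdgeList G E) (i : Fin m) : G.Adj (E i).1 (E i).2 := by
  have : listedEdge E i ∈ G.edgeSet := hE.2 ▸ Set.mem_range_self i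
  exact this

/-- The number of half-edges at a vertex is at most the maximum degree. -/
theorem card_halfEdges_le {n m D : ℕ} {G : SimpleGraph (Fin n)} [DecidableRel G.Adj]
    {E : Fin m → Fin n × Fin n} (hG : G.maxDegree ≤ D) (hE : IsEdgeList G E) {v : ℤ → ℤ}
    (h1 : ∀ i : Fin m, v i = (E i).1) (h2 : ∀ i : Fin m, v (i + m) = (E i).2) (x : ℤ) :
    ((Finset.Ico (0 : ℤ) (2 * m : ℕ)).filter fun g => v g = x).card ≤ D := by
  rcases Finset.eq_empty_or_nonempty
    ((Finset.Ico (0 : ℤ) (2 * m : ℕ)).filter fun g => v g = x) with he | ⟨g₀, hg₀⟩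
  · rw [he]; simp
  have hsplit : ∀ g : ℤ, 0 ≤ g → g < (2 * m : ℕ) →
      ∃ i : Fin m, (g = i ∧ v g = (E i).1) ∨ (g = i + m ∧ v g = (E i).2) := by
    intro g h0 h1'
    by_cases hg : g < m
    · obtain ⟨i, rfl⟩ := exists_fin h0 hg
      exact ⟨i, Or.inl ⟨rfl, h1 i⟩⟩
    · obtain ⟨i, hi⟩ := exists_fin (m := m) (h := g - m) (by omega) (by push_cast at h1'; omega)
      obtain rfl : g = i + m := by omega
      exact ⟨i, Or.inr ⟨rfl, h2 i⟩⟩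
  simp only [Finset.mem_filter, Finset.mem_Ico] at hg₀
  have : Nonempty (Fin m) := ⟨(hsplit g₀ hg₀.1.1 hg₀.1.2).choose⟩
  choose! φ hφ using hsplit
  obtain ⟨w, hw⟩ : ∃ w : Fin n, x = w := by
    rcases hφ g₀ hg₀.1.1 hg₀.1.2 with h | h
    · exact ⟨_, by rw [← hg₀.2, h.2]⟩
    · exact ⟨_, by rw [← hg₀.2, h.2]⟩
  subst hw
  refine le_trans ?_ ((G.degree_le_maxDegree w).trans hG)
  rw [← G.card_incidenceFinset_eq_degree]
  refine Finset.card_le_card_of_injOn (fun g => listedEdge E (φ g)) ?_ ?_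
  · intro g hg
    simp only [Finset.coe_filter, Finset.mem_Ico, Set.mem_ofPred_eq] at hg
    rw [Finset.mem_coe, SimpleGraph.mem_incidenceFinset]
    refine ⟨hE.2 ▸ Set.mem_range_self _, ?_⟩
    simp only [listedEdge, Sym2.mem_iff, Fin.ext_iff]
    rcases hφ g hg.1.1 hg.1.2 with h | h
    · left; have := h.2; omega
    · right; have := h.2; omega
  · intro g hg g' hg' e
    simp only [Finset.coe_filter, Finset.mem_Ico, Set.mem_ofPred_eq] at hg hg'
    have e' := hE.1 e
    have hne := (IsEdgeList.adj hE (φ g)).ne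
    rw [Ne, Fin.ext_iff] at hne
    have p := hφ g hg.1.1 hg.1.2
    have p' := hφ g' hg'.1.1 hg'.1.2
    rw [← e'] at p'
    omega

/-- Splits the edges into two classes, and directs them. Arrays `24` and `25` hold the tails and
heads, and array `12` tells which edges are in the larger class. -/
def splitEdges : Program :=
  .seq (.write 21 0 (.read 0 1))
  (.seq (.write 23 0 (.var 21 + .var 21))
  (.seq (.fill 20 23 10 (.lt (.var 20) (.var 21)) (.read 1 (.var 20)) (.read 2 (.var 20 - .var 21)))
  (.seq (.fill 20 23 11 (.lt (.var 20) (.var 21)) (.var 20 + .var 21) (.var 20 - .var 21))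
  (.seq balance
  (.seq balance
  (.seq (.fill 20 21 26 (.eq (.read 13 (.var 20)) (.read 14 (.var 20))) 1 0)
  (.seq (.fill 20 21 24 (.eq (.read 14 (.var 20)) 1) (.read 1 (.var 20)) (.read 2 (.var 20)))
  (.seq (.fill 20 21 25 (.eq (.read 14 (.var 20)) 1) (.read 2 (.var 20)) (.read 1 (.var 20)))
  (.seq (.write 27 0 0)
  (.seq (.forLoop 20 21 (.write 27 0 (.var 27 + .read 26 (.var 20))))
  (.seq (.write 9 0 (.not (.lt (.var 27 + .var 27) (.var 21))))
  (.fill 20 21 12 (.eq (.read 26 (.var 20)) (.var 9)) 1 0))))))))))))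

theorem inputMemory_ends {n m : ℕ} (E : Fin m → Fin n × Fin n) (i : Fin m) :
    inputMemory E 1 i = (E i).1 ∧ inputMemory E 2 i = (E i).2 := by
  simp [inputMemory]

theorem inputMemory_eq_zero {n m : ℕ} (E : Fin m → Fin n × Fin n) {a : ℕ} (ha : 3 ≤ a) :
    inputMemory E a = fun _ => 0 := by
  funext i
  simp only [inputMemory]
  rw [if_neg (by omega)]
  split_ifs <;> omega

theorem runs_count {W m : ℕ} {s : Memory} (hm : s 21 0 = m) (hW : m ≤ W) (h27 : s 27 0 = 0)
    (hc : ∀ g : ℤ, 0 ≤ g → g < m → s 26 g = 0 ∨ s 26 g = 1) :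
    Runs W (.forLoop 20 21 (.write 27 0 (.var 27 + .read 26 (.var 20)))) s m
      (fun s' => s' 27 0 = ∑ g ∈ Finset.range m, s 26 g) := by
  refine (Runs.forLoop (a := 20) (b := 21) (fun j s' => j ≤ m → 0 ≤ s' 27 0 ∧ s' 27 0 ≤ j ∧
    s' 27 0 = ∑ g ∈ Finset.range j, s 26 g) (by decide) (by decide) (by decide) hm hW
    (fun _ _ _ h => h) (by simp [h27]) ?_).mono le_rfl fun s' _ h => (h le_rfl).2.2
  intro j s' hj hfr hI
  have h26 : s' 26 = s 26 := hfr 26 (by decide)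
  have h20 : s' 20 0 = j := by rw [hfr 20 (by decide), Memory.set_same]; simp
  obtain ⟨h0, h1, h2⟩ := hI (by omega)
  have := hc j (by omega) (by omega)
  simp only [Program.wp, Memory.set_same, Expr.eval_add, Expr.eval_read, Expr.eval_const, h20, h26,
    Expr.eval_zero, Function.update_self, Finset.sum_range_succ, ← h2]
  refine ⟨by rw [abs_le]; omega, fun _ => ⟨by omega, by push_cast; omega, trivial⟩⟩

/-- The half-edges `i` and `i + m` belong to edge `i`. The first colouring `o` (moved to array `14`)
makes the end with colour `1` the tail; the class of an edge records whether the second colouring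
`d` (array `13`) agrees with `o`. Both colours are exchanged between the halves of an edge, so
either half gives the same class. -/
theorem runs_splitEdges {W n m : ℕ} {G : SimpleGraph (Fin n)} [DecidableRel G.Adj]
    {E : Fin m → Fin n × Fin n} (hG : G.maxDegree ≤ 4) (hE : IsEdgeList G E)
    (hW : 4 * m + 2 * n + 4 ≤ W) :
    Runs W splitEdges (inputMemory E) (50 * m) (fun s' => s' 21 0 = m ∧
      ∃ (tail head : Fin m → Fin n) (F : Fin m → Prop) (_ : DecidablePred F),
        (∀ i : Fin m, s' 24 i = tail i ∧ s' 25 i = head i ∧ s' 12 i = if F i then 1 else 0) ∧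
        (∀ i, s(tail i, head i) = listedEdge E i) ∧
        (∀ i j, (F i ↔ F j) → tail i = tail j → i = j) ∧
        (∀ i j, (F i ↔ F j) → head i = head j → i = j) ∧
        m ≤ 2 * (Finset.univ.filter F).card) := by
  have hz : ∀ a, 3 ≤ a → ∀ i, inputMemory E a i = 0 := fun a ha i => by
    rw [inputMemory_eq_zero E ha]
  have hm : inputMemory E 0 1 = m := by simp [inputMemory]
  have he := inputMemory_ends E
  generalize hs : inputMemory E = s at hz hm he ⊢
  have hEn : ∀ i, ((E i).1 : ℤ) < n ∧ ((E i).2 : ℤ) < n := fun i => by omega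
  -- memory preparation
  refine (Runs.write (by simp [hm]; omega)).then (by omega) fun s₁ f₁ q₁ => ?_
  have h21 : s₁ 21 0 = m := by rw [q₁]; simp [hm]
  refine (Runs.write (by
    simp only [Expr.eval_add, Expr.eval_read, Expr.eval_const, h21]
    rw [abs_of_nonneg] <;> omega)).then (by omega) fun s₂ f₂ q₂ => ?_
  have h21 : s₂ 21 0 = m := by rw [f₂ 21 (by decide), h21]
  have h23 : s₂ 23 0 = (2 * m : ℕ) := by
    rw [q₂]
    simp [f₂ 21 (by decide) ▸ h21]
    omega
  have he : ∀ i : Fin m, s₂ 1 i = (E i).1 ∧ s₂ 2 i = (E i).2 := fun i => by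
    rw [f₂ 1 (by decide), f₁ 1 (by decide), f₂ 2 (by decide), f₁ 2 (by decide)]
    exact he i
  have h13 : ∀ g, s₂ 13 g = 0 := fun g => by
    rw [f₂ 13 (by decide), f₁ 13 (by decide)]
    exact hz 13 (by omega) g
  clear f₁ f₂ q₁ q₂
  refine (Runs.fill (N := 2 * m) (fun g => if g < m then s₂ 1 g else s₂ 2 (g - m)) h23 (by omega)
    fun j h0 h1 => ?_).then (by omega) fun s₃ f₃ q₃ => ?_
  · constructor
    · simp [Memory.set, h21]
    · split_ifs with h
      · obtain ⟨i, rfl⟩ := exists_fin h0 h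
        rw [(he i).1, abs_of_nonneg (by omega)]
        have := hEn i
        omega
      · obtain ⟨i, hi⟩ := exists_fin (m := m) (h := j - m) (by omega) (by push_cast at h1; omega)
        rw [hi, (he i).2, abs_of_nonneg (by omega)]
        have := hEn i
        omega
  refine (Runs.fill (N := 2 * m) (fun g => if g < m then g + m else g - m)
    (by rw [f₃ 23 (by decide), h23]) (by omega)
    fun j h0 h1 => ?_).then (by omega) fun s₄ f₄ q₄ => ?_
  · constructor
    · simp [Memory.set, f₃ 21 (by decide), h21]
    · push_cast at h1
      split_ifs with h <;> rw [abs_of_nonneg (by omega)] <;> omega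
  have hρ : ∀ g : ℤ, 0 ≤ g → g < (2 * m : ℕ) →
      0 ≤ s₄ 11 g ∧ s₄ 11 g < (2 * m : ℕ) ∧ s₄ 11 g ≠ g ∧ s₄ 11 (s₄ 11 g) = g := by
    intro g h0 h1
    have h2 := q₄ g h0 h1
    push_cast at h1 ⊢
    split_ifs at h2 with h
    · rw [h2, q₄ _ (by omega) (by push_cast; omega), if_neg (by omega)]
      omega
    · rw [h2, q₄ _ (by omega) (by push_cast; omega), if_pos (by omega)]
      omega
  have hv1 : ∀ i : Fin m, s₄ 10 i = (E i).1 := fun i => by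
    rw [f₄ 10 (by decide), q₃ i (by omega) (by push_cast; omega), if_pos (by omega)]
    exact (he i).1
  have hv2 : ∀ i : Fin m, s₄ 10 (i + m) = (E i).2 := fun i => by
    rw [f₄ 10 (by decide), q₃ _ (by omega) (by push_cast; omega), if_neg (by omega),
      add_sub_cancel_right]
    exact (he i).2
  have hvn : ∀ g : ℤ, 0 ≤ g → g < (2 * m : ℕ) → 0 ≤ s₄ 10 g ∧ s₄ 10 g < n := by
    intro g h0 h1
    by_cases hg : g < m
    · obtain ⟨i, rfl⟩ := exists_fin h0 hg
      rw [hv1]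
      exact ⟨by omega, (hEn i).1⟩
    · obtain ⟨i, hi⟩ := exists_fin (m := m) (h := g - m) (by omega) (by push_cast at h1; omega)
      obtain rfl : g = i + m := by omega
      rw [hv2]
      exact ⟨by omega, (hEn i).2⟩
  have hρi : ∀ i : Fin m, s₄ 11 i = i + m := fun i => by
    rw [q₄ i (by omega) (by push_cast; omega), if_pos (by omega)]
  have h13 : ∀ g, s₄ 13 g = 0 := fun g => by rw [f₄ 13 (by decide), f₃ 13 (by decide), h13]
  have h21 : s₄ 21 0 = m := by rw [f₄ 21 (by decide), f₃ 21 (by decide), h21]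
  have h23 : s₄ 23 0 = (2 * m : ℕ) := by rw [f₄ 23 (by decide), f₃ 23 (by decide), h23]
  have he : ∀ i : Fin m, s₄ 1 i = (E i).1 ∧ s₄ 2 i = (E i).2 := fun i => by
    rw [f₄ 1 (by decide), f₃ 1 (by decide), f₄ 2 (by decide), f₃ 2 (by decide)]
    exact he i
  clear f₃ f₄ q₃ q₄
  -- the two colourings
  refine (runs_balance (M := m) h23 (by omega) hρ fun g h0 h1 => ?_).then (by omega)
    fun s₅ f₅ q₅ => ?_
  · have := hvn g h0 h1
    rw [h13, abs_of_nonneg le_rfl, abs_of_nonneg (by omega)]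
    omega
  obtain ⟨Q₁, hQ₁, q₅⟩ := q₅
  have f10 := f₅ 10 (by decide)
  have f11 := f₅ 11 (by decide)
  refine (runs_balance (M := m) (by rw [f₅ 23 (by decide), h23]) (by omega)
    (by rw [f11]; exact hρ) fun g h0 h1 => ?_).then (by omega) fun s₆ f₆ q₆ => ?_
  · have := hvn g h0 h1
    have := (q₅ g h0 h1).2.1
    rw [f10, abs_of_nonneg (by omega), abs_of_nonneg (by omega)]
    omega
  obtain ⟨Q₂, hQ₂, q₆⟩ := q₆
  rw [f11] at q₆
  rw [f10] at hQ₂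
  -- In the first round all old colours are zero, so the key is just the doubled vertex.
  have hQ₁' : PerfectPairing (2 * m : ℕ) (s₄ 10) Q₁ := ⟨hQ₁.partner, fun g g' a b c d hne e => by
    have h1 := hQ₁.partner g a b
    have h2 := hQ₁.partner g' c d
    have := hQ₁.key g g' a b c d hne
    simp only [h13] at this
    omega⟩
  have hpart : ∀ g g' : ℤ, (0 ≤ g ∧ g < (2 * m : ℕ)) → (0 ≤ g' ∧ g' < (2 * m : ℕ)) → g ≠ g' →
      s₄ 10 g = s₄ 10 g' → s₅ 13 g = s₅ 13 g' → s₆ 13 g ≠ s₆ 13 g' :=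
    fun g g' => color_ne (card_halfEdges_le hG hE hv1 hv2) hQ₁' hQ₂
      (fun g h0 h1 => ⟨(q₅ g h0 h1).2.1, (q₅ g h0 h1).2.2.2⟩)
      (fun g h0 h1 => ⟨(q₆ g h0 h1).2.1, (q₆ g h0 h1).2.2.2⟩)
  have h14 : ∀ g : ℤ, 0 ≤ g → g < (2 * m : ℕ) → s₅ 13 g = s₆ 14 g := fun g h0 h1 =>
    (q₆ g h0 h1).1.symm
  have ho : ∀ i : Fin m, (s₆ 14 i = 1 ∨ s₆ 14 i = 2) ∧ s₆ 14 (i + m) = 3 - s₆ 14 i := fun i => by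
    have := q₅ i (by omega) (by push_cast; omega)
    rw [← h14 _ (by omega) (by push_cast; omega), ← h14 _ (by omega) (by push_cast; omega), ← hρi]
    exact ⟨this.2.1, this.2.2.1⟩
  have hd : ∀ i : Fin m, (s₆ 13 i = 1 ∨ s₆ 13 i = 2) ∧ s₆ 13 (i + m) = 3 - s₆ 13 i := fun i => by
    have := q₆ i (by omega) (by push_cast; omega)
    rw [← hρi]
    exact ⟨this.2.1, this.2.2.1⟩
  have hpart : ∀ g g' : ℤ, (0 ≤ g ∧ g < (2 * m : ℕ)) → (0 ≤ g' ∧ g' < (2 * m : ℕ)) → g ≠ g' →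
      s₄ 10 g = s₄ 10 g' → s₆ 14 g = s₆ 14 g' → s₆ 13 g ≠ s₆ 13 g' := by
    intro g g' hg hg' hne hv e
    exact hpart g g' hg hg' hne hv (by rw [h14 g hg.1 hg.2, h14 g' hg'.1 hg'.2, e])
  have h21 : s₆ 21 0 = m := by rw [f₆ 21 (by decide), f₅ 21 (by decide), h21]
  have he : ∀ i : Fin m, s₆ 1 i = (E i).1 ∧ s₆ 2 i = (E i).2 := fun i => by
    rw [f₆ 1 (by decide), f₅ 1 (by decide), f₆ 2 (by decide), f₅ 2 (by decide)]
    exact he i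
  clear f₅ f₆ q₅ q₆ h14 hQ₁ hQ₂
  -- the classes, tails and heads
  refine (Runs.fill (N := m) (fun g => if s₆ 13 g = s₆ 14 g then 1 else 0) h21 (by omega)
    fun j h0 h1 => ?_).then (by omega) fun s₇ f₇ q₇ => ?_
  · refine ⟨by simp [Memory.set], ?_⟩
    split_ifs <;> simp; omega
  refine (Runs.fill (N := m) (fun g => if s₆ 14 g = 1 then s₆ 1 g else s₆ 2 g)
    (by rw [f₇ 21 (by decide), h21]) (by omega)
    fun j h0 h1 => ?_).then (by omega) fun s₈ f₈ q₈ => ?_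
  · refine ⟨by simp [Memory.set, f₇ 14 (by decide), f₇ 1 (by decide), f₇ 2 (by decide)], ?_⟩
    obtain ⟨i, rfl⟩ := exists_fin h0 h1
    have := hEn i
    split_ifs <;> [rw [(he i).1]; rw [(he i).2]] <;> rw [abs_of_nonneg (by omega)] <;> omega
  refine (Runs.fill (N := m) (fun g => if s₆ 14 g = 1 then s₆ 2 g else s₆ 1 g)
    (by rw [f₈ 21 (by decide), f₇ 21 (by decide), h21]) (by omega)
    fun j h0 h1 => ?_).then (by omega) fun s₉ f₉ q₉ => ?_
  · refine ⟨by simp [Memory.set, f₇ 14 (by decide), f₇ 1 (by decide), f₇ 2 (by decide),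
      f₈ 14 (by decide), f₈ 1 (by decide), f₈ 2 (by decide)], ?_⟩
    obtain ⟨i, rfl⟩ := exists_fin h0 h1
    have := hEn i
    split_ifs <;> [rw [(he i).2]; rw [(he i).1]] <;> rw [abs_of_nonneg (by omega)] <;> omega
  have h21' : s₉ 21 0 = m := by rw [f₉ 21 (by decide), f₈ 21 (by decide), f₇ 21 (by decide), h21]
  have h26 : ∀ i : Fin m, s₉ 26 i = if s₆ 13 i = s₆ 14 i then 1 else 0 := fun i => by
    rw [f₉ 26 (by decide), f₈ 26 (by decide), q₇ i (by omega) (by omega)]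
  have h24 : ∀ i : Fin m, s₉ 24 i = if s₆ 14 i = 1 then ((E i).1 : ℤ) else (E i).2 := fun i => by
    rw [f₉ 24 (by decide), q₈ i (by omega) (by omega), (he i).1, (he i).2]
  have h25 : ∀ i : Fin m, s₉ 25 i = if s₆ 14 i = 1 then ((E i).2 : ℤ) else (E i).1 := fun i => by
    rw [q₉ i (by omega) (by omega), (he i).1, (he i).2]
  clear f₇ f₈ f₉ q₇ q₈ q₉
  refine (Runs.write (by simp)).then (by omega) fun s₁₀ f₁₀ q₁₀ => ?_
  refine (runs_count (m := m) (by rw [f₁₀ 21 (by decide), h21']) (by omega) (by rw [q₁₀]; simp)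
    fun g h0 h1 => ?_).then (by omega) fun s₁₁ f₁₁ q₁₁ => ?_
  · obtain ⟨i, rfl⟩ := exists_fin h0 h1
    rw [f₁₀ 26 (by decide), h26]
    split_ifs <;> simp
  rw [f₁₀ 26 (by decide), ← Fin.sum_univ_eq_sum_range (fun g => s₉ 26 g)] at q₁₁
  simp only [h26] at q₁₁
  rw [Finset.sum_boole] at q₁₁
  refine (Runs.write (by
    rw [Expr.eval_not]
    split_ifs <;> simp
    omega)).then (by omega) fun s₁₂ f₁₂ q₁₂ => ?_
  have h21'' : s₁₁ 21 0 = m := by rw [f₁₁ 21 (by decide), f₁₀ 21 (by decide), h21']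
  -- Cell `9` tells which of the two classes is at least as large as the other.
  have h9 : s₁₂ 9 0 =
      if m ≤ 2 * (Finset.univ.filter fun i : Fin m => s₆ 13 i = s₆ 14 i).card then 1 else 0 := by
    rw [q₁₂]
    simp only [Expr.eval_not, Expr.eval_lt, Expr.eval_add, Expr.eval_read, Expr.eval_const, q₁₁,
      h21'', Expr.eval_zero, Function.update_self, ite_one_eq_zero]
    congr 1
    apply propext
    omega
  have h26' : ∀ i : Fin m, s₁₂ 26 i = if s₆ 13 i = s₆ 14 i then 1 else 0 := fun i => by
    rw [f₁₂ 26 (by decide), f₁₁ 26 (by decide), f₁₀ 26 (by decide), h26]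
  refine (Runs.fill (N := m) (fun g => if s₁₂ 26 g = s₁₂ 9 0 then 1 else 0)
    (by rw [f₁₂ 21 (by decide), h21'']) (by omega)
    fun j h0 h1 => ?_).mono (by omega) fun s' f' q' => ?_
  · refine ⟨by simp [Memory.set], ?_⟩
    split_ifs <;> simp; omega
  refine ⟨by rw [f' 21 (by decide), f₁₂ 21 (by decide), h21''],
    fun i => if s₆ 14 i = 1 then (E i).1 else (E i).2,
    fun i => if s₆ 14 i = 1 then (E i).2 else (E i).1,
    fun i => s₁₂ 26 i = s₁₂ 9 0, fun i => inferInstance, fun i => ⟨?_, ?_, ?_⟩, fun i => ?_, ?_, ?_, ?_⟩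
  · rw [f' 24 (by decide), f₁₂ 24 (by decide), f₁₁ 24 (by decide), f₁₀ 24 (by decide), h24]
    dsimp only
    split_ifs <;> rfl
  · rw [f' 25 (by decide), f₁₂ 25 (by decide), f₁₁ 25 (by decide), f₁₀ 25 (by decide), h25]
    dsimp only
    split_ifs <;> rfl
  · exact q' i (by omega) (by omega)
  · dsimp only [listedEdge]
    split_ifs
    · rfl
    · exact Sym2.eq_swap
  · intro i j hij e
    dsimp only at e
    by_contra hne
    have hi := ho i
    have hj := ho j
    have di := hd i
    have dj := hd j
    have vi := hv1 i
    have vi' := hv2 i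
    have vj := hv1 j
    have vj' := hv2 j
    rw [Fin.ext_iff] at hne e
    -- The tail half-edges of `i` and `j` have the same vertex and first colour. If the arcs are in
    -- the same class, they also have the same second colour, which is impossible for distinct
    -- half-edges.
    have key := hpart (if s₆ 14 i = 1 then i else i + m) (if s₆ 14 j = 1 then j else j + m)
      (by push_cast; split_ifs <;> omega) (by push_cast; split_ifs <;> omega)
      (by split_ifs <;> omega) (by split_ifs at e ⊢ <;> omega) (by split_ifs <;> omega)
    simp only [h26', h9] at hij
    split_ifs at hij key <;> omega
  · intro i j hij e
    dsimp only at e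
    by_contra hne
    have hi := ho i
    have hj := ho j
    have di := hd i
    have dj := hd j
    have vi := hv1 i
    have vi' := hv2 i
    have vj := hv1 j
    have vj' := hv2 j
    rw [Fin.ext_iff] at hne e
    have key := hpart (if s₆ 14 i = 1 then i + m else i) (if s₆ 14 j = 1 then j + m else j)
      (by push_cast; split_ifs <;> omega) (by push_cast; split_ifs <;> omega)
      (by split_ifs <;> omega) (by split_ifs at e ⊢ <;> omega) (by split_ifs <;> omega)
    simp only [h26', h9] at hij
    split_ifs at hij key <;> omega
  · simp only [h26', h9]
    have hsum := Finset.card_filter_add_card_filter_not (s := (Finset.univ : Finset (Fin m)))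
      (fun i => s₆ 13 i = s₆ 14 i)
    rw [Finset.card_univ, Fintype.card_fin] at hsum
    split_ifs with h
    · simpa only [ite_one_ne_zero, ite_eq_left_iff, zero_ne_one, imp_false, not_not] using h
    · simp only [ite_one_eq_zero]
      omega

end WordRAM

/-! ### Successor and predecessor tables -/

namespace WordRAM

/-- The arrays `o` and `ι` hold, plus one, the heads and tails of the arcs with `P` that leave and
enter a vertex; they are zero if there is no such arc. -/
structure Links {n m : ℕ} (P : Fin m → Prop) (tail head : Fin m → Fin n) (o ι : ℤ → ℤ) :
    Prop where
  out : ∀ g, P g → o (tail g) = head g + 1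
  inn : ∀ g, P g → ι (head g) = tail g + 1
  out_ne : ∀ v, o v ≠ 0 → ∃ g, P g ∧ v = tail g
  inn_ne : ∀ v, ι v ≠ 0 → ∃ g, P g ∧ v = head g

/-- The new entries overwrite none of another arc, because within a class tails and heads are
distinct. -/
theorem Links.insert {n m : ℕ} {P P' : Fin m → Prop} {tail head : Fin m → Fin n} {o ι : ℤ → ℤ}
    (h : Links P tail head o ι) (j : Fin m) (hP : ∀ g, P' g ↔ P g ∨ g = j)
    (ht : ∀ g, P g → tail g = tail j → g = j) (hh : ∀ g, P g → head g = head j → g = j) :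
    Links P' tail head (Function.update o (tail j) (head j + 1))
      (Function.update ι (head j) (tail j + 1)) where
  out g hg := by
    by_cases e : g = j
    · subst e; simp
    · have hg' := ((hP g).1 hg).resolve_right e
      rw [Function.update_of_ne]
      · exact h.out g hg'
      · intro e'
        exact e (ht g hg' (Fin.ext (by exact_mod_cast e')))
  inn g hg := by
    by_cases e : g = j
    · subst e; simp
    · have hg' := ((hP g).1 hg).resolve_right e
      rw [Function.update_of_ne]
      · exact h.inn g hg'
      · intro e'
        exact e (hh g hg' (Fin.ext (by exact_mod_cast e')))
  out_ne v hv := by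
    by_cases e : v = tail j
    · exact ⟨j, (hP j).2 (Or.inr rfl), e⟩
    · rw [Function.update_of_ne e] at hv
      obtain ⟨g, hg, hv⟩ := h.out_ne v hv
      exact ⟨g, (hP g).2 (Or.inl hg), hv⟩
  inn_ne v hv := by
    by_cases e : v = head j
    · exact ⟨j, (hP j).2 (Or.inr rfl), e⟩
    · rw [Function.update_of_ne e] at hv
      obtain ⟨g, hg, hv⟩ := h.inn_ne v hv
      exact ⟨g, (hP g).2 (Or.inl hg), hv⟩

theorem Links.congr {n m : ℕ} {P P' : Fin m → Prop} {tail head : Fin m → Fin n} {o ι : ℤ → ℤ}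
    (h : Links P tail head o ι) (hP : ∀ g, P' g ↔ P g) : Links P' tail head o ι := by
  obtain rfl : P' = P := funext fun g => propext (hP g)
  exact h

/-- Stores the arcs at each vertex. -/
def linkArcs : Program :=
  .forLoop 20 21 (.cond (.read 12 (.var 20))
    (.seq (.write 28 (.read 24 (.var 20)) (.read 25 (.var 20) + 1))
      (.write 29 (.read 25 (.var 20)) (.read 24 (.var 20) + 1)))
    (.seq (.write 30 (.read 24 (.var 20)) (.read 25 (.var 20) + 1))
      (.write 31 (.read 25 (.var 20)) (.read 24 (.var 20) + 1))))

theorem runs_linkArcs {W n m : ℕ} {s : Memory} (hm : s 21 0 = m) (hW : m + n + 1 ≤ W)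
    {tail head : Fin m → Fin n} {F : Fin m → Prop} [DecidablePred F]
    (h : ∀ i : Fin m, s 24 i = tail i ∧ s 25 i = head i ∧ s 12 i = if F i then 1 else 0)
    (ht : ∀ i j, (F i ↔ F j) → tail i = tail j → i = j)
    (hh : ∀ i j, (F i ↔ F j) → head i = head j → i = j)
    (hz : ∀ v, s 28 v = 0 ∧ s 29 v = 0 ∧ s 30 v = 0 ∧ s 31 v = 0) :
    Runs W linkArcs s m (fun s' => Links F tail head (s' 28) (s' 29) ∧
      Links (fun i => ¬ F i) tail head (s' 30) (s' 31)) := by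
  refine (Runs.forLoop (a := 20) (b := 21)
    (fun j s' => Links (fun i => F i ∧ (i : ℕ) < j) tail head (s' 28) (s' 29) ∧
      Links (fun i => ¬ F i ∧ (i : ℕ) < j) tail head (s' 30) (s' 31)) (by decide) (by decide)
    (by decide) hm (by omega) (fun _ _ _ h => h) ?_ ?_).mono le_rfl fun s' _ h => ?_
  · constructor <;> constructor <;> simp [hz]
  · intro j s' hj hfr ⟨h1, h2⟩
    have h20 : s' 20 0 = j := by rw [hfr 20 (by decide), Memory.set_same]; simp
    obtain ⟨i, hi⟩ : ∃ i : Fin m, (i : ℕ) = j := ⟨⟨j, hj⟩, rfl⟩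
    obtain ⟨e1, e2, e3⟩ := h i
    rw [hi] at e1 e2 e3
    have e1 : s' 24 j = tail i := by rw [hfr 24 (by decide)]; exact e1
    have e2 : s' 25 j = head i := by rw [hfr 25 (by decide)]; exact e2
    have e3 : s' 12 j = if F i then 1 else 0 := by rw [hfr 12 (by decide)]; exact e3
    have b1 : |(tail i : ℤ) + 1| ≤ W := by rw [abs_of_nonneg] <;> omega
    have b2 : |(head i : ℤ) + 1| ≤ W := by rw [abs_of_nonneg] <;> omega
    have hlt : ∀ g : Fin m, (g : ℕ) ≤ j ↔ (g : ℕ) < j ∨ g = i := fun g => by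
      rw [Fin.ext_iff]; omega
    simp only [Program.wp, Expr.eval_read, Expr.eval_add, Expr.eval_const, Expr.eval_one, h20, e3]
    simp [Memory.set_same, Memory.set_ne, e1, e2, b1, b2, h20]
    constructor
    · intro hF
      refine ⟨h1.insert i (fun g => ?_) (fun g hg => ht g i (by tauto))
        (fun g hg => hh g i (by tauto)), h2.congr fun g => ?_⟩
      · rw [hlt]
        constructor
        · tauto
        · rintro (h | rfl)
          · tauto
          · tauto
      · rw [hlt]
        constructor
        · rintro ⟨h, h' | rfl⟩ <;> tauto
        · tauto
    · intro hF
      refine ⟨h1.congr fun g => ?_, h2.insert i (fun g => ?_) (fun g hg => ht g i (by tauto))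
        (fun g hg => hh g i (by tauto))⟩
      · rw [hlt]
        constructor
        · rintro ⟨h, h' | rfl⟩ <;> tauto
        · tauto
      · rw [hlt]
        constructor
        · tauto
        · rintro (h | rfl)
          · tauto
          · tauto
  · exact ⟨h.1.congr fun g => by simp, h.2.congr fun g => by simp⟩

/-- `o` and `ι` hold, plus one, the successors and predecessors in a family of directed paths and
cycles on the numbers from `0` to `n - 1`. -/
structure Linked (n : ℤ) (o ι : ℤ → ℤ) : Prop where
  out : ∀ v, 0 ≤ v → v < n → o v ≠ 0 → 1 ≤ o v ∧ o v ≤ n ∧ ι (o v - 1) = v + 1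
  inn : ∀ v, 0 ≤ v → v < n → ι v ≠ 0 → 1 ≤ ι v ∧ ι v ≤ n ∧ o (ι v - 1) = v + 1

theorem Links.linked {n m : ℕ} {P : Fin m → Prop} {tail head : Fin m → Fin n} {o ι : ℤ → ℤ}
    (h : Links P tail head o ι) : Linked n o ι where
  out v _ _ hv := by
    obtain ⟨g, hg, rfl⟩ := h.out_ne v hv
    rw [h.out g hg, add_sub_cancel_right, h.inn g hg]
    omega
  inn v _ _ hv := by
    obtain ⟨g, hg, rfl⟩ := h.inn_ne v hv
    rw [h.inn g hg, add_sub_cancel_right, h.out g hg]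
    omega

end WordRAM

/-! ### Traversing paths and cycles to form blocks -/

namespace WordRAM

/-- The vertices `v` with `p v ≠ 0` have been given the positions `p v - 1 < cnt`, in blocks of
consecutive positions: the block of `v` starts at `Bs v` and has length `Ln (Bs v)`. The last block
starts at `b`; if `cur ≠ 0`, then it is to be continued with `cur - 1`. If `S`, then it may start
at a vertex with a predecessor. -/
structure BlockOrder (S : Prop) (n : ℤ) (o ι p r Bs Ln : ℤ → ℤ) (cnt b cur : ℤ) : Prop where
  nonneg : 0 ≤ b ∧ b ≤ cnt
  ord : ∀ k, 0 ≤ k → k < cnt → 0 ≤ r k ∧ r k < n ∧ p (r k) = k + 1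
  pos : ∀ v, 0 ≤ v → v < n → p v ≠ 0 → 1 ≤ p v ∧ p v ≤ cnt ∧ r (p v - 1) = v ∧ 0 ≤ Bs v ∧
    Bs v + 1 ≤ p v ∧ p v ≤ Bs v + Ln (Bs v) ∧ Bs v + Ln (Bs v) ≤ cnt
  blocks : ∀ v w, 0 ≤ v → v < n → p v ≠ 0 → 0 ≤ w → w < n → p w ≠ 0 → Bs v < Bs w →
    Bs v + Ln (Bs v) ≤ Bs w
  pred : ∀ v, 0 ≤ v → v < n → p v ≠ 0 → p v ≠ Bs v + 1 →
    ι v ≠ 0 ∧ p (ι v - 1) + 1 = p v ∧ Bs (ι v - 1) = Bs v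
  first : ∀ v, 0 ≤ v → v < n → p v = Bs v + 1 → p v ≠ 0 → ι v = 0 ∨
    (p (ι v - 1) ≠ 0 ∧ p (ι v - 1) = Bs v + Ln (Bs v) ∧ Bs (ι v - 1) = Bs v) ∨ (cur ≠ 0 ∧ Bs v = b)
  succ : ∀ v, 0 ≤ v → v < n → p v ≠ 0 → o v ≠ 0 →
    (p (o v - 1) ≠ 0 ∧ Bs (o v - 1) = Bs v ∧ (p (o v - 1) = p v + 1 ∨
      (p (o v - 1) = Bs v + 1 ∧ p v = Bs v + Ln (Bs v)))) ∨ (p v = cnt ∧ o v = cur ∧ Bs v = b)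
  walk : cur ≠ 0 → 1 ≤ cur ∧ cur ≤ n ∧ ((b = cnt ∧ p (cur - 1) = 0 ∧ (ι (cur - 1) = 0 ∨ S)) ∨
    (b < cnt ∧ Bs (r (cnt - 1)) = b ∧ b + Ln b = cnt ∧ o (r (cnt - 1)) = cur ∧
      (ι (r b) = 0 ∨ S)))
  full : S → ∀ v, 0 ≤ v → v < n → p v = 0 → o v ≠ 0

namespace BlockOrder

variable {S : Prop} {n : ℤ} {o ι p r Bs Ln : ℤ → ℤ} {cnt b cur : ℤ}

/-- Distinct positions hold distinct vertices. -/
theorem cnt_le (h : BlockOrder S n o ι p r Bs Ln cnt b cur) (hn : 0 ≤ n) : cnt ≤ n := by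
  have := Finset.card_le_card_of_injOn (s := Finset.Ico 0 cnt) (t := Finset.Ico 0 n) r
    (fun k hk => by
      rw [Finset.mem_coe, Finset.mem_Ico] at *
      have := h.ord k hk.1 hk.2
      omega)
    (fun k hk l hl e => by
      rw [Finset.mem_coe, Finset.mem_Ico] at *
      have h1 := h.ord k hk.1 hk.2
      have h2 := h.ord l hl.1 hl.2
      rw [e] at h1
      omega)
  rw [Int.card_Ico, Int.card_Ico] at this
  have := h.nonneg
  omega

theorem start (h : BlockOrder S n o ι p r Bs Ln cnt b 0) {i : ℤ} (h0 : 0 ≤ i) (hi : i < n)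
    (hp : p i = 0) (hs : ι i = 0 ∨ S) : BlockOrder S n o ι p r Bs Ln cnt cnt (i + 1) where
  nonneg := ⟨by have := h.nonneg; omega, le_rfl⟩
  ord := h.ord
  pos := h.pos
  blocks := h.blocks
  pred := h.pred
  first v h0 h1 h2 h3 := by
    rcases h.first v h0 h1 h2 h3 with h | h | h
    · exact Or.inl h
    · exact Or.inr (Or.inl h)
    · exact absurd rfl h.1
  succ v h0 h1 h2 h3 := by
    rcases h.succ v h0 h1 h2 h3 with h | h
    · exact Or.inl h
    · exact absurd h.2.1 h3
  walk _ := ⟨by omega, by omega, Or.inl ⟨rfl, by simpa using hp, by simpa using hs⟩⟩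
  full := h.full

/-- The predecessor of `cur - 1` is the vertex placed last. So `cur - 1` cannot follow another
vertex in its block; it is the first vertex of a block, and this is the current one. The walk has
closed a cycle. -/
theorem close (hl : Linked n o ι) (h : BlockOrder S n o ι p r Bs Ln cnt b cur) (hc : cur ≠ 0)
    (hp : p (cur - 1) ≠ 0) : BlockOrder S n o ι p r Bs Ln cnt b 0 := by
  obtain ⟨w1, w2, ⟨-, w3, -⟩ | ⟨w3, w4, w5, w6, w7⟩⟩ := h.walk hc
  · exact absurd w3 hp
  have hb := h.nonneg
  obtain ⟨l1, l2, l3⟩ := h.ord (cnt - 1) (by omega) (by omega)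
  obtain ⟨-, -, l4⟩ := hl.out _ l1 l2 (by omega)
  rw [w6] at l4
  have c0 := h.pos (cur - 1) (by omega) (by omega) hp
  have c1 : p (cur - 1) = Bs (cur - 1) + 1 := by
    by_contra e
    have := (h.pred (cur - 1) (by omega) (by omega) hp e).2.1
    rw [l4, add_sub_cancel_right] at this
    omega
  have c2 : Bs (cur - 1) = b := by
    rcases h.first (cur - 1) (by omega) (by omega) c1 hp with e | e | e
    · omega
    · rw [l4, add_sub_cancel_right] at e
      omega
    · exact e.2
  refine ⟨h.nonneg, h.ord, h.pos, h.blocks, h.pred, ?_, ?_, fun e => absurd rfl e, h.full⟩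
  · intro v h0 h1 h2 h3
    rcases h.first v h0 h1 h2 h3 with e | e | e
    · exact Or.inl e
    · exact Or.inr (Or.inl e)
    · have e1 := (h.pos v h0 h1 h3).2.2.1
      have e2 : v = cur - 1 := by
        rw [← e1, ← c0.2.2.1, h2, c1, e.2, c2]
      subst e2
      right; left
      rw [l4, add_sub_cancel_right, l3, c2, w4]
      exact ⟨by omega, by omega, rfl⟩
  · intro v h0 h1 h2 h3
    rcases h.succ v h0 h1 h2 h3 with e | ⟨e1, e2, e3⟩
    · exact Or.inl e
    · left
      rw [e2, c1, c2, e3, e1]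
      exact ⟨by omega, rfl, Or.inr ⟨rfl, by omega⟩⟩

/-- The vertex is appended to the last block and the walk goes on to its successor, if any. The
delicate clause is `first`: a walk that began at a vertex with a predecessor must not stop, and this
holds since by `full` unplaced vertices then have successors. -/
theorem place (hl : Linked n o ι) (h : BlockOrder S n o ι p r Bs Ln cnt b cur) (hc : cur ≠ 0)
    (hp : p (cur - 1) = 0) : BlockOrder S n o ι (Function.update p (cur - 1) (cnt + 1))
      (Function.update r cnt (cur - 1)) (Function.update Bs (cur - 1) b)
      (Function.update Ln b (cnt + 1 - b)) (cnt + 1) b (o (cur - 1)) := by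
  obtain ⟨c, rfl⟩ : ∃ c, cur = c + 1 := ⟨cur - 1, by omega⟩
  obtain ⟨w1, w2, w⟩ := h.walk hc
  simp only [add_sub_cancel_right] at hp w ⊢
  have hb := h.nonneg
  have hp' : ∀ v, p v ≠ 0 → Function.update p c (cnt + 1) v = p v := fun v hv =>
    Function.update_of_ne (by rintro rfl; exact hv hp) _ _
  have hBs' : ∀ v, p v ≠ 0 → Function.update Bs c b v = Bs v := fun v hv =>
    Function.update_of_ne (by rintro rfl; exact hv hp) _ _
  have hpc : Function.update p c (cnt + 1) c = cnt + 1 := Function.update_self _ _ _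
  have hBc : Function.update Bs c b c = b := Function.update_self _ _ _
  have hr' : ∀ k, k < cnt → Function.update r cnt c k = r k := fun k hk =>
    Function.update_of_ne (by omega) _ _
  have hrc : Function.update r cnt c cnt = c := Function.update_self _ _ _
  have hLb : Function.update Ln b (cnt + 1 - b) b = cnt + 1 - b := Function.update_self _ _ _
  have hL' : ∀ k, k ≠ b → Function.update Ln b (cnt + 1 - b) k = Ln k := fun k hk =>
    Function.update_of_ne hk _ _
  have hor : ∀ v, Function.update p c (cnt + 1) v ≠ 0 → v = c ∨ p v ≠ 0 := fun v hv => by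
    by_cases e : v = c
    · exact Or.inl e
    · rw [Function.update_of_ne e] at hv
      exact Or.inr hv
  generalize Function.update p c (cnt + 1) = p' at *
  generalize Function.update r cnt c = r' at *
  generalize Function.update Bs c b = Bs' at *
  generalize Function.update Ln b (cnt + 1 - b) = Ln' at *
  -- the last vertex of the current block
  have hlast : ∀ v, 0 ≤ v → v < n → p v ≠ 0 → Bs v = b →
      b < cnt ∧ b + Ln b = cnt ∧ (p v = cnt → o v = c + 1) ∧ (ι (r b) = 0 ∨ S) := by
    intro v h0 h1 h2 h3
    have hv := h.pos v h0 h1 h2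
    rcases w with w | w
    · omega
    · refine ⟨w.1, w.2.2.1, fun e => ?_, w.2.2.2.2⟩
      rw [← w.2.2.2.1, ← e, hv.2.2.1]
  have hle : ∀ v, 0 ≤ v → v < n → p v ≠ 0 → Bs v ≠ b → Bs v + Ln (Bs v) ≤ b := by
    intro v h0 h1 h2 h3
    have hv := h.pos v h0 h1 h2
    rcases w with w | ⟨w3, w4, w5, w6, -⟩
    · omega
    · have l := h.ord (cnt - 1) (by omega) (by omega)
      rcases lt_or_gt_of_ne h3 with h4 | h4
      · rw [← w4]
        exact h.blocks v _ h0 h1 h2 l.1 l.2.1 (by omega) (by omega)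
      · have := h.blocks _ v l.1 l.2.1 (by omega) h0 h1 h2 (by omega)
        rw [w4] at this
        omega
  -- the start of the current block
  have hstart : ∀ v, 0 ≤ v → v < n → (v = c ∧ b = cnt ∨ p v ≠ 0 ∧ Bs v = b ∧ p v = b + 1) →
      ι v = 0 ∨ o c ≠ 0 := by
    intro v h0 h1 hv
    have hS : ι v = 0 ∨ S := by
      rcases hv with ⟨rfl, hv⟩ | ⟨v1, v2, v3⟩
      · rcases w with w | w
        · exact w.2.2
        · omega
      · have := hlast v h0 h1 v1 v2
        have e := (h.pos v h0 h1 v1).2.2.1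
        rw [v3, add_sub_cancel_right] at e
        rw [← e]
        exact e ▸ this.2.2.2
    rcases hS with e | e
    · exact Or.inl e
    · exact Or.inr (h.full e c (by omega) (by omega) hp)
  refine ⟨by omega, ?_, ?_, ?_, ?_, ?_, ?_, ?_, ?_⟩
  · intro k h0 h1
    rcases eq_or_ne k cnt with rfl | hk
    · rw [hrc, hpc]; omega
    · have := h.ord k h0 (by omega)
      rw [hr' k (by omega), hp' _ (by omega)]
      exact this
  · intro v h0 h1 h2
    rcases hor v h2 with rfl | hv
    · rw [hpc, add_sub_cancel_right, hrc, hBc, hLb]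
      omega
    · have := h.pos v h0 h1 hv
      rw [hp' v hv, hBs' v hv, hr' _ (by omega)]
      by_cases e : Bs v = b
      · rw [e, hLb]; omega
      · rw [hL' _ e]; omega
  · intro v w' h0 h1 h2 h3 h4 h5 hlt
    rcases hor v h2 with rfl | hv
    · rcases hor w' h5 with rfl | hw
      · omega
      · rw [hBc, hBs' w' hw] at hlt
        have := hle w' h3 h4 hw (by omega)
        have := h.pos w' h3 h4 hw
        omega
    · rw [hBs' v hv] at hlt ⊢
      rcases hor w' h5 with rfl | hw
      · rw [hBc] at hlt ⊢
        rw [hL' _ (by omega)]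
        exact hle v h0 h1 hv (by omega)
      · rw [hBs' w' hw] at hlt ⊢
        have h6 := h.pos w' h3 h4 hw
        by_cases e : Bs v = b
        · have := hle w' h3 h4 hw (by omega)
          omega
        · rw [hL' _ e]
          exact h.blocks v w' h0 h1 hv h3 h4 hw hlt
  · intro v h0 h1 h2 h3
    rcases hor v h2 with rfl | hv
    · rw [hpc, hBc] at h3 ⊢
      rcases w with w | ⟨w3, w4, w5, w6, -⟩
      · omega
      · have l := h.ord (cnt - 1) (by omega) (by omega)
        have l' := (hl.out _ l.1 l.2.1 (by omega)).2.2
        rw [w6, add_sub_cancel_right] at l'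
        rw [l', add_sub_cancel_right, hp' _ (by omega), hBs' _ (by omega)]
        omega
    · rw [hp' v hv, hBs' v hv] at h3 ⊢
      have := h.pos v h0 h1 hv
      obtain ⟨e1, e2, e3⟩ := h.pred v h0 h1 hv h3
      rw [hp' _ (by omega), hBs' _ (by omega)]
      exact ⟨e1, e2, e3⟩
  · intro v h0 h1 h2 h3
    rcases hor v h3 with rfl | hv
    · rw [hpc, hBc] at h2
      rcases hstart v h0 h1 (Or.inl ⟨rfl, by omega⟩) with e | e
      · exact Or.inl e
      · exact Or.inr (Or.inr ⟨e, hBc⟩)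
    · rw [hp' v hv, hBs' v hv] at h2
      rw [hBs' v hv]
      by_cases e : Bs v = b
      · rcases hstart v h0 h1 (Or.inr ⟨hv, e, by omega⟩) with e' | e'
        · exact Or.inl e'
        · exact Or.inr (Or.inr ⟨e', e⟩)
      · rcases h.first v h0 h1 h2 hv with e' | ⟨e1, e2, e3⟩ | e'
        · exact Or.inl e'
        · right; left
          rw [hp' _ e1, hBs' _ e1, hL' _ e]
          exact ⟨e1, e2, e3⟩
        · exact absurd e'.2 e
  · intro v h0 h1 h2 h3
    rcases hor v h2 with rfl | hv
    · exact Or.inr ⟨hpc, rfl, hBc⟩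
    · left
      rw [hp' v hv, hBs' v hv]
      rcases h.succ v h0 h1 hv h3 with ⟨e1, e2, e3⟩ | ⟨e1, e2, e3⟩
      · rw [hp' _ e1, hBs' _ e1]
        refine ⟨e1, e2, e3.imp_right fun e => ⟨e.1, ?_⟩⟩
        by_cases e' : Bs v = b
        · have := hlast v h0 h1 hv e'
          rw [e'] at e
          have h4 := this.2.2.1 (by omega)
          rw [h4, add_sub_cancel_right] at e1
          exact absurd hp e1
        · rw [hL' _ e']; exact e.2
      · rw [e2, add_sub_cancel_right, hpc, hBc]
        exact ⟨by omega, e3.symm, Or.inl (by omega)⟩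
  · intro hc'
    obtain ⟨c1, c2, -⟩ := hl.out c (by omega) (by omega) hc'
    refine ⟨c1, c2, Or.inr ⟨by omega, ?_, by omega, ?_, ?_⟩⟩
    · rw [add_sub_cancel_right, hrc, hBc]
    · rw [add_sub_cancel_right, hrc]
    · rcases w with w | ⟨w3, -, -, -, w7⟩
      · rw [w.1, hrc]; exact w.2.2
      · rw [hr' b w3]; exact w7
  · intro hS v h0 h1 h2
    refine h.full hS v h0 h1 ?_
    by_contra e
    rw [hp' v e] at h2
    exact e h2

end BlockOrder

end WordRAM

namespace WordRAM

/-- One step of the search for blocks; a new block may start at `i` if `e` holds. -/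
def orderStep (e : Expr) : Program :=
  .cond (.var 19)
    (.cond (.read 32 (.var 19 - 1)) (.write 19 0 0)
      (.seq (.write 32 (.var 19 - 1) (.var 40 + 1))
      (.seq (.write 33 (.var 40) (.var 19 - 1))
      (.seq (.write 34 (.var 19 - 1) (.var 41))
      (.seq (.write 35 (.var 41) (.var 40 + 1 - .var 41))
      (.seq (.write 40 0 (.var 40 + 1))
      (.write 19 0 (.read 28 (.var 19 - 1)))))))))
    (.seq (.cond (.and e (.not (.read 32 (.var 20))))
        (.seq (.write 41 0 (.var 40)) (.write 19 0 (.var 20 + 1))) .skip)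
      (.write 20 0 (.var 20 + 1)))

def orderLoop (e : Expr) : Program :=
  .loop (.or (.lt (.var 20) (.read 0 0)) (.var 19)) (orderStep e)

theorem runs_orderLoop {W n : ℕ} {s : Memory} {e : Expr} {S : Prop} (hn : s 0 0 = n)
    (hW : n + 2 ≤ W) (hl : Linked n (s 28) (s 29))
    (he : ∀ s' : Memory, s' 29 = s 29 → (e.eval s' ≠ 0 ↔ s 29 (s' 20 0) = 0 ∨ S))
    (hB : BlockOrder S n (s 28) (s 29) (s 32) (s 33) (s 34) (s 35) (s 40 0) (s 41 0) 0)
    (h19 : s 19 0 = 0) (h20 : s 20 0 = 0) :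
    Runs W (orderLoop e) s (3 * n) (fun s' =>
      BlockOrder S n (s 28) (s 29) (s' 32) (s' 33) (s' 34) (s' 35) (s' 40 0) (s' 41 0) 0 ∧
        s' 19 0 = 0 ∧ ∀ v : ℤ, 0 ≤ v → v < n → s 29 v = 0 ∨ S → s' 32 v ≠ 0) := by
  -- The candidates not yet tried count twice, since trying one may begin a walk, for which the
  -- measure contains an extra one. Placing a vertex lowers the second term, and ending a walk
  -- removes the extra one. Initially the measure is at most `3 * n`.
  have key := Runs.loop (W := W) (e := .or (.lt (.var 20) (.read 0 0)) (.var 19))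
    (P := orderStep e)
    (fun μ s' => s' 0 = s 0 ∧ s' 28 = s 28 ∧ s' 29 = s 29 ∧ 0 ≤ s' 20 0 ∧ s' 20 0 ≤ n ∧
      BlockOrder S n (s 28) (s 29) (s' 32) (s' 33) (s' 34) (s' 35) (s' 40 0) (s' 41 0) (s' 19 0) ∧
      (∀ v : ℤ, 0 ≤ v → v < s' 20 0 → s 29 v = 0 ∨ S → s' 32 v ≠ 0 ∨ s' 19 0 = v + 1) ∧
      (μ : ℤ) = 2 * (n - s' 20 0) + (n - s' 40 0) + if s' 19 0 = 0 then 0 else 1) (by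
    rintro μ s' ⟨e1, e2, e3, h1, h2, hI, hD, hμ⟩ hg
    simp only [Expr.eval_or, Expr.eval_lt, Expr.eval_read, Expr.eval_const, Expr.eval_zero, e1, hn,
      ite_one_ne_zero] at hg
    have hcn := hI.cnt_le (by omega)
    have hb := hI.nonneg
    simp only [orderStep, Program.wp, Expr.eval_read, Expr.eval_const]
    refine ⟨fun hc => ⟨fun hp => ?_, fun hp => ?_⟩, fun hc => ?_⟩
    · simp only [Expr.eval_sub, Expr.eval_read, Expr.eval_const, Expr.eval_one] at hp
      have hw := hI.walk hc
      have := hI.close hl hc hp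
      rw [if_neg hc] at hμ
      simp [Memory.set_same, Memory.set_ne]
      refine ⟨μ - 1, by omega, e1, e2, e3, h1, h2, this, fun v h3 h4 h5 => ?_, by omega⟩
      rcases hD v h3 h4 h5 with h | h
      · exact Or.inl h
      · rw [h, add_sub_cancel_right] at hp
        exact Or.inl hp
    · simp only [Expr.eval_sub, Expr.eval_read, Expr.eval_const, Expr.eval_one] at hp
      have hw := hI.walk hc
      have := hI.place hl hc hp
      have hcn' := this.cnt_le (by omega)
      have ho := hl.out (s' 19 0 - 1) (by omega) (by omega)
      rw [if_neg hc] at hμ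
      simp [Memory.set_same, Memory.set_ne, e2]
      refine ⟨by rw [abs_le]; omega, by rw [abs_le]; omega, by rw [abs_le]; omega,
        by rw [abs_le]; omega, by rw [abs_le]; omega, ?_,
        (2 * (n - s' 20 0) + (n - (s' 40 0 + 1)) +
          if s 28 (s' 19 0 - 1) = 0 then 0 else 1).toNat, ?_, e1, e3, h1, h2, this,
          fun v h3 h4 h5 => ?_, ?_⟩
      · by_cases h0 : s 28 (s' 19 0 - 1) = 0
        · rw [h0]; simp
        · have := ho h0
          rw [abs_le]; omega
      · split_ifs <;> omega
      · left
        rcases hD v h3 h4 h5 with h | h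
        · rw [Function.update_of_ne]
          · exact h
          · rintro rfl; exact h hp
        · rw [h, add_sub_cancel_right, Function.update_self]
          omega
      · split_ifs <;> omega
    · have hlt : s' 20 0 < n := hg.resolve_right (by simp [hc])
      have he' := he s' e3
      rw [if_pos hc] at hμ
      rw [hc] at hI hD
      constructor
      · intro hq
        rw [Expr.and_ne_zero, Expr.not_ne_zero] at hq
        have := hI.start h1 hlt hq.2 (he'.1 hq.1)
        simp [Memory.set_same, Memory.set_ne]
        refine ⟨by rw [abs_le]; omega, by rw [abs_le]; omega, μ - 1, by omega, e1, e2, e3,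
          by omega, hlt, this, fun v h3 h4 h5 => ?_, ?_⟩
        · rcases eq_or_ne v (s' 20 0) with rfl | hne
          · exact Or.inr rfl
          · rcases hD v h3 (by omega) h5 with h | h
            · exact Or.inl h
            · omega
        · rw [if_neg (by omega)]; omega
      · intro hq
        have hq : e.eval s' ≠ 0 → s' 32 (s' 20 0) ≠ 0 := fun h h' =>
          Expr.and_ne_zero.2 ⟨h, (Expr.not_ne_zero (s := s') (e := .read 32 (.var 20))).2 h'⟩ hq
        simp [Memory.set_same, Memory.set_ne, hc]
        refine ⟨by rw [abs_le]; omega, μ - 2, by omega, e1, e2, e3, by omega, hlt, hI,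
          fun v h3 h4 h5 => ?_, by omega⟩
        rcases eq_or_ne v (s' 20 0) with rfl | hne
        · exact Or.inl (hq (he'.2 h5))
        · exact hD v h3 (by omega) h5)
    (μ := 2 * n + (n - s 40 0).toNat) (s := s)
    ⟨rfl, rfl, rfl, by omega, by omega, by rw [h19]; exact hB, by omega, by
      have := hB.cnt_le (by omega)
      rw [h19, h20, if_pos rfl]; push_cast; omega⟩
  have := hB.nonneg
  refine Runs.mono key (by omega) ?_
  rintro s' - ⟨hg, μ, e1, e2, e3, h1, h2, hI, hD, -⟩
  simp only [Expr.eval_or, Expr.eval_lt, Expr.eval_read, Expr.eval_const, Expr.eval_zero, e1, hn,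
    ite_one_ne_zero, ite_one_eq_zero, not_or, not_not] at hg
  rw [hg.2] at hI hD
  refine ⟨hI, hg.2, fun v h3 h4 h5 => ?_⟩
  rcases hD v h3 (by omega) h5 with h | h
  · exact h
  · omega

/-- When all paths have been dealt with, only cycles are left. -/
theorem BlockOrder.cycles {n : ℤ} {o ι p r Bs Ln : ℤ → ℤ} {cnt b : ℤ}
    (hl : Linked n o ι) (h : BlockOrder False n o ι p r Bs Ln cnt b 0)
    (hp : ∀ v : ℤ, 0 ≤ v → v < n → ι v = 0 → p v ≠ 0) :
    BlockOrder True n o ι p r Bs Ln cnt b 0 := by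
  refine ⟨h.nonneg, h.ord, h.pos, h.blocks, h.pred, h.first, h.succ, fun e => absurd rfl e, ?_⟩
  intro _ v h0 h1 h2
  have hU : ∀ u ∈ (Finset.Ico 0 n).filter (fun v => p v = 0), 0 ≤ u ∧ u < n ∧ p u = 0 ∧
      1 ≤ ι u ∧ ι u ≤ n ∧ o (ι u - 1) = u + 1 := by
    intro u hu
    simp only [Finset.mem_filter, Finset.mem_Ico] at hu
    have h3 : ι u ≠ 0 := fun e => hp u hu.1.1 hu.1.2 e hu.2
    exact ⟨hu.1.1, hu.1.2, hu.2, hl.inn u hu.1.1 hu.1.2 h3⟩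
  -- The predecessor of an unplaced vertex is unplaced, so the predecessor map is an injective
  -- self-map of the finite set of unplaced vertices. Being surjective, it exhibits each of them as
  -- a predecessor.
  obtain ⟨u, hu, e⟩ := Finset.surj_on_of_inj_on_of_card_le
    (s := (Finset.Ico 0 n).filter fun v => p v = 0)
    (t := (Finset.Ico 0 n).filter fun v => p v = 0) (fun u _ => ι u - 1) (by
      intro u hu
      obtain ⟨u0, u1, u2, u3, u4, u5⟩ := hU u hu
      simp only [Finset.mem_filter, Finset.mem_Ico]
      refine ⟨by omega, ?_⟩
      by_contra hne
      rcases h.succ (ι u - 1) (by omega) (by omega) hne (by omega) with e | e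
      · rw [u5, add_sub_cancel_right] at e
        exact e.1 u2
      · omega) (by
      intro u u' hu hu' e
      have e1 := (hU u hu).2.2.2.2.2
      have e2 := (hU u' hu').2.2.2.2.2
      rw [e] at e1
      omega) le_rfl v (by simp [h0, h1, h2])
  have := hU u hu
  rw [e, this.2.2.2.2.2]
  omega

/-- Determines the blocks: the arrays `32` and `33` hold the positions, plus one, and the vertices
at the positions, and the arrays `34` and `35` the blocks of the vertices and their lengths. -/
def orderBlocks : Program :=
  .seq (.write 19 0 0) (.seq (.write 20 0 0) (.seq (orderLoop (.not (.read 29 (.var 20))))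
    (.seq (.write 20 0 0) (orderLoop 1))))

theorem runs_orderBlocks {W n : ℕ} {s : Memory} (hn : s 0 0 = n) (hW : n + 2 ≤ W)
    (hl : Linked n (s 28) (s 29)) (hz : ∀ v, s 32 v = 0) (h40 : s 40 0 = 0) (h41 : s 41 0 = 0) :
    Runs W orderBlocks s (6 * n) (fun s' => (∃ cnt b,
      BlockOrder True n (s 28) (s 29) (s' 32) (s' 33) (s' 34) (s' 35) cnt b 0) ∧
        ∀ v : ℤ, 0 ≤ v → v < n → s' 32 v ≠ 0) := by
  refine (Runs.write (by simp)).then (by omega) fun s₁ f₁ q₁ => ?_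
  refine (Runs.write (by simp)).then (by omega) fun s₂ f₂ q₂ => ?_
  have h28 : s₂ 28 = s 28 := by rw [f₂ 28 (by decide), f₁ 28 (by decide)]
  have h29 : s₂ 29 = s 29 := by rw [f₂ 29 (by decide), f₁ 29 (by decide)]
  have h0 : s₂ 0 = s 0 := by rw [f₂ 0 (by decide), f₁ 0 (by decide)]
  refine (runs_orderLoop (n := n) (S := False) (by rw [h0, hn]) hW (by rw [h28, h29]; exact hl)
    ?_ ?_ ?_ ?_).then (by omega) fun s₃ f₃ q₃ => ?_
  · intro s' h
    simp [h]
  · rw [f₂ 40 (by decide), f₁ 40 (by decide), f₂ 41 (by decide), f₁ 41 (by decide), h40, h41,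
      f₂ 32 (by decide), f₁ 32 (by decide)]
    constructor <;> simp [hz]; omega
  · rw [f₂ 19 (by decide), q₁]; simp
  · rw [q₂]; simp
  obtain ⟨hB, h19, hp⟩ := q₃
  rw [h28, h29] at hB
  rw [h29] at hp
  have hB := hB.cycles hl fun v h0 h1 h2 => hp v h0 h1 (Or.inl h2)
  refine (Runs.write (by simp)).then (by omega) fun s₄ f₄ q₄ => ?_
  have h28' : s₄ 28 = s 28 := by rw [f₄ 28 (by decide), f₃ 28 (by decide), h28]
  have h29' : s₄ 29 = s 29 := by rw [f₄ 29 (by decide), f₃ 29 (by decide), h29]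
  refine (runs_orderLoop (n := n) (S := True) ?_ hW (by rw [h28', h29']; exact hl)
    ?_ ?_ ?_ ?_).mono (by omega) fun s' f' q' => ?_
  · rw [f₄ 0 (by decide), f₃ 0 (by decide), h0, hn]
  · intro s' h
    simp
  · rw [h28', h29', f₄ 32 (by decide), f₄ 33 (by decide), f₄ 34 (by decide), f₄ 35 (by decide),
      f₄ 40 (by decide), f₄ 41 (by decide)]
    exact hB
  · rw [f₄ 19 (by decide), h19]
  · rw [q₄]; simp
  · obtain ⟨hB, -, hp⟩ := q'
    rw [h28', h29'] at hB
    exact ⟨⟨_, _, hB⟩, fun v h0 h1 => hp v h0 h1 (Or.inr trivial)⟩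

end WordRAM

/-! ### Blocks, starts and turns in memory -/

namespace WordRAM

theorem Expr.and_eq_zero {s : Memory} {e f : Expr} :
    (and e f).eval s = 0 ↔ ¬ (e.eval s ≠ 0 ∧ f.eval s ≠ 0) := by
  rw [← and_ne_zero, not_not]

/-- The blocks that have been found by `orderBlocks`. -/
def blockArcs {n m : ℕ} {tail head : Fin m → Fin n} {F : Fin m → Prop} {o ι p r Bs Ln : ℤ → ℤ}
    {cnt b : ℤ} (hl : Links F tail head o ι) (h : BlockOrder True n o ι p r Bs Ln cnt b 0)
    (hp : ∀ v : ℤ, 0 ≤ v → v < n → p v ≠ 0)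
    (hd : ∀ i j, i ≠ j → s(tail i, head i) ≠ s(tail j, head j)) (hne : ∀ i, tail i ≠ head i)
    (ht : ∀ i j, (F i ↔ F j) → tail i = tail j → i = j)
    (hh : ∀ i j, (F i ↔ F j) → head i = head j → i = j) : ArcBlocks n m where
  tail := tail
  head := head
  F := F
  pos v := p v - 1
  base v := Bs v
  len := Ln
  distinct := hd
  ne := hne
  tail_inj := ht
  head_inj := hh
  pos_inj v w e := by
    have hv := h.pos v (by omega) (by omega) (hp v (by omega) (by omega))
    have hw := h.pos w (by omega) (by omega) (hp w (by omega) (by omega))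
    simp only at e
    rw [e, hw.2.2.1] at hv
    exact Fin.ext (by omega)
  mem_block v := by
    have hv := h.pos v (by omega) (by omega) (hp v (by omega) (by omega))
    omega
  blocks v w := h.blocks v w (by omega) (by omega) (hp v (by omega) (by omega)) (by omega)
    (by omega) (hp w (by omega) (by omega))
  arc i hi := by
    have h1 := hl.out i hi
    have hs := h.succ (tail i) (by omega) (by omega) (hp _ (by omega) (by omega)) (by omega)
    rw [h1, add_sub_cancel_right] at hs
    rcases hs with hs | hs
    · exact ⟨hs.2.1, by omega⟩
    · omega
  pred v hv := by
    obtain ⟨h1, h2, -⟩ := h.pred v (by omega) (by omega) (hp v (by omega) (by omega))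
      (fun e => hv (by omega))
    obtain ⟨i, hi, e⟩ := hl.inn_ne v h1
    have h3 := hl.inn i hi
    rw [← e] at h3
    rw [h3, add_sub_cancel_right] at h2
    exact ⟨i, hi, Fin.ext (by omega), by omega⟩
  full v q h0 h1 := by
    have hv := h.pos v (by omega) (by omega) (hp v (by omega) (by omega))
    obtain ⟨r0, r1, r2⟩ := h.ord q (by omega) (by omega)
    obtain ⟨w, hw⟩ := exists_fin r0 r1
    exact ⟨w, by rw [← hw, r2]; omega⟩

/-- Marks a vertex in each block: `for v := 0 to n - 1 do if e then A[base[v]] := pos[v] + 1`. -/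
def markBlocks (A : ℕ) (e : Expr) : Program :=
  .forLoop 20 0 (.cond e (.write A (.read 34 (.var 20)) (.read 32 (.var 20))) .skip)

/-- Later candidates overwrite earlier ones, so any candidate of the block may remain. An entry
keeps its initial value zero only if the block has no candidate. -/
theorem runs_markBlocks {W n A : ℕ} {e : Expr} {s : Memory} (I : Fin n → Prop) (hn : s 0 0 = n)
    (hW : n ≤ W) (he : ∀ v : Fin n, e.eval (s.set 20 0 v) ≠ 0 ↔ I v)
    (hp : ∀ v : Fin n, |s 32 v| ≤ W) (hz : ∀ b, s A b = 0) (hA : A ∉ e.reads := by decide)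
    (h0 : A ≠ 0 := by decide) (h20 : A ≠ 20 := by decide) (h32 : A ≠ 32 := by decide)
    (h34 : A ≠ 34 := by decide) :
    Runs W (markBlocks A e) s n (fun s' => ∀ b,
      (s' A b = 0 ∧ ∀ w : Fin n, s 34 w = b → ¬ I w) ∨
        ∃ w : Fin n, s 34 w = b ∧ s' A b = s 32 w ∧ I w) := by
  refine (Runs.forLoop (a := 20) (b := 0) (fun j s' => ∀ b,
      (s' A b = 0 ∧ ∀ w : Fin n, (w : ℕ) < j → s 34 w = b → ¬ I w) ∨
        ∃ w : Fin n, s 34 w = b ∧ s' A b = s 32 w ∧ I w) (by decide)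
      (by simpa [Program.writes] using h20.symm) (by simpa [Program.writes] using h0.symm) hn hW
      (fun _ _ _ h => by rwa [Memory.set_ne _ h20]) ?_ ?_).mono le_rfl fun s' _ h b => ?_
  · intro b
    exact Or.inl ⟨hz b, fun w hw => absurd hw (Nat.not_lt_zero _)⟩
  · intro j s' hj hfr hI
    obtain ⟨v, rfl⟩ : ∃ v : Fin n, (v : ℕ) = j := ⟨⟨j, hj⟩, rfl⟩
    simp only [Program.writes, List.append_nil, List.mem_singleton] at hfr
    have e1 : e.eval s' = e.eval (s.set 20 0 v) :=
      e.eval_congr fun x hx => hfr x (by rintro rfl; exact hA hx)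
    have h20' : s' 20 0 = v := by rw [hfr 20 h20.symm, Memory.set_same]; simp
    have h32' : s' 32 = s 32 := by rw [hfr 32 h32.symm, Memory.set_ne _ (by decide)]
    have h34' : s' 34 = s 34 := by rw [hfr 34 h34.symm, Memory.set_ne _ (by decide)]
    simp only [Program.wp, Expr.eval_read, Expr.eval_const, h20', h32', h34', Memory.set_same, e1]
    constructor
    · intro hv
      rw [he] at hv
      refine ⟨hp v, fun b => ?_⟩
      by_cases hb : b = s 34 v
      · right
        exact ⟨v, hb.symm, by rw [hb, Function.update_self], hv⟩
      · rw [Function.update_of_ne hb]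
        rcases hI b with ⟨h1, h2⟩ | h
        · left
          refine ⟨h1, fun w hw hwb => ?_⟩
          by_cases hwv : w = v
          · subst hwv; exact absurd hwb.symm hb
          · exact h2 w (lt_of_le_of_ne (Nat.lt_succ_iff.1 hw) fun e => hwv (Fin.ext e)) hwb
        · exact Or.inr h
    · intro hv
      have hv : ¬ I v := fun h => (he v).2 h hv
      intro b
      rcases hI b with ⟨h1, h2⟩ | h
      · left
        refine ⟨h1, fun w hw hwb => ?_⟩
        by_cases hwv : w = v
        · subst hwv; exact hv
        · exact h2 w (lt_of_le_of_ne (Nat.lt_succ_iff.1 hw) fun e => hwv (Fin.ext e)) hwb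
      · exact Or.inr h
  · exact (h b).imp_left fun h => ⟨h.1, fun w => h.2 w w.2⟩

/-- The memory holds the rotated blocks `R`. -/
structure Represents {n m : ℕ} (R : RotatedBlocks n m) (s : Memory) : Prop where
  size : s 0 0 = n ∧ s 21 0 = m
  tail : ∀ i : Fin m, s 24 i = R.tail i
  head : ∀ i : Fin m, s 25 i = R.head i
  F : ∀ i : Fin m, s 12 i ≠ 0 ↔ R.F i
  pos : ∀ v : Fin n, s 32 v = R.pos v + 1
  ord : ∀ v : Fin n, s 33 (R.pos v) = v
  base : ∀ v : Fin n, s 34 v = R.base v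
  len : s 35 = R.len
  S : s 36 = R.S
  T : s 37 = R.T
  links : Links (fun i => ¬ R.F i) R.tail R.head (s 30) (s 31)
  bounds : ∀ v, 0 ≤ R.base v ∧ R.base v + R.len (R.base v) ≤ n

theorem Represents.congr {n m : ℕ} {R : RotatedBlocks n m} {s s' : Memory} (h : Represents R s)
    (hs : ∀ a ∈ [0, 21, 24, 25, 12, 32, 33, 34, 35, 36, 37, 30, 31], s' a = s a) :
    Represents R s' := by
  simp only [List.forall_mem_cons, List.not_mem_nil, false_imp_iff, implies_true, and_true] at hs
  obtain ⟨e1, e2, e3, e4, e5, e6, e7, e8, e9, e10, e11, e12, e13⟩ := hs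
  constructor
  · rw [e1, e2]; exact h.size
  · rw [e3]; exact h.tail
  · rw [e4]; exact h.head
  · rw [e5]; exact h.F
  · rw [e6]; exact h.pos
  · rw [e7]; exact h.ord
  · rw [e8]; exact h.base
  · rw [e9]; exact h.len
  · rw [e10]; exact h.S
  · rw [e11]; exact h.T
  · rw [e12, e13]; exact h.links
  · exact h.bounds

/-- The vertex `v` may serve as a start. -/
def startTest : Expr :=
  .or (.not (.read 29 (.var 20))) (.and (.read 29 (.read 33 (.read 34 (.var 20))))
    (.not (.and (.read 30 (.var 20))
      (.eq (.read 34 (.read 30 (.var 20) - 1)) (.read 34 (.var 20))))))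

/-- The vertex `v` may serve as a turn. -/
def turnTest : Expr :=
  .or (.not (.read 28 (.var 20))) (.and (.read 29 (.read 33 (.read 34 (.var 20))))
    (.not (.and (.read 31 (.var 20))
      (.eq (.read 34 (.read 31 (.var 20) - 1)) (.read 34 (.var 20))))))

/-- Determines the blocks and chooses their starts and turns. -/
def findBlocks : Program :=
  .seq linkArcs (.seq orderBlocks (.seq (markBlocks 36 startTest) (markBlocks 37 turnTest)))

theorem runs_findBlocks {W n m : ℕ} {s : Memory} (hn : s 0 0 = n) (hm : s 21 0 = m)
    (hW : m + n + 2 ≤ W) {tail head : Fin m → Fin n} {F : Fin m → Prop} [DecidablePred F]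
    (h : ∀ i : Fin m, s 24 i = tail i ∧ s 25 i = head i ∧ s 12 i = if F i then 1 else 0)
    (hd : ∀ i j, i ≠ j → s(tail i, head i) ≠ s(tail j, head j)) (hne : ∀ i, tail i ≠ head i)
    (ht : ∀ i j, (F i ↔ F j) → tail i = tail j → i = j)
    (hh : ∀ i j, (F i ↔ F j) → head i = head j → i = j)
    (hz : ∀ a ∈ [28, 29, 30, 31, 32, 36, 37, 40, 41], ∀ v, s a v = 0) :
    Runs W findBlocks s (m + 8 * n) (fun s' => ∃ R : RotatedBlocks n m, R.tail = tail ∧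
      R.head = head ∧ R.F = F ∧ Represents R s') := by
  simp only [List.forall_mem_cons, List.not_mem_nil, false_imp_iff, implies_true, and_true] at hz
  obtain ⟨z1, z2, z3, z4, z5, z6, z7, z8, z9⟩ := hz
  refine (runs_linkArcs (m := m) hm (by omega) h ht hh
    fun v => ⟨z1 v, z2 v, z3 v, z4 v⟩).then (by omega) fun s₁ f₁ ⟨l₁, l₂⟩ => ?_
  refine (runs_orderBlocks (n := n) (by rw [f₁ 0 (by decide), hn]) (by omega) l₁.linked
    (by rw [f₁ 32 (by decide)]; exact z5) (by rw [f₁ 40 (by decide)]; exact z8 _)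
    (by rw [f₁ 41 (by decide)]; exact z9 _)).then (by omega) fun s₂ f₂ ⟨⟨cnt, b, hB⟩, hp⟩ => ?_
  obtain ⟨A, hA⟩ : ∃ A, A = blockArcs l₁ hB hp hd hne ht hh := ⟨_, rfl⟩
  have hpos : ∀ v, A.pos v = s₂ 32 v - 1 := fun v => by rw [hA]; rfl
  have hbase : ∀ v, A.base v = s₂ 34 v := fun v => by rw [hA]; rfl
  have htail : A.tail = tail := by rw [hA]; rfl
  have hhead : A.head = head := by rw [hA]; rfl
  have hF : A.F = F := by rw [hA]; rfl
  have hlen : A.len = s₂ 35 := by rw [hA]; rfl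
  have hcnt := hB.cnt_le (by omega)
  have hbd := fun v : Fin n => hB.pos v (by omega) (by omega) (hp v (by omega) (by omega))
  have h28 : s₂ 28 = s₁ 28 := f₂ 28 (by decide)
  have h29 : s₂ 29 = s₁ 29 := f₂ 29 (by decide)
  have h30 : s₂ 30 = s₁ 30 := f₂ 30 (by decide)
  have h31 : s₂ 31 = s₁ 31 := f₂ 31 (by decide)
  -- A block is a cycle if and only if the vertex in its first position has a predecessor, so one
  -- lookup decides.
  have hcyc : ∀ v, s₁ 29 (s₂ 33 (s₂ 34 (v : Fin n))) ≠ 0 ↔ A.Cyclic (A.base v) := by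
    intro v
    have hv := hbd v
    obtain ⟨r0, r1, r2⟩ := hB.ord (s₂ 34 v) (by omega) (by omega)
    obtain ⟨w, hw⟩ := exists_fin r0 r1
    rw [hw] at r2 ⊢
    simp only [ArcBlocks.Cyclic, hF, hhead, hpos, hbase]
    constructor
    · intro h0
      obtain ⟨i, hi, e⟩ := l₁.inn_ne w h0
      exact ⟨i, hi, by rw [← e, r2]; omega⟩
    · rintro ⟨i, hi, e⟩
      have e1 := (hbd (head i)).2.2.1
      have e2 := (hbd w).2.2.1
      rw [e] at e1
      rw [r2, add_sub_cancel_right, e1] at e2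
      rw [← e2, l₁.inn i hi]
      omega
  have hs : ∀ v : Fin n, startTest.eval (s₂.set 20 0 v) ≠ 0 ↔ A.IsStart v := by
    intro v
    have h1 : s₁ 29 v = 0 ↔ ¬ ∃ i, F i ∧ head i = v := by
      constructor
      · rintro e ⟨i, hi, rfl⟩
        rw [l₁.inn i hi] at e; omega
      · intro h0
        by_contra e
        obtain ⟨i, hi, e⟩ := l₁.inn_ne v e
        exact h0 ⟨i, hi, Fin.ext (by omega)⟩
    have h2 : (s₁ 30 v ≠ 0 ∧ s₂ 34 (s₁ 30 v - 1) = s₂ 34 v) ↔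
        ∃ i, ¬ F i ∧ tail i = v ∧ A.base (head i) = A.base v := by
      simp only [hbase]
      constructor
      · rintro ⟨h0, h1⟩
        obtain ⟨i, hi, e⟩ := l₂.out_ne v h0
        rw [e, l₂.out i hi, add_sub_cancel_right] at h1
        exact ⟨i, hi, Fin.ext (by omega), by rw [h1, e]⟩
      · rintro ⟨i, hi, rfl, e⟩
        rw [l₂.out i hi, add_sub_cancel_right]
        exact ⟨by omega, e⟩
    simp only [startTest, Expr.or_ne_zero, Expr.and_ne_zero, Expr.not_ne_zero, Expr.and_eq_zero,
      Expr.eq_ne_zero, Expr.eval_read, Expr.eval_sub, Expr.eval_one, Expr.eval_const, Memory.set_same,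
      Memory.set_ne _ (by decide : 29 ≠ 20), Memory.set_ne _ (by decide : 30 ≠ 20),
      Memory.set_ne _ (by decide : 33 ≠ 20), Memory.set_ne _ (by decide : 34 ≠ 20),
      Function.update_self, h29, h30, h1, h2, hcyc]
    simp only [ArcBlocks.IsStart, hF, htail, hhead]
  have hpW : ∀ v : Fin n, |s₂ 32 v| ≤ W := fun v => by have := hbd v; rw [abs_le]; omega
  refine (runs_markBlocks (n := n) (A := 36) A.IsStart (by rw [f₂ 0 (by decide), f₁ 0 (by decide), hn])
    (by omega) hs hpW
    (by rw [f₂ 36 (by decide), f₁ 36 (by decide)]; exact z6)).then (by omega) fun s₃ f₃ hS => ?_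
  have e32 : s₃ 32 = s₂ 32 := f₃ 32 (by decide)
  have e34 : s₃ 34 = s₂ 34 := f₃ 34 (by decide)
  have ht' : ∀ v : Fin n, turnTest.eval (s₃.set 20 0 v) ≠ 0 ↔ A.IsTurn v := by
    intro v
    have h1 : s₁ 28 v = 0 ↔ ¬ ∃ i, F i ∧ tail i = v := by
      constructor
      · rintro e ⟨i, hi, rfl⟩
        rw [l₁.out i hi] at e; omega
      · intro h0
        by_contra e
        obtain ⟨i, hi, e⟩ := l₁.out_ne v e
        exact h0 ⟨i, hi, Fin.ext (by omega)⟩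
    have h2 : (s₁ 31 v ≠ 0 ∧ s₂ 34 (s₁ 31 v - 1) = s₂ 34 v) ↔
        ∃ i, ¬ F i ∧ head i = v ∧ A.base (tail i) = A.base v := by
      simp only [hbase]
      constructor
      · rintro ⟨h0, h1⟩
        obtain ⟨i, hi, e⟩ := l₂.inn_ne v h0
        rw [e, l₂.inn i hi, add_sub_cancel_right] at h1
        exact ⟨i, hi, Fin.ext (by omega), by rw [h1, e]⟩
      · rintro ⟨i, hi, rfl, e⟩
        rw [l₂.inn i hi, add_sub_cancel_right]
        exact ⟨by omega, e⟩
    simp only [turnTest, Expr.or_ne_zero, Expr.and_ne_zero, Expr.not_ne_zero, Expr.and_eq_zero,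
      Expr.eq_ne_zero, Expr.eval_read, Expr.eval_sub, Expr.eval_one, Expr.eval_const, Memory.set_same,
      Memory.set_ne _ (by decide : 29 ≠ 20), Memory.set_ne _ (by decide : 31 ≠ 20),
      Memory.set_ne _ (by decide : 28 ≠ 20),
      Memory.set_ne _ (by decide : 33 ≠ 20), Memory.set_ne _ (by decide : 34 ≠ 20),
      Function.update_self, h28, h29, h31, f₃ 28 (by decide), f₃ 29 (by decide), f₃ 31 (by decide),
      f₃ 33 (by decide), e34, h1, h2, hcyc]
    simp only [ArcBlocks.IsTurn, hF, htail, hhead]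
  refine (runs_markBlocks (n := n) (A := 37) (s := s₃) A.IsTurn
    (by rw [f₃ 0 (by decide), f₂ 0 (by decide), f₁ 0 (by decide), hn]) (by omega) ht'
    (by rwa [e32])
    (by rw [f₃ 37 (by decide), f₂ 37 (by decide), f₁ 37 (by decide)]; exact z7)).mono
      (by omega) fun s₄ f₄ hT => ?_
  rw [e32, e34] at hT
  have e36 : s₄ 36 = s₃ 36 := f₄ 36 (by decide)
  have hpc : ∀ v, A.pos v + 1 = s₂ 32 v := fun v => by rw [hpos]; ring
  refine ⟨{ A with S := s₄ 36, T := s₄ 37, start := ?_, turn := ?_, pos_nonneg := ?_ },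
    htail, hhead, hF, ?_⟩
  · intro v
    simp only [e36, hpc, hbase]
    rcases hS (s₂ 34 v) with h | ⟨w, h1, h2, h3⟩
    · exact Or.inl h
    · exact Or.inr ⟨w, h1, h2, h3⟩
  · intro v
    simp only [hpc, hbase]
    rcases hT (s₂ 34 v) with h | ⟨w, h1, h2, h3⟩
    · exact Or.inl h
    · exact Or.inr ⟨w, h1, h2, h3⟩
  · intro v
    have := hbd v
    have := hpc v
    omega
  · have k1 : ∀ a ∉ Program.writes (markBlocks 37 turnTest) ++ (markBlocks 36 startTest).writes,
        s₄ a = s₂ a := fun a ha => by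
      rw [List.mem_append, not_or] at ha
      rw [f₄ a ha.1, f₃ a ha.2]
    have k2 : ∀ a ∉ (Program.writes (markBlocks 37 turnTest) ++ (markBlocks 36 startTest).writes) ++
        orderBlocks.writes, s₄ a = s₁ a := fun a ha => by
      rw [List.mem_append, not_or] at ha
      rw [k1 a ha.1, f₂ a ha.2]
    have k3 : ∀ a ∉ ((Program.writes (markBlocks 37 turnTest) ++ (markBlocks 36 startTest).writes) ++
        orderBlocks.writes) ++ linkArcs.writes, s₄ a = s a := fun a ha => by
      rw [List.mem_append, not_or] at ha
      rw [k2 a ha.1, f₁ a ha.2]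
    constructor
    · rw [k3 0 (by decide), k3 21 (by decide)]; exact ⟨hn, hm⟩
    · rw [k3 24 (by decide)]; simp only [htail]; exact fun i => (h i).1
    · rw [k3 25 (by decide)]; simp only [hhead]; exact fun i => (h i).2.1
    · rw [k3 12 (by decide)]; simp only [hF]
      intro i
      rw [(h i).2.2, ite_one_ne_zero]
    · rw [k1 32 (by decide)]
      exact fun v => (hpc v).symm
    · rw [k1 33 (by decide)]
      intro v
      simp only [hpos]
      exact (hbd v).2.2.1
    · rw [k1 34 (by decide)]
      exact fun v => (hbase v).symm
    · rw [k1 35 (by decide)]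
      exact hlen.symm
    · rfl
    · rfl
    · rw [k2 30 (by decide), k2 31 (by decide)]
      simp only [hF, htail, hhead]
      exact l₂
    · intro v
      have := hbd v
      simp only [hbase, hlen]
      omega

end WordRAM

/-! ### Computing the coordinates of the vertices -/

namespace WordRAM

/-- `Runs.fill` for an array with `n` entries. -/
theorem Runs.fillFin {W n : ℕ} {a b A : ℕ} {e f g : Expr} {s : Memory} (φ : Fin n → ℤ)
    (hn : s b 0 = n) (hnW : n ≤ W)
    (hφ : ∀ v : Fin n,
      (if e.eval (s.set a 0 v) ≠ 0 then f.eval (s.set a 0 v) else g.eval (s.set a 0 v)) = φ v ∧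
        |φ v| ≤ W)
    (hab : a ≠ b := by decide) (hAa : A ≠ a := by decide) (hAb : A ≠ b := by decide)
    (hA : A ∉ e.reads ++ f.reads ++ g.reads := by decide) :
    Runs W (.fill a b A e f g) s n (fun s' => ∀ v : Fin n, s' A v = φ v) := by
  refine (Runs.fill (fun j => if e.eval (s.set a 0 j) ≠ 0 then f.eval (s.set a 0 j)
      else g.eval (s.set a 0 j)) hn hnW (fun j h0 h1 => ⟨rfl, ?_⟩) hab hAa hAb hA).mono le_rfl
    fun s' _ h v => ?_
  · obtain ⟨v, rfl⟩ := exists_fin h0 h1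
    rw [(hφ v).1]
    exact (hφ v).2
  · rw [h v (by omega) (by omega), (hφ v).1]

section

variable {n m : ℕ} {R : RotatedBlocks n m} {s : Memory}

theorem Represents.mem (h : Represents R s) (v : Fin n) : 0 ≤ R.base v ∧ R.base v ≤ R.pos v ∧
    R.pos v < R.base v + R.len (R.base v) ∧ R.base v + R.len (R.base v) ≤ n ∧
    0 ≤ R.S (R.base v) ∧ R.S (R.base v) ≤ n ∧ 0 ≤ R.T (R.base v) ∧ R.T (R.base v) ≤ n := by
  have h1 := h.bounds v
  have h2 := R.mem_block v
  refine ⟨by omega, by omega, by omega, by omega, ?_⟩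
  constructor
  · rcases R.start v with h3 | ⟨w, h3, h4, -⟩
    · omega
    · have := h.bounds w
      have := R.mem_block w
      omega
  constructor
  · rcases R.start v with h3 | ⟨w, h3, h4, -⟩
    · omega
    · have := h.bounds w
      have := R.mem_block w
      omega
  constructor
  · rcases R.turn v with h3 | ⟨w, h3, h4, -⟩
    · omega
    · have := h.bounds w
      have := R.mem_block w
      omega
  · rcases R.turn v with h3 | ⟨w, h3, h4, -⟩
    · omega
    · have := h.bounds w
      have := R.mem_block w
      omega

/-- These numbers are also computed for blocks without a start, where they are not used but have to
respect the memory bound. This is why the estimates are weaker than those of `idx_facts`. -/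
theorem Represents.idx_mem (h : Represents R s) (v : Fin n) : 0 ≤ R.idx v ∧ R.idx v ≤ n ∧
    |R.part (R.base v)| ≤ 2 * n + 1 := by
  have h1 := h.mem v
  rw [abs_le]
  simp only [RotatedBlocks.idx, RotatedBlocks.part, wrap]
  rcases R.start v with h3 | ⟨w, h3, h4, -⟩
  · split_ifs <;> omega
  · have := h.bounds w
    have := R.mem_block w
    rw [h3] at this
    split_ifs <;> omega

/-- The block of the current vertex is reflected horizontally. -/
def flipXTest : Expr :=
  .and (.read 36 (.read 34 (.var 20)))
    (.and (.read 30 (.read 33 (.read 36 (.read 34 (.var 20)) - 1)))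
      (.lt (.read 36 (.read 34 (.var 20)))
        (.read 32 (.read 30 (.read 33 (.read 36 (.read 34 (.var 20)) - 1)) - 1))))

/-- The block of the current vertex is reflected vertically. -/
def flipYTest : Expr :=
  .and (.read 36 (.read 34 (.var 20)))
    (.and (.read 31 (.read 33 (.read 37 (.read 34 (.var 20)) - 1)))
      (.lt (.read 32 (.read 31 (.read 33 (.read 37 (.read 34 (.var 20)) - 1)) - 1))
        (.read 37 (.read 34 (.var 20)))))

theorem Represents.flipXTest (h : Represents R s) (v : Fin n) :
    flipXTest.eval (s.set 20 0 v) ≠ 0 ↔ R.S (R.base v) ≠ 0 ∧ R.flipX (R.base v) = true := by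
  simp only [WordRAM.flipXTest, Expr.and_ne_zero, Expr.lt_ne_zero, Expr.eval_read, Expr.eval_sub,
    Expr.eval_one, Expr.eval_const, Memory.set_same, Function.update_self,
    Memory.set_ne s (by decide : 36 ≠ 20), Memory.set_ne s (by decide : 34 ≠ 20),
    Memory.set_ne s (by decide : 33 ≠ 20), Memory.set_ne s (by decide : 30 ≠ 20),
    Memory.set_ne s (by decide : 32 ≠ 20), h.base, h.S]
  refine and_congr_right fun h0 => ?_
  obtain ⟨w, -, h2, -⟩ := RotatedBlocks.start_of_S_ne_zero h0
  simp only [RotatedBlocks.flipX, decide_eq_true_iff]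
  rw [h2, add_sub_cancel_right, h.ord]
  constructor
  · rintro ⟨h3, h4⟩
    obtain ⟨i, hi, e⟩ := h.links.out_ne w h3
    have e : w = R.tail i := Fin.ext (by omega)
    rw [e, h.links.out i hi, add_sub_cancel_right, h.pos] at h4
    exact ⟨i, hi, by rw [e], by omega⟩
  · rintro ⟨i, hi, h3, h4⟩
    have e : R.tail i = w := R.pos_inj (by omega)
    rw [← e, h.links.out i hi, add_sub_cancel_right, h.pos]
    constructor <;> omega

theorem Represents.flipYTest (h : Represents R s) (v : Fin n) :
    flipYTest.eval (s.set 20 0 v) ≠ 0 ↔ R.S (R.base v) ≠ 0 ∧ R.flipY (R.base v) = true := by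
  simp only [WordRAM.flipYTest, Expr.and_ne_zero, Expr.lt_ne_zero, Expr.eval_read, Expr.eval_sub,
    Expr.eval_one, Expr.eval_const, Memory.set_same, Function.update_self,
    Memory.set_ne s (by decide : 36 ≠ 20), Memory.set_ne s (by decide : 34 ≠ 20),
    Memory.set_ne s (by decide : 33 ≠ 20), Memory.set_ne s (by decide : 31 ≠ 20),
    Memory.set_ne s (by decide : 37 ≠ 20),
    Memory.set_ne s (by decide : 32 ≠ 20), h.base, h.S, h.T]
  refine and_congr_right fun h0 => ?_
  obtain ⟨w, -, h2, -⟩ := RotatedBlocks.turn_of_S_ne_zero h0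
  simp only [RotatedBlocks.flipY, decide_eq_true_iff]
  rw [h2, add_sub_cancel_right, h.ord]
  constructor
  · rintro ⟨h3, h4⟩
    obtain ⟨i, hi, e⟩ := h.links.inn_ne w h3
    have e : w = R.head i := Fin.ext (by omega)
    rw [e, h.links.inn i hi, add_sub_cancel_right, h.pos] at h4
    exact ⟨i, hi, by rw [e], by omega⟩
  · rintro ⟨i, hi, h3, h4⟩
    have e : R.head i = w := R.pos_inj (by omega)
    rw [← e, h.links.inn i hi, add_sub_cancel_right, h.pos]
    constructor <;> omega

/-- Computes the indices in the rotated blocks. -/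
def indices : Program :=
  .seq (.fill 20 0 42 flipXTest 1 0)
  (.seq (.fill 20 0 43 flipYTest 1 0)
  (.seq (.fill 20 0 44 (.lt (.read 32 (.var 20)) (.read 36 (.read 34 (.var 20))))
    (.read 32 (.var 20) - .read 36 (.read 34 (.var 20)) + .read 35 (.read 34 (.var 20)))
    (.read 32 (.var 20) - .read 36 (.read 34 (.var 20))))
  (.fill 20 0 45 (.lt (.read 37 (.read 34 (.var 20))) (.read 36 (.read 34 (.var 20))))
    (.read 37 (.read 34 (.var 20)) - .read 36 (.read 34 (.var 20)) +
      .read 35 (.read 34 (.var 20)) + 1)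
    (.read 37 (.read 34 (.var 20)) - .read 36 (.read 34 (.var 20)) + 1))))

theorem runs_indices {W : ℕ} (h : Represents R s) (hW : 64 * (n + 1) ≤ W) :
    Runs W indices s (4 * n) (fun s' => Represents R s' ∧ ∀ v : Fin n,
      (s' 42 v ≠ 0 ↔ R.S (R.base v) ≠ 0 ∧ R.flipX (R.base v) = true) ∧
      (s' 43 v ≠ 0 ↔ R.S (R.base v) ≠ 0 ∧ R.flipY (R.base v) = true) ∧
      s' 44 v = R.idx v ∧ s' 45 v = R.part (R.base v)) := by
  classical
  refine (Runs.fillFin (n := n) (fun v => if R.S (R.base v) ≠ 0 ∧ R.flipX (R.base v) = true then 1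
    else 0) h.size.1 (by omega) fun v => ⟨?_, ?_⟩).then (by omega) fun s₁ f₁ h42 => ?_
  · simp only [h.flipXTest, Expr.eval_one, Expr.eval_zero]
  · rw [abs_le]; split_ifs <;> omega
  have r₁ := h.congr (s' := s₁) fun a ha => f₁ a (by revert ha a; decide)
  refine (Runs.fillFin (n := n) (fun v => if R.S (R.base v) ≠ 0 ∧ R.flipY (R.base v) = true then 1
    else 0) r₁.size.1 (by omega) fun v => ⟨?_, ?_⟩).then (by omega) fun s₂ f₂ h43 => ?_
  · simp only [r₁.flipYTest, Expr.eval_one, Expr.eval_zero]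
  · rw [abs_le]; split_ifs <;> omega
  have r₂ := r₁.congr (s' := s₂) fun a ha => f₂ a (by revert ha a; decide)
  refine (Runs.fillFin (n := n) R.idx r₂.size.1 (by omega) fun v => ⟨?_, ?_⟩).then (by omega)
    fun s₃ f₃ h44 => ?_
  · simp [Memory.set, r₂.base, r₂.pos, r₂.S, r₂.len, RotatedBlocks.idx, wrap]
  · have := r₂.idx_mem v
    rw [abs_le]; omega
  have r₃ := r₂.congr (s' := s₃) fun a ha => f₃ a (by revert ha a; decide)
  refine (Runs.fillFin (n := n) (fun v => R.part (R.base v)) r₃.size.1 (by omega)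
    fun v => ⟨?_, ?_⟩).mono (by omega) fun s₄ f₄ h45 => ?_
  · simp [Memory.set, r₃.base, r₃.T, r₃.S, r₃.len, RotatedBlocks.part, wrap]
    split_ifs <;> rfl
  · have := r₂.idx_mem v
    omega
  refine ⟨r₃.congr fun a ha => f₄ a (by revert ha a; decide), fun v => ⟨?_, ?_, ?_, h45 v⟩⟩
  · rw [f₄ 42 (by decide), f₃ 42 (by decide), f₂ 42 (by decide), h42, ite_one_ne_zero]
  · rw [f₄ 43 (by decide), f₃ 43 (by decide), h43, ite_one_ne_zero]
  · rw [f₄ 44 (by decide), h44]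

/-- Computes the coordinates of the vertices. -/
def placeVertices : Program :=
  .seq indices
  (.seq (.fill 20 0 46 (.read 42 (.var 20))
    (.read 34 (.var 20) + (.read 35 (.read 34 (.var 20)) - 1 - .read 44 (.var 20)))
    (.read 34 (.var 20) + .read 44 (.var 20)))
  (.seq (.fill 20 0 47 (.read 36 (.read 34 (.var 20))) (.read 46 (.var 20))
    (.read 32 (.var 20) - 1))
  (.seq (.fill 20 0 48 (.lt (.read 44 (.var 20)) (.read 45 (.var 20)))
    (.read 35 (.read 34 (.var 20)) - .read 45 (.var 20) + .read 44 (.var 20))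
    (.read 44 (.var 20) - .read 45 (.var 20)))
  (.seq (.fill 20 0 49 (.read 43 (.var 20))
    (.read 34 (.var 20) + (.read 35 (.read 34 (.var 20)) - 1 - .read 48 (.var 20)))
    (.read 34 (.var 20) + .read 48 (.var 20)))
  (.seq (.fill 20 0 50 (.read 36 (.read 34 (.var 20))) (.read 49 (.var 20))
    (.read 32 (.var 20) - 1))
  (.seq (.fill 20 0 3 1 (.read 47 (.var 20) + .read 47 (.var 20) + .read 47 (.var 20) +
    .read 47 (.var 20)) 0)
  (.fill 20 0 4 1 (.read 50 (.var 20) + .read 50 (.var 20) + .read 50 (.var 20) +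
    .read 50 (.var 20)) 0)))))))

theorem runs_placeVertices {W : ℕ} (h : Represents R s) (hW : 64 * (n + 1) ≤ W) :
    Runs W placeVertices s (11 * n) (fun s' => Represents R s' ∧ ∀ v : Fin n,
      s' 47 v = R.X v ∧ s' 50 v = R.Y v ∧ s' 3 v = 4 * R.X v ∧ s' 4 v = 4 * R.Y v) := by
  refine (runs_indices h hW).then (by omega) fun s₁ f₁ ⟨r₁, h₁⟩ => ?_
  refine (Runs.fillFin (n := n) (fun v => if s₁ 42 v ≠ 0 then
      R.base v + (R.len (R.base v) - 1 - R.idx v) else R.base v + R.idx v)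
    r₁.size.1 (by omega) fun v => ⟨?_, ?_⟩).then (by omega) fun s₂ f₂ h₂ => ?_
  · simp [Memory.set, r₁.base, r₁.len, (h₁ v).2.2.1]
  · have := r₁.idx_mem v
    have := r₁.mem v
    rw [abs_le]; split_ifs <;> omega
  have r₂ := r₁.congr (s' := s₂) fun a ha => f₂ a (by revert ha a; decide)
  have e42 : s₂ 42 = s₁ 42 := f₂ 42 (by decide)
  have e43 : s₂ 43 = s₁ 43 := f₂ 43 (by decide)
  have e44 : s₂ 44 = s₁ 44 := f₂ 44 (by decide)
  have e45 : s₂ 45 = s₁ 45 := f₂ 45 (by decide)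
  refine (Runs.fillFin (n := n) R.X r₂.size.1 (by omega) fun v => ⟨?_, ?_⟩).then (by omega)
    fun s₃ f₃ h₃ => ?_
  · simp only [Expr.eval_read, Expr.eval_sub, Expr.eval_one, Expr.eval_const, Memory.set_same,
      Function.update_self, Memory.set_ne s₂ (by decide : 36 ≠ 20),
      Memory.set_ne s₂ (by decide : 34 ≠ 20), Memory.set_ne s₂ (by decide : 32 ≠ 20),
      Memory.set_ne s₂ (by decide : 46 ≠ 20), r₂.base, r₂.S, r₂.pos, h₂, (h₁ v).1,
      RotatedBlocks.X, reflect]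
    by_cases h0 : R.S (R.base v) = 0 <;> by_cases h1 : R.flipX (R.base v) = true <;> simp [h0, h1]
  · have := R.X_mem v
    have := r₁.mem v
    rw [abs_le]; omega
  have r₃ := r₂.congr (s' := s₃) fun a ha => f₃ a (by revert ha a; decide)
  have a43 : s₃ 43 = s₁ 43 := by rw [f₃ 43 (by decide), e43]
  have a44 : s₃ 44 = s₁ 44 := by rw [f₃ 44 (by decide), e44]
  have a45 : s₃ 45 = s₁ 45 := by rw [f₃ 45 (by decide), e45]
  refine (Runs.fillFin (n := n) (fun v => if R.idx v < R.part (R.base v) then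
      R.len (R.base v) - R.part (R.base v) + R.idx v else R.idx v - R.part (R.base v))
    r₃.size.1 (by omega) fun v => ⟨?_, ?_⟩).then (by omega) fun s₄ f₄ h₄ => ?_
  · simp [Memory.set, r₃.base, r₃.len, a44, a45, (h₁ v).2.2.1, (h₁ v).2.2.2]
  · have := r₁.idx_mem v
    have := r₁.mem v
    rw [abs_le] at *
    split_ifs <;> omega
  have r₄ := r₃.congr (s' := s₄) fun a ha => f₄ a (by revert ha a; decide)
  have b43 : s₄ 43 = s₁ 43 := by rw [f₄ 43 (by decide), a43]
  refine (Runs.fillFin (n := n) (fun v => if s₁ 43 v ≠ 0 then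
      R.base v + (R.len (R.base v) - 1 - s₄ 48 v) else R.base v + s₄ 48 v)
    r₄.size.1 (by omega) fun v => ⟨?_, ?_⟩).then (by omega) fun s₅ f₅ h₅ => ?_
  · simp [Memory.set, r₄.base, r₄.len, b43]
  · have := r₁.idx_mem v
    have := r₁.mem v
    rw [h₄, abs_le] at *
    split_ifs <;> omega
  have r₅ := r₄.congr (s' := s₅) fun a ha => f₅ a (by revert ha a; decide)
  refine (Runs.fillFin (n := n) R.Y r₅.size.1 (by omega) fun v => ⟨?_, ?_⟩).then (by omega)
    fun s₆ f₆ h₆ => ?_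
  · simp only [Expr.eval_read, Expr.eval_sub, Expr.eval_one, Expr.eval_const, Memory.set_same,
      Function.update_self, Memory.set_ne s₅ (by decide : 36 ≠ 20),
      Memory.set_ne s₅ (by decide : 34 ≠ 20), Memory.set_ne s₅ (by decide : 32 ≠ 20),
      Memory.set_ne s₅ (by decide : 49 ≠ 20), r₅.base, r₅.S, r₅.pos, h₅, h₄, (h₁ v).2.1,
      RotatedBlocks.Y, reflect]
    by_cases h0 : R.S (R.base v) = 0 <;> by_cases h1 : R.flipY (R.base v) = true <;> simp [h0, h1]
  · have := R.Y_mem v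
    have := r₁.mem v
    rw [abs_le]; omega
  have r₆ := r₅.congr (s' := s₆) fun a ha => f₆ a (by revert ha a; decide)
  have e47 : s₆ 47 = s₃ 47 := by rw [f₆ 47 (by decide), f₅ 47 (by decide), f₄ 47 (by decide)]
  -- The factor four is obtained by repeated addition, so that the program remains free of
  -- multiplication.
  refine (Runs.fillFin (n := n) (fun v => 4 * R.X v) r₆.size.1 (by omega)
    fun v => ⟨?_, ?_⟩).then (by omega) fun s₇ f₇ h₇ => ?_
  · simp [Memory.set, e47, h₃]; ring
  · have := R.X_mem v
    have := r₁.mem v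
    rw [abs_le]; omega
  have r₇ := r₆.congr (s' := s₇) fun a ha => f₇ a (by revert ha a; decide)
  have e50 : s₇ 50 = s₆ 50 := f₇ 50 (by decide)
  refine (Runs.fillFin (n := n) (fun v => 4 * R.Y v) r₇.size.1 (by omega)
    fun v => ⟨?_, ?_⟩).mono (by omega) fun s₈ f₈ h₈ => ?_
  · simp [Memory.set, e50, h₆]; ring
  · have := R.Y_mem v
    have := r₁.mem v
    rw [abs_le]; omega
  refine ⟨r₇.congr fun a ha => f₈ a (by revert ha a; decide), fun v => ⟨?_, ?_, ?_, h₈ v⟩⟩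
  · rw [f₈ 47 (by decide), f₇ 47 (by decide), e47, h₃]
  · rw [f₈ 50 (by decide), e50, h₆]
  · rw [f₈ 3 (by decide), h₇]

end

end WordRAM

/-! ### Computing the bends -/

namespace WordRAM

/-- The tail of the current arc. -/
def tailExpr : Expr := .read 24 (.var 20)

/-- The head of the current arc. -/
def headExpr : Expr := .read 25 (.var 20)

/-- The start of the block of the tail of the current arc. -/
def startExpr : Expr := .read 36 (.read 34 tailExpr)

/-- The turn of the block of the tail of the current arc. -/
def turnExpr : Expr := .read 37 (.read 34 tailExpr)

/-- The current arc has a bend. -/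
def bentTest : Expr :=
  .or (.not (.read 12 (.var 20)))
    (.or (.and (.not startExpr) (.eq (.read 32 headExpr - 1) (.read 34 tailExpr)))
      (.and startExpr (.or (.eq (.read 32 tailExpr) turnExpr) (.eq (.read 32 headExpr) startExpr))))

/-- Computes the horizontal shifts of the bends. -/
def shiftX : Program :=
  .seq (.fill 20 21 51 (.lt (.read 47 tailExpr) (.read 47 headExpr)) 1 (0 - 1))
  (.seq (.fill 20 21 52 (.eq (.read 32 tailExpr) turnExpr) 0 (.read 51 (.var 20)))
  (.seq (.fill 20 21 53 startExpr (.read 52 (.var 20)) 1)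
  (.fill 20 21 54 (.read 12 (.var 20)) (.read 53 (.var 20)) 0)))

/-- Computes the vertical shifts of the bends. -/
def shiftY : Program :=
  .seq (.fill 20 21 55 (.lt (.read 50 headExpr) (.read 50 tailExpr)) 1 (0 - 1))
  (.seq (.fill 20 21 56 (.eq (.read 32 headExpr) startExpr) 0 (.read 55 (.var 20)))
  (.seq (.fill 20 21 57 startExpr (.read 56 (.var 20)) (0 - 1))
  (.fill 20 21 58 (.read 12 (.var 20)) (.read 57 (.var 20)) 0)))

/-- Computes the bends. -/
def placeBends : Program :=
  .seq shiftX
  (.seq shiftY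
  (.seq (.fill 20 21 5 bentTest 1 0)
  (.seq (.fill 20 21 6 (.read 12 (.var 20)) (.read 3 tailExpr + .read 54 (.var 20))
    (.read 3 headExpr + .read 54 (.var 20)))
  (.fill 20 21 7 (.read 12 (.var 20)) (.read 4 headExpr + .read 58 (.var 20))
    (.read 4 tailExpr + .read 58 (.var 20))))))

variable {n m : ℕ} {R : RotatedBlocks n m} {s : Memory}

theorem Represents.tailExpr (h : Represents R s) (i : Fin m) :
    tailExpr.eval (s.set 20 0 i) = R.tail i := by
  simp [WordRAM.tailExpr, Memory.set, h.tail]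

theorem Represents.headExpr (h : Represents R s) (i : Fin m) :
    headExpr.eval (s.set 20 0 i) = R.head i := by
  simp [WordRAM.headExpr, Memory.set, h.head]

theorem Represents.startExpr (h : Represents R s) (i : Fin m) :
    startExpr.eval (s.set 20 0 i) = R.S (R.base (R.tail i)) := by
  simp [WordRAM.startExpr, Memory.set_ne, h.tailExpr, h.base, h.S]

theorem Represents.turnExpr (h : Represents R s) (i : Fin m) :
    turnExpr.eval (s.set 20 0 i) = R.T (R.base (R.tail i)) := by
  simp [WordRAM.turnExpr, Memory.set_ne, h.tailExpr, h.base, h.T]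

theorem Represents.bentTest (h : Represents R s) (i : Fin m) :
    bentTest.eval (s.set 20 0 i) ≠ 0 ↔ R.Bent i := by
  have hF := h.F i
  simp only [WordRAM.bentTest, Expr.or_ne_zero, Expr.and_ne_zero, Expr.not_ne_zero,
    Expr.eq_ne_zero, Expr.eval_read, Expr.eval_sub, Expr.eval_one, Expr.eval_const,
    h.tailExpr, h.headExpr, h.startExpr, h.turnExpr, Memory.set_same, Function.update_self,
    Memory.set_ne s (by decide : 12 ≠ 20), Memory.set_ne s (by decide : 32 ≠ 20),
    Memory.set_ne s (by decide : 34 ≠ 20), h.pos, h.base, RotatedBlocks.Bent, add_sub_cancel_right]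
  rw [← not_not (a := s 12 i = 0), ← ne_eq, hF]
  by_cases h1 : R.F i <;> by_cases h2 : R.S (R.base (R.tail i)) = 0 <;> simp [h1, h2]

theorem runs_shiftX {W : ℕ} (h : Represents R s) (hW : m + 1 ≤ W)
    (hX : ∀ v : Fin n, s 47 v = R.X v) :
    Runs W shiftX s (4 * m) (fun s' => ∀ i : Fin m, |s' 54 i| ≤ 1 ∧ s' 54 i = R.layout.α i) := by
  classical
  refine (Runs.fillFin (n := m) (fun i => if R.X (R.tail i) < R.X (R.head i) then 1 else -1)
    h.size.2 (by omega) fun i => ⟨?_, ?_⟩).then (by omega) fun s₁ f₁ h₁ => ?_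
  · simp [Memory.set_ne, h.tailExpr, h.headExpr, hX]
  · rw [abs_le]; split_ifs <;> omega
  have r₁ := h.congr (s' := s₁) fun a ha => f₁ a (by revert ha a; decide)
  refine (Runs.fillFin (n := m) (fun i => if R.pos (R.tail i) + 1 = R.T (R.base (R.tail i)) then 0
    else s₁ 51 i) r₁.size.2 (by omega) fun i => ⟨?_, ?_⟩).then (by omega) fun s₂ f₂ h₂ => ?_
  · simp [Memory.set, r₁.tailExpr, r₁.turnExpr, r₁.pos]
  · rw [h₁, abs_le]; split_ifs <;> omega
  have r₂ := r₁.congr (s' := s₂) fun a ha => f₂ a (by revert ha a; decide)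
  refine (Runs.fillFin (n := m) (fun i => if R.S (R.base (R.tail i)) = 0 then 1
    else s₂ 52 i) r₂.size.2 (by omega) fun i => ⟨?_, ?_⟩).then (by omega) fun s₃ f₃ h₃ => ?_
  · simp [Memory.set, r₂.startExpr]
  · rw [h₂, h₁, abs_le]; split_ifs <;> omega
  have r₃ := r₂.congr (s' := s₃) fun a ha => f₃ a (by revert ha a; decide)
  -- The three passes so far mirror the nested case distinction in the definition of `α`, from the
  -- inside outwards.
  have key : ∀ i, (if R.F i then s₃ 53 i else 0) = R.layout.α i := fun i => by
    simp only [RotatedBlocks.layout, h₃, h₂, h₁]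
  refine (Runs.fillFin (n := m) R.layout.α r₃.size.2 (by omega)
    fun i => ⟨?_, ?_⟩).mono (by omega) fun s₄ f₄ h₄ i => ?_
  · rw [← key]
    simp only [Expr.eval_read, Memory.set_ne s₃ (by decide : 12 ≠ 20), Expr.eval_const,
      Memory.set_same, Function.update_self, r₃.F, Memory.set_ne s₃ (by decide : 53 ≠ 20),
      Expr.eval_zero]
  · rw [← key, h₃, h₂, h₁, abs_le]; split_ifs <;> omega
  · rw [h₄]
    refine ⟨?_, rfl⟩
    rw [← key, h₃, h₂, h₁, abs_le]; split_ifs <;> omega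

theorem runs_shiftY {W : ℕ} (h : Represents R s) (hW : m + 1 ≤ W)
    (hY : ∀ v : Fin n, s 50 v = R.Y v) :
    Runs W shiftY s (4 * m) (fun s' => ∀ i : Fin m, |s' 58 i| ≤ 1 ∧ s' 58 i = R.layout.β i) := by
  classical
  refine (Runs.fillFin (n := m) (fun i => if R.Y (R.head i) < R.Y (R.tail i) then 1 else -1)
    h.size.2 (by omega) fun i => ⟨?_, ?_⟩).then (by omega) fun s₁ f₁ h₁ => ?_
  · simp [Memory.set_ne, h.tailExpr, h.headExpr, hY]
  · rw [abs_le]; split_ifs <;> omega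
  have r₁ := h.congr (s' := s₁) fun a ha => f₁ a (by revert ha a; decide)
  refine (Runs.fillFin (n := m) (fun i => if R.pos (R.head i) + 1 = R.S (R.base (R.tail i)) then 0
    else s₁ 55 i) r₁.size.2 (by omega) fun i => ⟨?_, ?_⟩).then (by omega) fun s₂ f₂ h₂ => ?_
  · simp [Memory.set, r₁.headExpr, r₁.startExpr, r₁.pos]
  · rw [h₁, abs_le]; split_ifs <;> omega
  have r₂ := r₁.congr (s' := s₂) fun a ha => f₂ a (by revert ha a; decide)
  refine (Runs.fillFin (n := m) (fun i => if R.S (R.base (R.tail i)) = 0 then -1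
    else s₂ 56 i) r₂.size.2 (by omega) fun i => ⟨?_, ?_⟩).then (by omega) fun s₃ f₃ h₃ => ?_
  · simp [Memory.set, r₂.startExpr]
  · rw [h₂, h₁, abs_le]; split_ifs <;> omega
  have r₃ := r₂.congr (s' := s₃) fun a ha => f₃ a (by revert ha a; decide)
  have key : ∀ i, (if R.F i then s₃ 57 i else 0) = R.layout.β i := fun i => by
    simp only [RotatedBlocks.layout, h₃, h₂, h₁]
  refine (Runs.fillFin (n := m) R.layout.β r₃.size.2 (by omega)
    fun i => ⟨?_, ?_⟩).mono (by omega) fun s₄ f₄ h₄ i => ?_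
  · rw [← key]
    simp only [Expr.eval_read, Memory.set_ne s₃ (by decide : 12 ≠ 20), Expr.eval_const,
      Memory.set_same, Function.update_self, r₃.F, Memory.set_ne s₃ (by decide : 57 ≠ 20),
      Expr.eval_zero]
  · rw [← key, h₃, h₂, h₁, abs_le]; split_ifs <;> omega
  · rw [h₄]
    refine ⟨?_, rfl⟩
    rw [← key, h₃, h₂, h₁, abs_le]; split_ifs <;> omega

theorem runs_placeBends {W : ℕ} (h : Represents R s) (hW : 64 * (n + 1) ≤ W) (hm : m + 1 ≤ W)
    (hp : ∀ v : Fin n, s 47 v = R.X v ∧ s 50 v = R.Y v ∧ s 3 v = 4 * R.X v ∧ s 4 v = 4 * R.Y v) :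
    Runs W placeBends s (11 * m) (fun s' => ∀ i : Fin m, (s' 5 i ≠ 0 ↔ R.layout.bent i) ∧
      s' 6 i = 4 * R.X (R.layout.c i) + R.layout.α i ∧
      s' 7 i = 4 * R.Y (R.layout.a i) + R.layout.β i) := by
  classical
  refine (runs_shiftX h hm fun v => (hp v).1).then (by omega) fun s₁ f₁ h₁ => ?_
  have r₁ := h.congr (s' := s₁) fun a ha => f₁ a (by revert ha a; decide)
  refine (runs_shiftY r₁ hm fun v => by rw [f₁ 50 (by decide)]; exact (hp v).2.1).then (by omega)
    fun s₂ f₂ h₂ => ?_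
  have r₂ := r₁.congr (s' := s₂) fun a ha => f₂ a (by revert ha a; decide)
  refine (Runs.fillFin (n := m) (fun i => if R.Bent i then 1 else 0)
    r₂.size.2 (by omega) fun i => ⟨?_, ?_⟩).then (by omega) fun s₃ f₃ h₃ => ?_
  · simp only [r₂.bentTest, Expr.eval_one, Expr.eval_zero]
  · rw [abs_le]; split_ifs <;> omega
  have r₃ := r₂.congr (s' := s₃) fun a ha => f₃ a (by revert ha a; decide)
  have e54 : s₃ 54 = s₁ 54 := by rw [f₃ 54 (by decide), f₂ 54 (by decide)]
  have e3 : s₃ 3 = s 3 := by rw [f₃ 3 (by decide), f₂ 3 (by decide), f₁ 3 (by decide)]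
  refine (Runs.fillFin (n := m) (fun i => 4 * R.X (R.layout.c i) + R.layout.α i)
    r₃.size.2 (by omega) fun i => ⟨?_, ?_⟩).then (by omega) fun s₄ f₄ h₄ => ?_
  · simp only [Expr.eval_read, Memory.set_ne s₃ (by decide : 12 ≠ 20), Expr.eval_const,
      Memory.set_same, Function.update_self, r₃.F, Memory.set_ne s₃ (by decide : 54 ≠ 20),
      Memory.set_ne s₃ (by decide : 3 ≠ 20), Expr.eval_add, r₃.tailExpr, r₃.headExpr, e54, e3,
      (hp _).2.2.1, (h₁ i).2]
    by_cases hi : R.F i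
    · rw [if_pos hi, RotatedBlocks.F_c hi]
    · rw [if_neg hi, RotatedBlocks.not_F_c hi]
  · have := R.X_mem (R.layout.c i)
    have := r₁.mem (R.layout.c i)
    have := h₁ i
    rw [abs_le] at *
    omega
  have r₄ := r₃.congr (s' := s₄) fun a ha => f₄ a (by revert ha a; decide)
  have e58 : s₄ 58 = s₂ 58 := by rw [f₄ 58 (by decide), f₃ 58 (by decide)]
  have e4 : s₄ 4 = s 4 := by
    rw [f₄ 4 (by decide), f₃ 4 (by decide), f₂ 4 (by decide), f₁ 4 (by decide)]
  refine (Runs.fillFin (n := m) (fun i => 4 * R.Y (R.layout.a i) + R.layout.β i)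
    r₄.size.2 (by omega) fun i => ⟨?_, ?_⟩).mono (by omega) fun s₅ f₅ h₅ i => ⟨?_, ?_, h₅ i⟩
  · simp only [Expr.eval_read, Memory.set_ne s₄ (by decide : 12 ≠ 20), Expr.eval_const,
      Memory.set_same, Function.update_self, r₄.F, Memory.set_ne s₄ (by decide : 58 ≠ 20),
      Memory.set_ne s₄ (by decide : 4 ≠ 20), Expr.eval_add, r₄.tailExpr, r₄.headExpr, e58, e4,
      (hp _).2.2.2, (h₂ i).2]
    by_cases hi : R.F i
    · rw [if_pos hi, RotatedBlocks.F_a hi]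
    · rw [if_neg hi, RotatedBlocks.not_F_a hi]
  · have := R.Y_mem (R.layout.a i)
    have := r₁.mem (R.layout.a i)
    have := h₂ i
    rw [abs_le] at *
    omega
  · rw [f₅ 5 (by decide), f₄ 5 (by decide), h₃, ite_one_ne_zero]
    rfl
  · rw [f₅ 6 (by decide), h₄]

end WordRAM

/-! ### The complete algorithm -/

/-- Handshake lemma: the degrees sum to `2 * m` and are at most four. This turns all bounds in `m`
into bounds in `n`. -/
theorem IsEdgeList.card_le {n m : ℕ} {G : SimpleGraph (Fin n)} [DecidableRel G.Adj]
    {E : Fin m → Fin n × Fin n} (hE : IsEdgeList G E) (hG : G.maxDegree ≤ 4) : m ≤ 2 * n := by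
  have h1 : G.edgeFinset.card = m := by
    have : G.edgeFinset = Finset.univ.image (listedEdge E) := by
      rw [← Finset.coe_inj, SimpleGraph.coe_edgeFinset, ← hE.2]
      simp
    rw [this, Finset.card_image_of_injective _ hE.1]
    simp
  have h2 := G.sum_degrees_eq_twice_card_edges
  have h3 := Finset.sum_le_card_nsmul Finset.univ (fun v => G.degree v) 4
    fun v _ => (G.degree_le_maxDegree v).trans hG
  rw [Finset.card_univ, Fintype.card_fin, smul_eq_mul] at h3
  omega

namespace WordRAM

/-- Computes the drawing. -/
def drawGraph : Program :=
  .seq splitEdges (.seq findBlocks (.seq placeVertices placeBends))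

/-- The four stages make at most `50 * m`, `m + 8 * n`, `11 * n` and `11 * m` iterations; with `m ≤
2 * n` this is at most `143 * n`. -/
theorem runs_drawGraph {W n m : ℕ} {G : SimpleGraph (Fin n)} [DecidableRel G.Adj]
    {E : Fin m → Fin n × Fin n} (hG : G.maxDegree ≤ 4) (hE : IsEdgeList G E)
    (hW : 64 * (n + 1) ≤ W) :
    Runs W drawGraph (inputMemory E) (143 * n) (fun s => ∃ R : RotatedBlocks n m,
      (∀ i, s(R.tail i, R.head i) = listedEdge E i) ∧
      (∃ _ : DecidablePred R.F, m ≤ 2 * (Finset.univ.filter R.F).card) ∧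
      (∀ v : Fin n, (s 3 v, s 4 v) = R.layout.place v ∧ 0 ≤ R.X v ∧ R.X v < n ∧ 0 ≤ R.Y v ∧
        R.Y v < n) ∧
      ∀ i : Fin m, (s 5 i ≠ 0 ↔ R.layout.bent i) ∧ (s 6 i, s 7 i) = R.layout.bendPoint i) := by
  have hm := hE.card_le hG
  refine (runs_splitEdges hG hE (by omega)).then (by omega)
    fun s₁ f₁ ⟨h21, tail, head, F, _, hs, he, ht, hh, hF⟩ => ?_
  have hd : ∀ i j, i ≠ j → s(tail i, head i) ≠ s(tail j, head j) := fun i j hij e => by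
    rw [he, he] at e
    exact hij (hE.1 e)
  have hne : ∀ i, tail i ≠ head i := fun i e => by
    have h1 := IsEdgeList.adj hE i
    rw [← SimpleGraph.mem_edgeSet] at h1
    change listedEdge E i ∈ _ at h1
    rw [← he i, SimpleGraph.mem_edgeSet, e] at h1
    exact h1.ne rfl
  refine (runs_findBlocks (n := n) (by rw [f₁ 0 (by decide)]; simp [inputMemory]) h21 (by omega) hs
    hd hne ht hh fun a ha v => ?_).then (by omega) fun s₂ f₂ ⟨R, e1, e2, e3, r₂⟩ => ?_
  · rw [f₁ a (by revert ha a; decide), inputMemory_eq_zero E (by revert ha a; decide)]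
  subst e1 e2 e3
  refine (runs_placeVertices r₂ hW).then (by omega) fun s₃ f₃ ⟨r₃, h₃⟩ => ?_
  refine (runs_placeBends r₃ hW (by omega) h₃).mono (by omega) fun s₄ f₄ h₄ => ?_
  refine ⟨R, he, ⟨_, hF⟩, fun v => ?_, fun i => ⟨(h₄ i).1, ?_⟩⟩
  · rw [f₄ 3 (by decide), f₄ 4 (by decide), (h₃ v).2.2.1, (h₃ v).2.2.2]
    have := r₃.mem v
    have := R.X_mem v
    have := R.Y_mem v
    exact ⟨rfl, by omega, by omega, by omega, by omega⟩
  · rw [(h₄ i).2.1, (h₄ i).2.2]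
    rfl

end WordRAM

/-! ### Reading off the drawing, its area and its straight edges -/

namespace OneBendDrawing

open Classical in
/-- The drawing of the graph with edge list `E` that the memory `s` holds. -/
noncomputable def ofMemory {n m : ℕ} (E : Fin m → Fin n × Fin n) (s : WordRAM.Memory) :
    OneBendDrawing (Fin n) where
  pos v := (s 3 v, s 4 v)
  bend e := if h : ∃ i, listedEdge E i = e then
    (if s 5 h.choose = 0 then none else some (s 6 h.choose, s 7 h.choose)) else none

theorem holdsDrawing_ofMemory {n m : ℕ} {E : Fin m → Fin n × Fin n}
    (hE : Function.Injective (listedEdge E)) (s : WordRAM.Memory) :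
    HoldsDrawing E s (ofMemory E s) := by
  refine ⟨fun v => rfl, fun i => ?_⟩
  have h : ∃ j, listedEdge E j = listedEdge E i := ⟨i, rfl⟩
  simp only [ofMemory]
  rw [dif_pos h, hE h.choose_spec]

theorem extent_le {S : Set ℤ} (hS : S.Nonempty) {a b : ℤ} (h : ∀ x ∈ S, a ≤ x ∧ x ≤ b) :
    sSup S - sInf S ≤ b - a :=
  sub_le_sub (csSup_le hS fun x hx => (h x hx).2) (le_csInf hS fun x hx => (h x hx).1)

theorem area_le {V : Type*} [Nonempty V] {G : SimpleGraph V} {D : OneBendDrawing V} {a b : ℤ}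
    (h : ∀ p ∈ D.points G, a ≤ p.1 ∧ p.1 ≤ b ∧ a ≤ p.2 ∧ p.2 ≤ b) :
    D.area G ≤ (b - a + 1) ^ 2 := by
  have hne : (D.points G).Nonempty := ⟨_, Or.inl ⟨Classical.arbitrary V, rfl⟩⟩
  have h1 := extent_le (hne.image Prod.fst) (a := a) (b := b) (by
    rintro _ ⟨p, hp, rfl⟩
    exact ⟨(h p hp).1, (h p hp).2.1⟩)
  have h2 := extent_le (hne.image Prod.snd) (a := a) (b := b) (by
    rintro _ ⟨p, hp, rfl⟩
    exact ⟨(h p hp).2.2.1, (h p hp).2.2.2⟩)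
  have hab : a ≤ b := by
    obtain ⟨p, hp⟩ := hne
    exact (h p hp).1.trans (h p hp).2.1
  have h3 : 0 ≤ D.height G + 1 := by
    obtain ⟨p, hp⟩ := hne
    have hb : BddAbove (Prod.snd '' D.points G) := ⟨b, by
      rintro _ ⟨p, hp, rfl⟩
      exact (h p hp).2.2.2⟩
    have hb' : BddBelow (Prod.snd '' D.points G) := ⟨a, by
      rintro _ ⟨p, hp, rfl⟩
      exact (h p hp).2.2.1⟩
    have h4 := le_csSup hb ⟨p, hp, rfl⟩
    have h5 := csInf_le hb' ⟨p, hp, rfl⟩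
    simp only [height]
    omega
  rw [area, sq]
  exact mul_le_mul (by rw [width]; omega) (by rw [height]; omega) h3 (by omega)

/-- Distinct indices list distinct edges, so counting indices counts edges. -/
theorem le_ncard_straightEdges {n m : ℕ} {G : SimpleGraph (Fin n)} {D : OneBendDrawing (Fin n)}
    {E : Fin m → Fin n × Fin n} (hE : IsEdgeList G E) (S : Finset (Fin m))
    (hS : ∀ i ∈ S, D.bend (listedEdge E i) = none) : S.card ≤ (D.straightEdges G).ncard := by
  classical
  rw [← Finset.card_image_of_injective S hE.1, ← Set.ncard_coe_finset]
  refine Set.ncard_le_ncard (fun e he => ?_) (Set.toFinite _)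
  obtain ⟨i, hi, rfl⟩ := Finset.mem_image.1 (Finset.mem_coe.1 he)
  exact ⟨hE.2 ▸ Set.mem_range_self i, hS i hi⟩

end OneBendDrawing

theorem mainTheorem6 :
    ∃ (P : WordRAM.Program) (c : ℕ),
      ∀ (n m : ℕ) (G : SimpleGraph (Fin n)) [DecidableRel G.Adj] (E : Fin m → Fin n × Fin n),
        0 < n → G.maxDegree ≤ 4 → IsEdgeList G E →
        ∃ (t : ℕ) (s : WordRAM.Memory) (D : OneBendDrawing (Fin n)),
          WordRAM.Exec ((n + 1) ^ c) P (inputMemory E) t s ∧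
          t ≤ c * n ∧
          HoldsDrawing E s D ∧
          D.IsRAC G ∧
          D.area G ≤ (c : ℤ) * (n : ℤ) ^ 2 ∧
          (m : ℝ) / 8 ≤ ((D.straightEdges G).ncard : ℝ) := by
  classical
  -- One constant serves three purposes: `64 * weight + 1` is a sufficient exponent for the word
  -- size, `144 * size` bounds the time per vertex, and `16` the area.
  refine ⟨WordRAM.drawGraph,
    64 * WordRAM.drawGraph.weight + 1 + 144 * WordRAM.drawGraph.size + 16, ?_⟩
  have hmul : WordRAM.drawGraph.mulFree = true := by decide
  generalize hP : WordRAM.drawGraph = P at hmul ⊢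
  intro n m G _ E hn hG hE
  obtain ⟨k, s, hs, hk, -, R, hR, ⟨_, hF⟩, hpos, hbend⟩ :=
    WordRAM.runs_drawGraph hG hE (W := 64 * (n + 1)) le_rfl
  rw [hP] at hs
  have hm := hE.card_le hG
  have hB : WordRAM.Memory.Bounded (64 * (n + 1)) (inputMemory E) := by
    intro a i
    rw [abs_le]
    simp only [inputMemory]
    split_ifs <;> omega
  obtain ⟨-, t, ht, htk⟩ := hs.exec (B := (n + 1) ^
      (64 * P.weight + 1 + 144 * P.size + 16)) (by omega) hmul (by
    -- A constant is absorbed into a power of `n + 1`, whose base is at least two because `n` is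
    -- positive.
    calc P.weight * (64 * (n + 1)) = (64 * P.weight) * (n + 1) := by ring
      _ ≤ (n + 1) ^ (64 * P.weight) * (n + 1) := by
        gcongr
        exact (Nat.lt_pow_self (by omega)).le
      _ = (n + 1) ^ (64 * P.weight + 1) := (pow_succ _ _).symm
      _ ≤ _ := Nat.pow_le_pow_right (by omega) (by omega)) hB
  have hD := OneBendDrawing.holdsDrawing_ofMemory hE.1 s
  generalize OneBendDrawing.ofMemory E s = D at hD
  have hac : ∀ i, s(R.layout.a i, R.layout.c i) = listedEdge E i := by
    intro i
    rw [← hR]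
    by_cases h : R.F i
    · rw [RotatedBlocks.F_a h, RotatedBlocks.F_c h, Sym2.eq_swap]
    · rw [RotatedBlocks.not_F_a h, RotatedBlocks.not_F_c h]
  have hdesc : R.layout.Describes G D := by
    refine ⟨fun e => ?_, fun v => by rw [hD.1, (hpos v).1], fun i hi => ?_, fun i hi => ?_⟩
    · simp only [hac, ← hE.2, Set.mem_range]
    · rw [hac, hD.2, if_neg ((hbend i).1.2 hi), (hbend i).2]
    · rw [hac, hD.2, if_pos (not_not.1 fun h => hi ((hbend i).1.1 h))]
  refine ⟨t, s, D, ht, ?_, hD, hdesc.isRAC R.layout_valid, ?_, ?_⟩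
  · calc t ≤ P.size * (k + 1) := htk
      _ ≤ P.size * (144 * n) := Nat.mul_le_mul_left _ (by omega)
      _ = (144 * P.size) * n := by ring
      _ ≤ _ := Nat.mul_le_mul_right _ (by omega)
  · have : Nonempty (Fin n) := ⟨⟨0, hn⟩⟩
    -- Vertices have coordinates between `0` and `4 * (n - 1)`, and shifts of bends add at most one
    -- on either side.
    have hp : ∀ p ∈ D.points G,
        -1 ≤ p.1 ∧ p.1 ≤ 4 * (n : ℤ) - 3 ∧ -1 ≤ p.2 ∧ p.2 ≤ 4 * (n : ℤ) - 3 := by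
      rintro p (⟨v, rfl⟩ | ⟨e, he, hb⟩)
      · have := hpos v
        rw [hdesc.pos]
        simp only [GridLayout.place]
        change _ ∧ 0 ≤ R.layout.X v ∧ R.layout.X v < _ ∧ 0 ≤ R.layout.Y v ∧ R.layout.Y v < _ at this
        omega
      · obtain ⟨i, rfl⟩ := (hdesc.edges e).1 he
        have hi : R.layout.bent i := by
          by_contra hi
          rw [hdesc.none i hi] at hb
          cases hb
        rw [hdesc.bend i hi, Option.some.injEq] at hb
        subst hb
        have h1 := (hpos (R.layout.a i)).2
        have h2 := (hpos (R.layout.c i)).2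
        change 0 ≤ R.layout.X _ ∧ R.layout.X _ < _ ∧ 0 ≤ R.layout.Y _ ∧ R.layout.Y _ < _ at h1 h2
        have h3 := R.layout_valid.half.small i
        have h4 := R.layout_valid.half'.small i
        change R.layout.α i = _ ∨ R.layout.α i = _ ∨ R.layout.α i = _ at h4
        simp only [GridLayout.bendPoint]
        omega
    refine (OneBendDrawing.area_le hp).trans ?_
    push_cast
    have h1 : (0 : ℤ) ≤ P.weight := by positivity
    have h2 : (0 : ℤ) ≤ P.size := by positivity
    have h3 : (1 : ℤ) ≤ n := by exact_mod_cast hn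
    calc (4 * (n : ℤ) - 3 - -1 + 1) ^ 2 ≤ (4 * (n : ℤ)) ^ 2 := by
          gcongr
          · omega
          · omega
      _ = 16 * (n : ℤ) ^ 2 := by ring
      _ ≤ _ := by
        gcongr
        omega
  · have h1 := R.card_F_le
    have h2 := OneBendDrawing.le_ncard_straightEdges hE (D := D)
      (Finset.univ.filter fun j => ¬ R.Bent j) fun i hi => by
        rw [← hac]
        exact hdesc.none i (Finset.mem_filter.1 hi).2
    -- In fact `m` is at most twice the size of `F`, which is at most three times the number of
    -- straight edges, so the factor six would suffice.
    have h3 : m ≤ 8 * (D.straightEdges G).ncard := by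
      have : (Finset.univ.filter R.F).card = (Finset.univ.filter fun j => R.F j).card := by
        congr
      rw [Finset.filter_congr_decidable] at h1
      omega
    have h4 : (m : ℝ) ≤ 8 * ((D.straightEdges G).ncard : ℝ) := by exact_mod_cast h3
    linarith
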